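/- **Setting.** Let $(\mathcal S,\mathcal A,\mathsf P,r,\gamma)$ be a Markov decision process with $0\le r\le r_{\max}$ and $\gamma\in[0,1]$, let $\pi$ be a target policy and $\pi_b$ a behavior policy with importance ratio $\rho(s,a)=\pi(a|s)/\pi_b(a|s)$, and let $\mu=\mu^{\pi_b}$ be a stationary distribution of the state chain under $\pi_b$. Let $V_\theta:\mathcal S\to\mathbb R$, $\theta\in\mathbb R^N$, be twice continuously differentiable in $\theta$, and put $\phi_\theta(s)=\nabla V_\theta(s)$, $\delta_{s,a,s'}(\theta)=r(s,a,s')+\gamma V_\theta(s')-V_\theta(s)$, $A_\theta=\mathbb E_\mu[\phi_\theta(S)\phi_\theta(S)^\top]$. The objective is the mean-square projected Bellman error $$J(\theta)=\mathbb E_{\mu}\big[\,|\mathbf\Pi_\theta(T^\pi V_\theta-V_\theta)(S)|^2\big],$$ where $T^\pi v(s)=\mathbb E[r(s,A,S')+\gamma v(S')\mid A\sim\pi(\cdot|s),S'\sim\mathsf P(\cdot|s,A)]$ and $\mathbf\Pi_\theta$ is the orthogonal projection in $L^2(\mu)$ onto the tangent plane $\{s\mapsto\phi_\theta(s)^\top\zeta:\zeta\in\mathbb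 R^N\}$; equivalently, $J(\theta)=\mathbb E_\mu[\rho\delta(\theta)\phi_\theta]^\top A_\theta^{-1}\,\mathbb E_\mu[\rho\delta(\theta)\phi_\theta]$, with $S\sim\mu$, $A\sim\pi_b(\cdot|S)$, $S'\sim\mathsf P(\cdot|S,A)$ in the expectations. **Assumptions.** There are positive constants $C_v,C_\phi,D_v,L_V,\lambda_v,\rho_{\max}$ such that for all $s,a,\theta,\theta'$: $|V_\theta(s)|\le C_v$, $\|\phi_\theta(s)\|\le C_\phi$, $\|\nabla^2V_\theta(s)\|\le D_v$, $\|\nabla^2V_\theta(s)-\nabla^2V_{\theta'}(s)\|\le L_V\|\theta-\theta'\|$; the smallest eigenvalue of $A_\theta$ is at least $\lambda_v$; $\rho(s,a)\le\rho_{\max}$. In the Markovian case there are moreover $m>0$ and $\kappa\in(0,1)$ with $\sup_s d_{TV}(\mathbb P(s_t=\cdot\mid s_0=s,\pi_b),\mu)\le m\kappa^t$ for all $t>0$. **Algorithm.** Let $R_\omega=\frac{\rho_{\max}C_\phi}{\lambda_v}(r_{\max}+(1+\gamma)C_v)$ and let $\mathbf\Pi_{R_\omega}$ be the projection onto the centered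 ball of radius $R_\omega$. From deterministic $\theta_0,\omega_0\in\mathbb R^N$ and samples $(s_t,a_t,s_t')$, with $\rho_t=\rho(s_t,a_t)$ and $\delta_t=\delta_{s_t,a_t,s_t'}(\theta_t)$, iterate $$\omega_{t+1}=\mathbf\Pi_{R_\omega}\big(\omega_t+\beta(-\phi_{\theta_t}(s_t)\phi_{\theta_t}(s_t)^\top\omega_t+\rho_t\delta_t\phi_{\theta_t}(s_t))\big),$$ $$\theta_{t+1}=\theta_t+\alpha\big(\rho_t\delta_t\phi_{\theta_t}(s_t)-\gamma\rho_t\phi_{\theta_t}(s_t')\phi_{\theta_t}(s_t)^\top\omega_t-(\rho_t\delta_t-\phi_{\theta_t}(s_t)^\top\omega_t)\nabla^2V_{\theta_t}(s_t)\omega_t\big).$$ In the i.i.d. setting the samples are independent with $s_t\sim\mu$, $a_t\sim\pi_b(\cdot|s_t)$, $s_t'\sim\mathsf P(\cdot|s_t,a_t)$. In the Markovian setting $s_t'=s_{t+1}$ and $(s_t,a_t)_{t\ge0}$ is a trajectory under $\pi_b$ with an arbitrary law of $s_0$. The output is $\theta_W$, with $W$ uniform on $\{0,\dots,T-1\}$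 and independent of the samples. **Theorem 1.** Under the assumptions other than ergodicity $J$ is differentiable, and there is a constant $c_0>0$, depending only on $\gamma,r_{\max},C_v,C_\phi,D_v,L_V,\lambda_v,\rho_{\max}$, with the following property. Let $\frac12\le a\le1$, $0<b\le a$ and $c_1,c_2,c_3,c_4>0$. For $T\ge1$ consider step sizes with $c_1T^{-a}\le\alpha\le c_2T^{-a}$ and $c_3T^{-b}\le\beta\le c_4T^{-b}$ and, if $a=b$, also $\alpha\le c_0\beta$. Then $\|\nabla J(\theta_W)\|^2$ is integrable and 1. under i.i.d. sampling, $\ \mathbb E\|\nabla J(\theta_W)\|^2\le C\,\big(T^{-(1-a)}+T^{-b}+T^{-(1-b)}\big)$; 2. under Markovian sampling, $\ \mathbb E\|\nabla J(\theta_W)\|^2\le C\,\big(\log T\cdot T^{-(1-a)}+T^{-(1-b)}+\log T\cdot T^{-b}\big)$, where $C$ depends only on the constants of the assumptions (including $m,\kappa$ in case 2) and on $a,b,c_1,\dots,c_4$. -/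

import Mathlib

open MeasureTheory ProbabilityTheory

universe u v w

noncomputable section

namespace NonlinearTDC

/-- Parameter space `ℝ^N` with the Euclidean norm. -/
abbrev Param (N : ℕ) : Type := EuclideanSpace ℝ (Fin N)

/-! ### The Markov decision process and the two policies -/

/-- A discounted Markov decision process with a target policy `π` and a behavior policy `πb`. -/
structure OffPolicyMDP (S A : Type*) [MeasurableSpace S] [MeasurableSpace A] where
  /-- transition kernel `P(s' | s, a)` -/
  P : Kernel (S × A) S
  /-- target policy `π(a | s)` -/
  π : Kernel S A
  /-- behavior policy `π_b(a | s)` -/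
  πb : Kernel S A
  /-- reward `r(s, a, s')` -/
  r : S × A × S → ℝ
  /-- discount factor -/
  γ : ℝ
  markov_P : IsMarkovKernel P
  markov_π : IsMarkovKernel π
  markov_πb : IsMarkovKernel πb
  measurable_r : Measurable r
  r_nonneg : ∀ x, 0 ≤ r x
  γ_mem : γ ∈ Set.Icc (0 : ℝ) 1

attribute [instance] OffPolicyMDP.markov_P OffPolicyMDP.markov_π OffPolicyMDP.markov_πb

section MDP

variable {S A : Type*} [MeasurableSpace S] [MeasurableSpace A]

/-- Under the behavior policy: from `s`, draw `a ∼ π_b(· | s)` and then `s' ∼ P(· | s, a)`. -/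
def OffPolicyMDP.step (M : OffPolicyMDP S A) : Kernel S (A × S) := M.πb ⊗ₖ M.P

/-- Transition kernel of the state chain induced by the behavior policy. -/
def OffPolicyMDP.stateKernel (M : OffPolicyMDP S A) : Kernel S S := M.step.snd

/-- Law of a sample `(s, a, s')` with `s ∼ μ`, `a ∼ π_b(· | s)`, `s' ∼ P(· | s, a)`. -/
def OffPolicyMDP.sampleLaw (M : OffPolicyMDP S A) (μ : Measure S) : Measure (S × A × S) :=
  μ ⊗ₘ M.step

/-- Importance sampling ratio `ρ(s, a) = π(a | s) / π_b(a | s)`, i.e. the density of `π(· | s)`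
with respect to `π_b(· | s)`. -/
def OffPolicyMDP.ρ [MeasurableSpace.CountableOrCountablyGenerated S A]
    (M : OffPolicyMDP S A) (s : S) (a : A) : ℝ :=
  (Kernel.rnDeriv M.π M.πb s a).toReal

/-- Bellman operator of the target policy,
`T^π v (s) = ∫∫ (r(s,a,s') + γ v(s')) P(ds' | s, a) π(da | s)`. -/
def OffPolicyMDP.bellman (M : OffPolicyMDP S A) (v : S → ℝ) (s : S) : ℝ :=
  ∫ a, ∫ s', (M.r (s, a, s') + M.γ * v s') ∂(M.P (s, a)) ∂(M.π s)

/-- Total variation distance of two probability measures. -/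
def tvDist (μ ν : Measure S) : ℝ :=
  ⨆ B : {B : Set S // MeasurableSet B}, |μ.real B.1 - ν.real B.1|

/-- Geometric uniform ergodicity of the state chain of the behavior policy:
`sup_s d_TV(Pr(s_t = · | s_0 = s), μ) ≤ m κ^t` for all `t > 0`. -/
def OffPolicyMDP.GeomErgodic (M : OffPolicyMDP S A) (μ : Measure S) (m κ : ℝ) : Prop :=
  ∀ t : ℕ, 0 < t → ∀ s : S, tvDist ((M.stateKernel ^ t) s) μ ≤ m * κ ^ t

/-- The importance sampling ratio exists and is bounded by `ρmax`. -/
def OffPolicyMDP.RatioBounded [MeasurableSpace.CountableOrCountablyGenerated S A]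
    (M : OffPolicyMDP S A) (ρmax : ℝ) : Prop :=
  ∀ s : S, M.π s ≪ M.πb s ∧ ∀ᵐ a ∂(M.πb s), M.ρ s a ≤ ρmax

end MDP

/-! ### The function class and the objective -/

section Approximation

variable {S A : Type*} [MeasurableSpace S] [MeasurableSpace A] {N : ℕ}

/-- Feature vector `φ_θ(s) = ∇_θ V_θ(s)`. -/
def feature (V : Param N → S → ℝ) (θ : Param N) (s : S) : Param N :=
  gradient (fun θ' => V θ' s) θ

/-- Hessian `∇²_θ V_θ(s)`, as a linear operator on `ℝ^N`. -/
def hessian (V : Param N → S → ℝ) (θ : Param N) (s : S) : Param N →L[ℝ] Param N :=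
  fderiv ℝ (fun θ' => feature V θ' s) θ

/-- Boundedness and smoothness of the function class; the norm of a Hessian is its operator
norm. -/
structure BoundedSmooth (V : Param N → S → ℝ) (Cv Cφ Dv LV : ℝ) : Prop where
  measurable : ∀ θ, Measurable (V θ)
  contDiff : ∀ s, ContDiff ℝ 2 (fun θ => V θ s)
  abs_le : ∀ θ s, |V θ s| ≤ Cv
  feature_le : ∀ θ s, ‖feature V θ s‖ ≤ Cφ
  hessian_le : ∀ θ s, ‖hessian V θ s‖ ≤ Dv
  hessian_lip : ∀ θ θ' s, ‖hessian V θ s - hessian V θ' s‖ ≤ LV * ‖θ - θ'‖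

/-- The matrix `A_θ = E_μ[φ_θ(S) φ_θ(S)ᵀ]`. -/
def gramMatrix (μ : Measure S) (V : Param N → S → ℝ) (θ : Param N) : Matrix (Fin N) (Fin N) ℝ :=
  Matrix.of fun i j => ∫ s, feature V θ s i * feature V θ s j ∂μ

/-- Non-singularity: for every `θ`, the eigenvalues of `A_θ` are at least `lam`. -/
def NonSingular (μ : Measure S) (V : Param N → S → ℝ) (lam : ℝ) : Prop :=
  ∀ θ : Param N, ∀ e : ℝ,
    Module.End.HasEigenvalue (Matrix.toLin' (gramMatrix μ V θ)) e → lam ≤ e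

open Classical in
/-- The class in `L²(μ)` of a square-integrable function (and `0` for any other function). -/
def toL2 (μ : Measure S) (f : S → ℝ) : Lp ℝ 2 μ :=
  if h : MemLp f 2 μ then h.toLp f else 0

/-- The tangent plane `{s ↦ φ_θ(s)ᵀ ζ : ζ ∈ ℝ^N}` at `θ` in `L²(μ)`, spanned by the `N` components
of `φ_θ`. -/
def tangentPlane (μ : Measure S) (V : Param N → S → ℝ) (θ : Param N) : Submodule ℝ (Lp ℝ 2 μ) :=
  Submodule.span ℝ (Set.range fun i : Fin N => toL2 μ (fun s => feature V θ s i))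

instance (μ : Measure S) (V : Param N → S → ℝ) (θ : Param N) :
    FiniteDimensional ℝ (tangentPlane μ V θ) :=
  FiniteDimensional.span_of_finite ℝ (Set.finite_range _)

/-- Mean-square projected Bellman error
`J(θ) = E_μ[|Π_θ (T^π V_θ - V_θ)|²]`, where `Π_θ` is the orthogonal projection of `L²(μ)` onto the
tangent plane at `θ`. -/
def mspbe (M : OffPolicyMDP S A) (μ : Measure S) (V : Param N → S → ℝ) (θ : Param N) : ℝ :=
  ‖(tangentPlane μ V θ).starProjection (toL2 μ (fun s => M.bellman (V θ) s - V θ s))‖ ^ 2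

end Approximation

/-! ### The algorithm -/

section Algorithm

variable {S A : Type*} [MeasurableSpace S] [MeasurableSpace A] {N : ℕ}

/-- Projection onto the closed ball of radius `R` around the origin. -/
def projBall (R : ℝ) (v : Param N) : Param N :=
  if ‖v‖ ≤ R then v else (R / ‖v‖) • v

theorem projBall_isProjection {R : ℝ} (hR : 0 ≤ R) (v : Param N) :
    ‖projBall R v‖ ≤ R ∧ ∀ w : Param N, ‖w‖ ≤ R → ‖v - projBall R v‖ ≤ ‖v - w‖ := by
  unfold projBall
  split_ifs with h
  · exact ⟨h, fun w _ => by simp⟩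
  · push Not at h
    have hv : 0 < ‖v‖ := lt_of_le_of_lt hR h
    refine ⟨?_, fun w hw => ?_⟩
    · rw [norm_smul, Real.norm_of_nonneg (by positivity)]
      field_simp
      exact le_rfl
    · have h1 : v - (R / ‖v‖) • v = (1 - R / ‖v‖) • v := by rw [sub_smul, one_smul]
      have h2 : 0 ≤ 1 - R / ‖v‖ := by
        rw [sub_nonneg, div_le_one hv]; exact h.le
      rw [h1, norm_smul, Real.norm_of_nonneg h2]
      have h3 : (1 - R / ‖v‖) * ‖v‖ = ‖v‖ - R := by field_simp
      rw [h3]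
      have := norm_sub_norm_le v w
      linarith

/-- The projection radius `R_ω = ρ_max C_φ (r_max + (1 + γ) C_v) / λ_v`. -/
def projRadius (γ rmax Cv Cφ lam ρmax : ℝ) : ℝ :=
  ρmax * Cφ / lam * (rmax + (1 + γ) * Cv)

/-- Temporal-difference error `δ_{s,a,s'}(θ) = r(s,a,s') + γ V_θ(s') - V_θ(s)`. -/
def tdError (M : OffPolicyMDP S A) (V : Param N → S → ℝ) (θ : Param N) (x : S × A × S) : ℝ :=
  M.r x + M.γ * V θ x.2.2 - V θ x.1

variable [MeasurableSpace.CountableOrCountablyGenerated S A]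

/-- The term `h = (ρ δ(θ) - φ_θ(s)ᵀ w) ∇²V_θ(s) w`. -/
def hTerm (M : OffPolicyMDP S A) (V : Param N → S → ℝ) (x : S × A × S) (θ w : Param N) :
    Param N :=
  (M.ρ x.1 x.2.1 * tdError M V θ x - inner ℝ (feature V θ x.1) w) • hessian V θ x.1 w

/-- Unprojected direction of the fast iterate: `-φ φᵀ w + ρ δ φ`. -/
def fastDir (M : OffPolicyMDP S A) (V : Param N → S → ℝ) (x : S × A × S) (θ w : Param N) :
    Param N :=
  -(inner ℝ (feature V θ x.1) w • feature V θ x.1)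
    + (M.ρ x.1 x.2.1 * tdError M V θ x) • feature V θ x.1

/-- Direction of the slow iterate: `ρ δ φ(s) - γ ρ φ(s') φ(s)ᵀ w - h`. -/
def slowDir (M : OffPolicyMDP S A) (V : Param N → S → ℝ) (x : S × A × S) (θ w : Param N) :
    Param N :=
  (M.ρ x.1 x.2.1 * tdError M V θ x) • feature V θ x.1
    - (M.γ * M.ρ x.1 x.2.1 * inner ℝ (feature V θ x.1) w) • feature V θ x.2.2
    - hTerm M V x θ w

/-- The iterates `(θ_t, ω_t)` of non-linear off-policy TDC with constant step sizes `α` (slow) and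
`β` (fast) and projection radius `R`, driven by the samples `x 0, x 1, …` from `(θ_0, ω_0)`. -/
def iterate (M : OffPolicyMDP S A) (V : Param N → S → ℝ) (α β R : ℝ) (θ₀ ω₀ : Param N)
    (x : ℕ → S × A × S) : ℕ → Param N × Param N
  | 0 => (θ₀, ω₀)
  | t + 1 =>
    let p := iterate M V α β R θ₀ ω₀ x t
    (p.1 + α • slowDir M V (x t) p.1 p.2, projBall R (p.2 + β • fastDir M V (x t) p.1 p.2))

end Algorithm

/-! ### The two sampling models -/

section Sampling

variable {S A : Type*} [MeasurableSpace S] [MeasurableSpace A]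
  {Ω : Type*} [MeasurableSpace Ω]

/-- I.i.d. samples `(s_t, a_t, s'_t)` with `s_t ∼ μ`, `a_t ∼ π_b(· | s_t)`,
`s'_t ∼ P(· | s_t, a_t)`. -/
structure IIDSamples (M : OffPolicyMDP S A) (μ : Measure S) (Pr : Measure Ω)
    (X : ℕ → Ω → S × A × S) : Prop where
  measurable : ∀ t, Measurable (X t)
  indep : iIndepFun X Pr
  law : ∀ t, Pr.map (X t) = M.sampleLaw μ

/-- The σ-algebra generated by `s_0, a_0, …, s_{t-1}, a_{t-1}, s_t`. -/
abbrev history (s : ℕ → Ω → S) (a : ℕ → Ω → A) (t : ℕ) : MeasurableSpace Ω :=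
  (⨆ i ∈ Set.Iic t, MeasurableSpace.comap (s i) inferInstance) ⊔
    (⨆ i ∈ Set.Iio t, MeasurableSpace.comap (a i) inferInstance)

/-- A trajectory `s_0, a_0, s_1, a_1, …` of the process under the behavior policy, with an arbitrary
law of `s_0`: given the history up to `s_t`, the pair `(a_t, s_{t+1})` has conditional law
`π_b(da | s_t) P(ds' | s_t, a)`. -/
structure Trajectory (M : OffPolicyMDP S A) (Pr : Measure Ω)
    (s : ℕ → Ω → S) (a : ℕ → Ω → A) : Prop where
  measurable_s : ∀ t, Measurable (s t)
  measurable_a : ∀ t, Measurable (a t)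
  condLaw : ∀ t, ∀ C : Set (A × S), MeasurableSet C →
    Pr⟦(fun ω => (a t ω, s (t + 1) ω)) ⁻¹' C | history s a t⟧
      =ᵐ[Pr] fun ω => (M.step (s t ω)).real C

/-- `W` is uniform on `{0, …, T - 1}`. -/
def IsUniformIndex (Pr : Measure Ω) (T : ℕ) (W : Ω → ℕ) : Prop :=
  Measurable W ∧ ∀ t < T, Pr.real (W ⁻¹' {t}) = 1 / (T : ℝ)

end Sampling

/-! ### The standing assumptions and step sizes -/

/-- The standing assumptions: the reward is bounded by `rmax`, `μ` is a stationary distribution of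
the behavior policy, and boundedness/smoothness, non-singularity and bounded importance sampling
ratio hold with the given constants. -/
structure Assumptions {S A : Type*} [MeasurableSpace S] [MeasurableSpace A]
    [MeasurableSpace.CountableOrCountablyGenerated S A] {N : ℕ}
    (M : OffPolicyMDP S A) (μ : Measure S) (V : Param N → S → ℝ)
    (γ rmax Cv Cφ Dv LV lam ρmax : ℝ) : Prop where
  discount : M.γ = γ
  reward_le : ∀ x, M.r x ≤ rmax
  isProb : IsProbabilityMeasure μ
  stationary : Kernel.Invariant M.stateKernel μ
  smooth : BoundedSmooth V Cv Cφ Dv LV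
  nonSingular : NonSingular μ V lam
  ratio : M.RatioBounded ρmax

/-- The step sizes `α`, `β` are of exact orders `T^{-a}` and `T^{-b}`, with the constants
`c₁ ≤ c₂` for `α` and `c₃ ≤ c₄` for `β`; when the two orders agree, `α / β` is at most `c₀`. -/
def StepSizes (a b c₀ c₁ c₂ c₃ c₄ : ℝ) (T : ℕ) (α β : ℝ) : Prop :=
  c₁ * (T : ℝ) ^ (-a) ≤ α ∧ α ≤ c₂ * (T : ℝ) ^ (-a) ∧
  c₃ * (T : ℝ) ^ (-b) ≤ β ∧ β ≤ c₄ * (T : ℝ) ^ (-b) ∧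
  (a = b → α ≤ c₀ * β)

end NonlinearTDC

end

/-! Write b(θ) = E[ρ δ φ] and ω(θ) = A_θ⁻¹ b(θ) (`fastLimit`). For frozen θ the mean fast direction
at w is b(θ) − A_θ w = −A_θ (w − ω(θ)), so coercivity of A_θ pulls the fast iterate towards ω(θ).
The normal equations show that J = bᵀ A⁻¹ b (`Regular.mspbe_eq_objective`). Differentiating this,
and using that importance weights have conditional mean one given the state, yields ∇J(θ) = −2 times
the mean slow direction at (θ, ω(θ)) (`Regular.objectiveDeriv_eq_meanSlow`). Hence the slow iterate
performs gradient descent on J to the extent that w tracks ω(θ).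

All the regularity needed (J, ∇J, ω, Dω and both directions are bounded and Lipschitz where the
iterates live) follows from product and inverse rules. The constants are polynomials in a single
number K dominating the constants of the assumptions, and do not involve the dimension, the state
space or the step sizes. `TwoTimescale` records what is kept from the model.

Convergence rests on the Lyapunov function J(θ) + k (α/β) ‖w − ω(θ)‖². The tracking error contracts
at speed β, so the weight α/β brings its decrease to the order α of the decrease of J. One step
changes the function by α times a drift plus O(αβ) (`lyapunov_step`), and if α/β is below a
threshold depending on K, the mean drift is at most −‖∇J‖²/8 (`integral_drift_le`): the cross terms
between ∇J and the tracking error are absorbed by completing squares. Telescoping and dividing by αT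
bounds the average of E‖∇J(θ_t)‖², which is the expectation at the uniform index, by a multiple of
1/T + 1/(αT) + β plus the averaged sampling noise (`average_le`).

Under independent sampling the noise vanishes, since the iterate depends on earlier samples only.
Along a trajectory the iterate is replaced by the one j steps earlier, which moves it by at most j c
β; the sample is then within m κ^j of stationarity given that past (`Trajectory.integral_mixing`).
Taking j of order log T makes κ^j ≤ 1/T and produces the logarithms. For the finitely many T at
which α/β may exceed the threshold, boundedness of ∇J suffices. -/

noncomputable section

namespace NonlinearTDC

set_option linter.unusedSectionVars false

/-! ### Bounded Lipschitz functions and derivatives -/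

section Calculus

variable {E F G H : Type*} [NormedAddCommGroup E] [NormedSpace ℝ E]
  [NormedAddCommGroup F] [NormedSpace ℝ F] [NormedAddCommGroup G] [NormedSpace ℝ G]
  [NormedAddCommGroup H] [NormedSpace ℝ H]

/-- `f` has derivative `f'`; both are bounded by `K`, and `f'` is `K`-Lipschitz. -/
structure C11 (K : ℝ) (f : E → F) (f' : E → E →L[ℝ] F) : Prop where
  hasFDerivAt : ∀ x, HasFDerivAt f (f' x) x
  bound : ∀ x, ‖f x‖ ≤ K
  bound' : ∀ x, ‖f' x‖ ≤ K
  lip' : ∀ x y, ‖f' x - f' y‖ ≤ K * ‖x - y‖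

namespace C11

variable {K L : ℝ} {f : E → F} {f' : E → E →L[ℝ] F} {g : E → G} {g' : E → E →L[ℝ] G}

theorem nonneg (h : C11 K f f') : 0 ≤ K := (norm_nonneg _).trans (h.bound 0)

theorem mono (h : C11 K f f') (hKL : K ≤ L) : C11 L f f' :=
  ⟨h.hasFDerivAt, fun x => (h.bound x).trans hKL, fun x => (h.bound' x).trans hKL,
    fun x y => (h.lip' x y).trans (by gcongr)⟩

theorem continuous (h : C11 K f f') : Continuous f :=
  continuous_iff_continuousAt.2 fun x => (h.hasFDerivAt x).continuousAt

theorem lip (h : C11 K f f') (x y : E) : ‖f x - f y‖ ≤ K * ‖x - y‖ :=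
  Convex.norm_image_sub_le_of_norm_hasFDerivWithin_le (s := Set.univ)
    (fun z _ => (h.hasFDerivAt z).hasFDerivWithinAt) (fun z _ => h.bound' z) convex_univ
    (Set.mem_univ y) (Set.mem_univ x)

/-- Mean value inequality for `f - f' x` on the segment from `x` to `y`, along which `f'` differs
from `f' x` by at most `K * ‖y - x‖`. The factor 1/2 of Taylor's formula is given up. -/
theorem expand (h : C11 K f f') (x y : E) :
    ‖f y - f x - f' x (y - x)‖ ≤ K * ‖y - x‖ ^ 2 := by
  have := Convex.norm_image_sub_le_of_norm_hasFDerivWithin_le' (s := segment ℝ x y)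
    (f := f) (f' := f') (φ := f' x) (C := K * ‖y - x‖)
    (fun z _ => (h.hasFDerivAt z).hasFDerivWithinAt)
    (fun z hz => (h.lip' z x).trans (mul_le_mul_of_nonneg_left (by
      have := norm_sub_le_of_mem_segment hz
      simpa [norm_sub_rev] using this) h.nonneg)) (convex_segment x y)
    (left_mem_segment ℝ x y) (right_mem_segment ℝ x y)
  calc _ ≤ _ := this
    _ = _ := by ring

theorem add {f₂ : E → F} {f₂' : E → E →L[ℝ] F} (h : C11 K f f') (h₂ : C11 L f₂ f₂') :
    C11 (K + L) (fun x => f x + f₂ x) (fun x => f' x + f₂' x) where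
  hasFDerivAt x := (h.hasFDerivAt x).add (h₂.hasFDerivAt x)
  bound x := (norm_add_le _ _).trans (add_le_add (h.bound x) (h₂.bound x))
  bound' x := (norm_add_le _ _).trans (add_le_add (h.bound' x) (h₂.bound' x))
  lip' x y := by
    have : f' x + f₂' x - (f' y + f₂' y) = (f' x - f' y) + (f₂' x - f₂' y) := by abel
    rw [this, add_mul]
    exact (norm_add_le _ _).trans (add_le_add (h.lip' x y) (h₂.lip' x y))

theorem neg (h : C11 K f f') : C11 K (fun x => -f x) (fun x => -f' x) where
  hasFDerivAt x := (h.hasFDerivAt x).neg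
  bound x := by simpa using h.bound x
  bound' x := by simpa using h.bound' x
  lip' x y := by
    rw [← neg_sub', norm_neg]
    exact h.lip' x y

theorem const (c : F) (hc : ‖c‖ ≤ K) : C11 K (fun _ : E => c) (fun _ => 0) where
  hasFDerivAt x := hasFDerivAt_const c x
  bound _ := hc
  bound' _ := by simpa using (norm_nonneg _).trans hc
  lip' x y := by
    have := (norm_nonneg _).trans hc
    simp only [sub_zero, norm_zero]
    positivity

/-- Product rule. The derivative has two terms and its increment four, each at most `K * L * ‖x -
y‖`, whence the factor 4. Scalar multiplication, inner product, evaluation of operators and the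
rank-one map are all instances. -/
theorem bilin (B : F →L[ℝ] G →L[ℝ] H) (hB : ‖B‖ ≤ 1) (hf : C11 K f f') (hg : C11 L g g') :
    C11 (4 * K * L) (fun x => B (f x) (g x))
      (fun x => B.precompR E (f x) (g' x) + B.precompL E (f' x) (g x)) := by
  have hK := hf.nonneg
  have hL := hg.nonneg
  have hR : ∀ a b, ‖B.precompR E a b‖ ≤ ‖a‖ * ‖b‖ := fun a b => by
    refine (ContinuousLinearMap.le_opNorm₂ _ _ _).trans ?_
    have := (B.norm_precompR_le E).trans hB
    calc _ ≤ 1 * ‖a‖ * ‖b‖ := by gcongr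
      _ = _ := by ring
  have hLl : ∀ a b, ‖B.precompL E a b‖ ≤ ‖a‖ * ‖b‖ := fun a b => by
    refine (ContinuousLinearMap.le_opNorm₂ _ _ _).trans ?_
    have := (B.norm_precompL_le E).trans hB
    calc _ ≤ 1 * ‖a‖ * ‖b‖ := by gcongr
      _ = _ := by ring
  refine ⟨fun x => B.hasFDerivAt_of_bilinear (hf.hasFDerivAt x) (hg.hasFDerivAt x),
    fun x => ?_, fun x => ?_, fun x y => ?_⟩
  · calc ‖B (f x) (g x)‖ ≤ ‖B‖ * ‖f x‖ * ‖g x‖ := B.le_opNorm₂ _ _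
      _ ≤ 1 * K * L := by
        have := hf.bound x
        have := hg.bound x
        gcongr
      _ ≤ 4 * K * L := by nlinarith [mul_nonneg hK hL]
  · calc _ ≤ ‖f x‖ * ‖g' x‖ + ‖f' x‖ * ‖g x‖ :=
          (norm_add_le _ _).trans (add_le_add (hR _ _) (hLl _ _))
      _ ≤ K * L + K * L := by
        have := hf.bound x
        have := hf.bound' x
        have := hg.bound x
        have := hg.bound' x
        gcongr
      _ ≤ 4 * K * L := by nlinarith [mul_nonneg hK hL]
  · have e : B.precompR E (f x) (g' x) + B.precompL E (f' x) (g x)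
        - (B.precompR E (f y) (g' y) + B.precompL E (f' y) (g y))
        = (B.precompR E (f x - f y) (g' x) + B.precompR E (f y) (g' x - g' y))
        + (B.precompL E (f' x - f' y) (g x) + B.precompL E (f' y) (g x - g y)) := by
      simp only [map_sub, _root_.sub_apply]
      abel
    rw [e]
    calc _ ≤ (‖f x - f y‖ * ‖g' x‖ + ‖f y‖ * ‖g' x - g' y‖)
          + (‖f' x - f' y‖ * ‖g x‖ + ‖f' y‖ * ‖g x - g y‖) :=
          (norm_add_le _ _).trans (add_le_add
            ((norm_add_le _ _).trans (add_le_add (hR _ _) (hR _ _)))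
            ((norm_add_le _ _).trans (add_le_add (hLl _ _) (hLl _ _))))
      _ ≤ (K * ‖x - y‖ * L + K * (L * ‖x - y‖)) + (K * ‖x - y‖ * L + K * (L * ‖x - y‖)) := by
        have := hf.bound y
        have := hf.bound' y
        have := hg.bound x
        have := hg.bound' x
        have := hf.lip x y
        have := hf.lip' x y
        have := hg.lip x y
        have := hg.lip' x y
        gcongr
      _ = 4 * K * L * ‖x - y‖ := by ring

/-- Inverses of invertible elements of a Banach algebra. -/
theorem ringInverse {R : Type*} [NormedRing R] [NormedAlgebra ℝ R] [CompleteSpace R]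
    {A : E → R} {A' : E → E →L[ℝ] R} (hK : 1 ≤ K) (h : C11 K A A') (hu : ∀ x, IsUnit (A x))
    (hI : ∀ x, ‖Ring.inverse (A x)‖ ≤ K) :
    C11 (3 * K ^ 5) (fun x => Ring.inverse (A x))
      (fun x => (-(ContinuousLinearMap.mulLeftRight ℝ R) (Ring.inverse (A x))
        (Ring.inverse (A x))).comp (A' x)) := by
  have hK0 : 0 ≤ K := h.nonneg
  have happ : ∀ x v, ((-(ContinuousLinearMap.mulLeftRight ℝ R) (Ring.inverse (A x))
        (Ring.inverse (A x))).comp (A' x)) v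
        = -(Ring.inverse (A x) * A' x v * Ring.inverse (A x)) := fun x v => by
    simp
  have hA' : ∀ x v, ‖A' x v‖ ≤ K * ‖v‖ := fun x v =>
    ((A' x).le_opNorm v).trans (by gcongr; exact h.bound' x)
  have hb : ∀ x v, ‖Ring.inverse (A x) * A' x v * Ring.inverse (A x)‖ ≤ K ^ 3 * ‖v‖ := by
    intro x v
    calc _ ≤ ‖Ring.inverse (A x)‖ * ‖A' x v‖ * ‖Ring.inverse (A x)‖ := by
          refine (norm_mul_le _ _).trans ?_
          gcongr
          exact norm_mul_le _ _
      _ ≤ K * (K * ‖v‖) * K := by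
        have := hI x
        have := hA' x v
        gcongr
      _ = _ := by ring
  have p15 : K ≤ K ^ 5 := by simpa using pow_le_pow_right₀ hK (show 1 ≤ 5 by norm_num)
  have p35 : K ^ 3 ≤ K ^ 5 := pow_le_pow_right₀ hK (show 3 ≤ 5 by norm_num)
  have hd : ∀ x, HasFDerivAt (fun x => Ring.inverse (A x))
      ((-(ContinuousLinearMap.mulLeftRight ℝ R) (Ring.inverse (A x))
        (Ring.inverse (A x))).comp (A' x)) x := fun x => by
    obtain ⟨w, hw⟩ := hu x
    have := hasFDerivAt_ringInverse (𝕜 := ℝ) w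
    rw [hw] at this
    have h2 := this.comp x (h.hasFDerivAt x)
    rw [← hw, Ring.inverse_unit]
    exact h2
  -- The derivative `-I A' I` of the inverse has norm at most `K ^ 3`. This bound is also what
  -- controls the differences of inverses in the Lipschitz estimate of the derivative.
  have hlip : ∀ x y, ‖Ring.inverse (A x) - Ring.inverse (A y)‖ ≤ K ^ 3 * ‖x - y‖ := fun x y =>
    Convex.norm_image_sub_le_of_norm_hasFDerivWithin_le (s := Set.univ)
      (fun z _ => (hd z).hasFDerivWithinAt) (fun z _ => by
        refine ContinuousLinearMap.opNorm_le_bound _ (by positivity) fun v => ?_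
        rw [happ, norm_neg]
        exact hb z v) convex_univ (Set.mem_univ y) (Set.mem_univ x)
  refine ⟨hd, fun x => (hI x).trans (by nlinarith), fun x => ?_, fun x y => ?_⟩
  · refine ContinuousLinearMap.opNorm_le_bound _ (by positivity) fun v => ?_
    rw [happ, norm_neg]
    exact (hb x v).trans (by gcongr; nlinarith [pow_nonneg hK0 5])
  · refine ContinuousLinearMap.opNorm_le_bound _ (by positivity) fun v => ?_
    rw [_root_.sub_apply, happ, happ]
    set I := Ring.inverse (A x)
    set J := Ring.inverse (A y)
    -- Change one of the three factors at a time: the middle change costs `K ^ 3`, each change of an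
    -- inverse costs `K ^ 5`.
    have e : -(I * A' x v * I) - -(J * A' y v * J)
        = -(I * ((A' x - A' y) v) * I + (I - J) * A' y v * I + J * A' y v * (I - J)) := by
      simp only [_root_.sub_apply]
      noncomm_ring
    have h3 : ∀ a b c : R, ‖a * b * c‖ ≤ ‖a‖ * ‖b‖ * ‖c‖ := fun a b c =>
      (norm_mul_le _ _).trans (by gcongr; exact norm_mul_le _ _)
    rw [e, norm_neg]
    have h1 := hI x
    have h2 := hI y
    have h4 := hA' y v
    have h5 := hlip x y
    have h6 : ‖(A' x - A' y) v‖ ≤ K * ‖x - y‖ * ‖v‖ :=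
      (ContinuousLinearMap.le_opNorm _ _).trans (by gcongr; exact h.lip' x y)
    calc _ ≤ ‖I‖ * ‖(A' x - A' y) v‖ * ‖I‖ + ‖I - J‖ * ‖A' y v‖ * ‖I‖
          + ‖J‖ * ‖A' y v‖ * ‖I - J‖ :=
          (norm_add₃_le).trans (add_le_add (add_le_add (h3 _ _ _) (h3 _ _ _)) (h3 _ _ _))
      _ ≤ K * (K * ‖x - y‖ * ‖v‖) * K + (K ^ 3 * ‖x - y‖) * (K * ‖v‖) * K
          + K * (K * ‖v‖) * (K ^ 3 * ‖x - y‖) := by gcongr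
      _ = (K ^ 3 + 2 * K ^ 5) * (‖x - y‖ * ‖v‖) := by ring
      _ ≤ (3 * K ^ 5) * (‖x - y‖ * ‖v‖) := by gcongr; linarith
      _ = _ := by ring

end C11

/-- A linear map on `ℝ^N` is the sum of its rank-one pieces on the coordinate axes. -/
theorem clm_eq_sum {N : ℕ} (L : Param N →L[ℝ] F) :
    L = ∑ i, (EuclideanSpace.proj i : Param N →L[ℝ] ℝ).smulRight
      (L (EuclideanSpace.single i 1)) := by
  ext v
  have hv : v = ∑ i, v i • (EuclideanSpace.single i (1 : ℝ) : Param N) := by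
    ext j
    simp [Finset.sum_apply, Pi.single_apply]
  conv_lhs => rw [hv]
  simp [map_sum]

/-- In finite dimension an operator is a finite sum of fixed continuous images of its values on the
basis vectors, so measurability of these values passes to the operator norm topology. -/
theorem aestronglyMeasurable_clm {X : Type*} [MeasurableSpace X] {ν : Measure X} {N : ℕ}
    {L : X → Param N →L[ℝ] F} (h : ∀ v, AEStronglyMeasurable (fun x => L x v) ν) :
    AEStronglyMeasurable L ν := by
  have : L = fun x => ∑ i, (ContinuousLinearMap.smulRightL ℝ (Param N) F
      (EuclideanSpace.proj i : Param N →L[ℝ] ℝ)) (L x (EuclideanSpace.single i 1)) := by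
    funext x
    exact clm_eq_sum (L x)
  rw [this]
  refine Finset.aestronglyMeasurable_fun_sum _ fun i _ => ?_
  exact (ContinuousLinearMap.continuous _).comp_aestronglyMeasurable (h _)

/-- Directional derivatives are almost everywhere limits of the difference quotients with increments
`1 / (n + 1)`. -/
theorem aestronglyMeasurable_deriv {X : Type*} [MeasurableSpace X] {ν : Measure X} {N : ℕ}
    {f : X → Param N → F} {f' : X → Param N → Param N →L[ℝ] F}
    (hm : ∀ θ, AEStronglyMeasurable (fun x => f x θ) ν) (θ : Param N)
    (hd : ∀ᵐ x ∂ν, HasFDerivAt (f x) (f' x θ) θ) :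
    AEStronglyMeasurable (fun x => f' x θ) ν := by
  refine aestronglyMeasurable_clm fun v => ?_
  refine aestronglyMeasurable_of_tendsto_ae Filter.atTop
    (f := fun (n : ℕ) x => ((n : ℝ) + 1) • (f x (θ + ((n : ℝ) + 1)⁻¹ • v) - f x θ)) ?_ ?_
  · intro n
    exact ((hm _).sub (hm _)).const_smul _
  · filter_upwards [hd] with x hx
    refine hx.lim v ?_
    simp only [Real.norm_eq_abs]
    exact Filter.tendsto_abs_atTop_atTop.comp
      (Filter.tendsto_atTop_add_const_right _ _ tendsto_natCast_atTop_atTop)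

theorem integrable_of_norm_le {X : Type*} [MeasurableSpace X] {ν : Measure X} [IsFiniteMeasure ν]
    {f : X → F} {K : ℝ} (hm : AEStronglyMeasurable f ν) (hb : ∀ᵐ x ∂ν, ‖f x‖ ≤ K) :
    Integrable f ν :=
  Integrable.of_bound hm K hb

theorem norm_integral_le {X : Type*} [MeasurableSpace X] {ν : Measure X} [IsProbabilityMeasure ν]
    {f : X → F} {K : ℝ} (hb : ∀ᵐ x ∂ν, ‖f x‖ ≤ K) : ‖∫ x, f x ∂ν‖ ≤ K := by
  simpa using norm_integral_le_of_norm_le_const hb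

section Integral

variable {X : Type*} [MeasurableSpace X] {ν : Measure X} [IsProbabilityMeasure ν] {N : ℕ} {K : ℝ}
  {f : X → Param N → F} {f' : X → Param N → Param N →L[ℝ] F}

theorem C11.integrable_deriv (hm : ∀ θ, AEStronglyMeasurable (fun x => f x θ) ν)
    (h : ∀ᵐ x ∂ν, C11 K (f x) (f' x)) (θ : Param N) : Integrable (fun x => f' x θ) ν :=
  integrable_of_norm_le
    (aestronglyMeasurable_deriv hm θ (h.mono fun _ hx => hx.hasFDerivAt θ))
    (h.mono fun _ hx => hx.bound' θ)

/-- Differentiation under the integral sign, dominated by the constant `K`. The null set on which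
`C11 K` fails does not depend on the parameter. -/
theorem C11.integral (hm : ∀ θ, AEStronglyMeasurable (fun x => f x θ) ν)
    (h : ∀ᵐ x ∂ν, C11 K (f x) (f' x)) :
    C11 K (fun θ => ∫ x, f x θ ∂ν) (fun θ => ∫ x, f' x θ ∂ν) where
  hasFDerivAt θ := by
    refine hasFDerivAt_integral_of_dominated_of_fderiv_le (F := fun θ x => f x θ)
      (F' := fun θ x => f' x θ) (bound := fun _ => K) Filter.univ_mem
      (Filter.Eventually.of_forall fun η => hm η)
      (integrable_of_norm_le (hm θ) (h.mono fun _ hx => hx.bound θ))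
      (C11.integrable_deriv hm h θ).aestronglyMeasurable
      (h.mono fun _ hx η _ => hx.bound' η) (integrable_const _)
      (h.mono fun _ hx η _ => hx.hasFDerivAt η)
  bound θ := norm_integral_le (h.mono fun _ hx => hx.bound θ)
  bound' θ := norm_integral_le (h.mono fun _ hx => hx.bound' θ)
  lip' θ η := by
    rw [← integral_sub (C11.integrable_deriv hm h θ) (C11.integrable_deriv hm h η)]
    exact norm_integral_le (h.mono fun _ hx => hx.lip' θ η)

end Integral

/-- `f` is bounded by `K` and `K`-Lipschitz on `D`. -/
structure BL {P : Type*} [NormedAddCommGroup P] (K : ℝ) (D : Set P) (f : P → F) : Prop where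
  nonneg : 0 ≤ K
  bound : ∀ p ∈ D, ‖f p‖ ≤ K
  lip : ∀ p ∈ D, ∀ q ∈ D, ‖f p - f q‖ ≤ K * ‖p - q‖

namespace BL

variable {P : Type*} [NormedAddCommGroup P] {K L : ℝ} {D : Set P} {f : P → F} {g : P → G}

theorem mono (h : BL K D f) (hKL : K ≤ L) : BL L D f :=
  ⟨h.nonneg.trans hKL, fun p hp => (h.bound p hp).trans hKL,
    fun p hp q hq => (h.lip p hp q hq).trans (by gcongr)⟩

theorem add {f₂ : P → F} (h : BL K D f) (h₂ : BL L D f₂) :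
    BL (K + L) D (fun x => f x + f₂ x) where
  nonneg := add_nonneg h.nonneg h₂.nonneg
  bound p hp := (norm_add_le _ _).trans (add_le_add (h.bound p hp) (h₂.bound p hp))
  lip p hp q hq := by
    rw [add_sub_add_comm, add_mul]
    exact (norm_add_le _ _).trans (add_le_add (h.lip p hp q hq) (h₂.lip p hp q hq))

theorem neg (h : BL K D f) : BL K D (fun x => -f x) where
  nonneg := h.nonneg
  bound p hp := by simpa using h.bound p hp
  lip p hp q hq := by
    rw [← neg_sub', norm_neg]
    exact h.lip p hp q hq

theorem sub {f₂ : P → F} (h : BL K D f) (h₂ : BL L D f₂) :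
    BL (K + L) D (fun x => f x - f₂ x) := by
  simpa only [sub_eq_add_neg] using h.add h₂.neg

theorem bilin (B : F →L[ℝ] G →L[ℝ] H) (hB : ‖B‖ ≤ 1) (hf : BL K D f) (hg : BL L D g) :
    BL (2 * K * L) D (fun x => B (f x) (g x)) := by
  have hK := hf.nonneg
  have hL := hg.nonneg
  have hR : ∀ a b, ‖B a b‖ ≤ ‖a‖ * ‖b‖ := fun a b => by
    calc _ ≤ ‖B‖ * ‖a‖ * ‖b‖ := B.le_opNorm₂ _ _
      _ ≤ 1 * ‖a‖ * ‖b‖ := by gcongr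
      _ = _ := by ring
  refine ⟨by positivity, fun p hp => ?_, fun p hp q hq => ?_⟩
  · have := hf.bound p hp
    have := hg.bound p hp
    calc _ ≤ ‖f p‖ * ‖g p‖ := hR _ _
      _ ≤ K * L := by gcongr
      _ ≤ _ := by nlinarith [mul_nonneg hK hL]
  · have e : B (f p) (g p) - B (f q) (g q) = B (f p - f q) (g p) + B (f q) (g p - g q) := by
      simp
    have := hf.bound q hq
    have := hg.bound p hp
    have := hf.lip p hp q hq
    have := hg.lip p hp q hq
    rw [e]
    calc _ ≤ ‖f p - f q‖ * ‖g p‖ + ‖f q‖ * ‖g p - g q‖ :=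
          (norm_add_le _ _).trans (add_le_add (hR _ _) (hR _ _))
      _ ≤ K * ‖p - q‖ * L + K * (L * ‖p - q‖) := by gcongr
      _ = _ := by ring

theorem smul {c : P → ℝ} (hc : BL K D c) (hf : BL L D f) :
    BL (2 * K * L) D (fun x => c x • f x) :=
  bilin (ContinuousLinearMap.lsmul ℝ ℝ) ContinuousLinearMap.opNorm_lsmul_le hc hf

theorem inner {N : ℕ} {f g : P → Param N} (hf : BL K D f) (hg : BL L D g) :
    BL (2 * K * L) D (fun x => inner ℝ (f x) (g x)) :=
  bilin (innerSL ℝ) (norm_innerSL_le ℝ) hf hg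

theorem apply {f : P → E →L[ℝ] F} {g : P → E} (hf : BL K D f) (hg : BL L D g) :
    BL (2 * K * L) D (fun x => f x (g x)) :=
  bilin (ContinuousLinearMap.id ℝ (E →L[ℝ] F)) ContinuousLinearMap.norm_id_le hf hg

theorem of_fst {Q : Type*} [NormedAddCommGroup Q] {D : Set (P × Q)} (hK : 0 ≤ K)
    (hb : ∀ p, ‖f p‖ ≤ K) (hl : ∀ p q, ‖f p - f q‖ ≤ K * ‖p - q‖) :
    BL K D (fun p => f p.1) where
  nonneg := hK
  bound p _ := hb p.1
  lip p _ q _ := (hl _ _).trans (by gcongr; exact norm_fst_le (p - q))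

end BL

theorem C11.bl {P : Type*} [NormedAddCommGroup P] {K : ℝ} {f : E → F} {f' : E → E →L[ℝ] F}
    (h : C11 K f f') {D : Set (E × P)} : BL K D (fun p => f p.1) :=
  BL.of_fst h.nonneg h.bound h.lip

theorem C11.bl_deriv {P : Type*} [NormedAddCommGroup P] {K : ℝ} {f : E → F}
    {f' : E → E →L[ℝ] F} (h : C11 K f f') {D : Set (E × P)} : BL K D (fun p => f' p.1) :=
  BL.of_fst h.nonneg h.bound' h.lip'

end Calculus

/-! ### Regularity of the value functions -/

section ValueFunction

variable {S : Type*} [MeasurableSpace S] {N : ℕ} {V : Param N → S → ℝ}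

theorem hasFDerivAt_value {s : S} (hV : ContDiff ℝ 2 (fun θ => V θ s)) (θ : Param N) :
    HasFDerivAt (fun θ => V θ s) (innerSL ℝ (feature V θ s)) θ := by
  have h : DifferentiableAt ℝ (fun θ => V θ s) θ := (hV.differentiable (by norm_num)) θ
  exact h.hasGradientAt.hasFDerivAt

theorem fderiv_value {s : S} (hV : ContDiff ℝ 2 (fun θ => V θ s)) :
    fderiv ℝ (fun θ => V θ s) = fun θ => innerSL ℝ (feature V θ s) := by
  funext θ
  exact (hasFDerivAt_value hV θ).fderiv

theorem hasFDerivAt_feature {s : S} (hV : ContDiff ℝ 2 (fun θ => V θ s)) (θ : Param N) :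
    HasFDerivAt (fun θ => feature V θ s) (hessian V θ s) θ := by
  have h1 : ContDiff ℝ 1 (fderiv ℝ (fun θ => V θ s)) := hV.fderiv_right (by norm_num)
  have h2 : Differentiable ℝ (fun θ => feature V θ s) := by
    have : (fun θ => feature V θ s) = fun θ =>
      (InnerProductSpace.toDual ℝ (Param N)).symm (fderiv ℝ (fun θ => V θ s) θ) := rfl
    rw [this]
    exact (InnerProductSpace.toDual ℝ (Param N)).symm.toContinuousLinearEquiv.differentiable.comp
      (h1.differentiable (by norm_num))
  exact (h2 θ).hasFDerivAt

/-- Symmetry of the second derivative, carried through the Riesz identification of gradient and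
derivative. It makes the Hessian terms cancel in the gradient formula. -/
theorem hessian_symm {s : S} (hV : ContDiff ℝ 2 (fun θ => V θ s)) (θ u v : Param N) :
    inner ℝ (hessian V θ s u) v = inner ℝ u (hessian V θ s v) := by
  have hs := hV.contDiffAt.isSymmSndFDerivAt (x := θ) (by simp)
  have h := hs u v
  have e : fderiv ℝ (fderiv ℝ (fun θ => V θ s)) θ
      = (innerSL ℝ : Param N →L[ℝ] Param N →L[ℝ] ℝ).comp (hessian V θ s) := by
    rw [fderiv_value hV]
    exact ((innerSL ℝ : Param N →L[ℝ] Param N →L[ℝ] ℝ).hasFDerivAt.comp θ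
      (hasFDerivAt_feature hV θ)).fderiv
  rw [e] at h
  simp only [ContinuousLinearMap.comp_apply] at h
  rw [innerSL_apply_apply, innerSL_apply_apply] at h
  exact h.trans (real_inner_comm _ _)

theorem measurable_of_hasFDerivAt {F : Type*} [NormedAddCommGroup F] [NormedSpace ℝ F]
    [MeasurableSpace F] [BorelSpace F] [SecondCountableTopology F]
    {f : Param N → S → F} {f' : Param N → S → Param N →L[ℝ] F}
    (hm : ∀ θ, Measurable (f θ)) (hd : ∀ θ s, HasFDerivAt (fun θ => f θ s) (f' θ s) θ)
    (θ v : Param N) : Measurable (fun s => f' θ s v) := by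
  refine measurable_of_tendsto_metrizable
    (f := fun (n : ℕ) s => ((n : ℝ) + 1) • (f (θ + ((n : ℝ) + 1)⁻¹ • v) s - f θ s)) ?_ ?_
  · intro n
    exact ((hm _).sub (hm _)).const_smul _
  · rw [tendsto_pi_nhds]
    intro s
    refine (hd θ s).lim v ?_
    simp only [Real.norm_eq_abs]
    exact Filter.tendsto_abs_atTop_atTop.comp
      (Filter.tendsto_atTop_add_const_right _ _ tendsto_natCast_atTop_atTop)

namespace BoundedSmooth

variable {Cv Cφ Dv LV K : ℝ}

theorem c11_value (h : BoundedSmooth V Cv Cφ Dv LV) (hv : Cv ≤ K) (hφ : Cφ ≤ K) (hD : Dv ≤ K)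
    (s : S) : C11 K (fun θ => V θ s) (fun θ => innerSL ℝ (feature V θ s)) where
  hasFDerivAt θ := hasFDerivAt_value (h.contDiff s) θ
  bound θ := (h.abs_le θ s).trans hv
  bound' θ := by
    rw [innerSL_apply_norm]
    exact (h.feature_le θ s).trans hφ
  lip' θ η := by
    rw [← map_sub, innerSL_apply_norm]
    exact Convex.norm_image_sub_le_of_norm_hasFDerivWithin_le (s := Set.univ)
      (f := fun θ => feature V θ s)
      (fun z _ => (hasFDerivAt_feature (h.contDiff s) z).hasFDerivWithinAt)
      (fun z _ => (h.hessian_le z s).trans hD) convex_univ (Set.mem_univ η) (Set.mem_univ θ)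

theorem c11_feature (h : BoundedSmooth V Cv Cφ Dv LV) (hφ : Cφ ≤ K) (hD : Dv ≤ K) (hL : LV ≤ K)
    (s : S) : C11 K (fun θ => feature V θ s) (fun θ => hessian V θ s) where
  hasFDerivAt θ := hasFDerivAt_feature (h.contDiff s) θ
  bound θ := (h.feature_le θ s).trans hφ
  bound' θ := (h.hessian_le θ s).trans hD
  lip' θ η := (h.hessian_lip θ η s).trans (by gcongr)

theorem measurable_feature (h : BoundedSmooth V Cv Cφ Dv LV) (θ : Param N) :
    Measurable (feature V θ) := by
  have hi : ∀ i, Measurable fun s => feature V θ s i := fun i => by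
    have := measurable_of_hasFDerivAt h.measurable
      (fun θ s => hasFDerivAt_value (h.contDiff s) θ) θ (EuclideanSpace.single i 1)
    simpa [EuclideanSpace.inner_single_right] using this
  exact (WithLp.measurable_toLp 2 _).comp (measurable_pi_lambda _ hi)

theorem measurable_hessian (h : BoundedSmooth V Cv Cφ Dv LV) (θ v : Param N) :
    Measurable (fun s => hessian V θ s v) :=
  measurable_of_hasFDerivAt h.measurable_feature
    (fun θ s => hasFDerivAt_feature (h.contDiff s) θ) θ v

/-- Carathéodory functions: continuous in the parameter and measurable in the state. Joint
measurability is required because the algorithm evaluates them at random parameters. -/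
theorem measurable_value_uncurry (h : BoundedSmooth V Cv Cφ Dv LV) :
    Measurable (fun p : Param N × S => V p.1 p.2) :=
  measurable_uncurry_of_continuous_of_measurable
    (fun s => (h.contDiff s).continuous) h.measurable

theorem measurable_feature_uncurry (h : BoundedSmooth V Cv Cφ Dv LV) :
    Measurable (fun p : Param N × S => feature V p.1 p.2) :=
  measurable_uncurry_of_continuous_of_measurable
    (fun s => continuous_iff_continuousAt.2 fun θ =>
      (hasFDerivAt_feature (h.contDiff s) θ).continuousAt) h.measurable_feature

theorem measurable_hessian_uncurry (h : BoundedSmooth V Cv Cφ Dv LV) :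
    Measurable (fun p : (Param N × Param N) × S => hessian V p.1.1 p.2 p.1.2) := by
  refine measurable_uncurry_of_continuous_of_measurable
    (u := fun (p : Param N × Param N) s => hessian V p.1 s p.2) (fun s => ?_)
    (fun p => h.measurable_hessian p.1 p.2)
  have h1 : ContDiff ℝ 1 (fderiv ℝ (fun θ => V θ s)) := (h.contDiff s).fderiv_right (by norm_num)
  have h2 : ContDiff ℝ 1 (fun θ => feature V θ s) :=
    (InnerProductSpace.toDual ℝ (Param N)).symm.toContinuousLinearEquiv.contDiff.comp h1
  have h3 : Continuous (fun θ => hessian V θ s) := h2.continuous_fderiv (by norm_num)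
  exact (h3.comp continuous_fst).clm_apply continuous_snd

end BoundedSmooth

end ValueFunction

/-! ### Coercivity of the Gram matrix -/

section Gram

/-- The eigenvalues of `A - c` are those of `A` shifted by `-c`, hence nonnegative, so `A - c` is
positive semidefinite. -/
theorem hermitian_coercive {n : Type*} [Fintype n] [DecidableEq n] {A : Matrix n n ℝ} {c : ℝ}
    (hA : A.IsHermitian)
    (he : ∀ e : ℝ, Module.End.HasEigenvalue (Matrix.toLin' A) e → c ≤ e) (v : n → ℝ) :
    c * (v ⬝ᵥ v) ≤ v ⬝ᵥ A.mulVec v := by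
  have hH : (A - c • (1 : Matrix n n ℝ)).IsHermitian := by
    refine hA.sub ?_
    ext i j
    simp [Matrix.one_apply, eq_comm]
  have hp : (A - c • (1 : Matrix n n ℝ)).PosSemidef := by
    rw [hH.posSemidef_iff_eigenvalues_nonneg]
    intro i
    have h1 := hH.mulVec_eigenvectorBasis i
    set w : n → ℝ := ⇑(hH.eigenvectorBasis i) with hw
    have hw0 : w ≠ 0 := by
      intro h0
      have : hH.eigenvectorBasis i = 0 := by
        ext j
        exact congrFun h0 j
      have h3 := hH.eigenvectorBasis.orthonormal.1 i
      rw [this, norm_zero] at h3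
      exact zero_ne_one h3
    have h2 : A.mulVec w = (hH.eigenvalues i + c) • w := by
      rw [Matrix.sub_mulVec, Matrix.smul_mulVec, Matrix.one_mulVec] at h1
      rw [add_smul, ← h1]
      simp
    have := he _ (Module.End.hasEigenvalue_of_hasEigenvector
      (Module.End.hasEigenvector_iff.2 ⟨Module.End.mem_eigenspace_iff.2 (by simpa using h2), hw0⟩))
    simpa using this
  have := hp.dotProduct_mulVec_nonneg v
  rw [Matrix.sub_mulVec, dotProduct_sub, Matrix.smul_mulVec, Matrix.one_mulVec,
    dotProduct_smul] at this
  simpa using this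

end Gram

/-! ### Sampling and importance weights -/

section Weights

variable {S A : Type*} [MeasurableSpace S] [MeasurableSpace A]

instance (M : OffPolicyMDP S A) : IsMarkovKernel M.step := by
  unfold OffPolicyMDP.step; infer_instance

instance (M : OffPolicyMDP S A) : IsMarkovKernel M.stateKernel := by
  unfold OffPolicyMDP.stateKernel; infer_instance

instance (M : OffPolicyMDP S A) (μ : Measure S) [IsProbabilityMeasure μ] :
    IsProbabilityMeasure (M.sampleLaw μ) := by
  unfold OffPolicyMDP.sampleLaw; infer_instance

theorem integral_sampleLaw_fst {F : Type*} [NormedAddCommGroup F] [NormedSpace ℝ F]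
    (M : OffPolicyMDP S A) (μ : Measure S) [IsProbabilityMeasure μ]
    {f : S → F} (hf : AEStronglyMeasurable f μ) :
    ∫ x, f x.1 ∂(M.sampleLaw μ) = ∫ s, f s ∂μ := by
  have h : (M.sampleLaw μ).map Prod.fst = μ := Measure.fst_compProd μ M.step
  conv_rhs => rw [← h]
  rw [integral_map measurable_fst.aemeasurable (by rwa [h])]

variable [MeasurableSpace.CountableOrCountablyGenerated S A]

theorem ratio_nonneg (M : OffPolicyMDP S A) (s : S) (a : A) : 0 ≤ M.ρ s a := ENNReal.toReal_nonneg

theorem measurable_ratio (M : OffPolicyMDP S A) : Measurable (fun p : S × A => M.ρ p.1 p.2) :=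
  (Kernel.measurable_rnDeriv M.π M.πb).ennreal_toReal

theorem measurable_ratio_sample (M : OffPolicyMDP S A) :
    Measurable (fun x : S × A × S => M.ρ x.1 x.2.1) :=
  (measurable_ratio M).comp (measurable_fst.prodMk measurable_snd.fst)

/-- Samples whose importance ratio is at most `K`. -/
def goodSamples (M : OffPolicyMDP S A) (K : ℝ) : Set (S × A × S) := {x | M.ρ x.1 x.2.1 ≤ K}

theorem measurableSet_goodSamples (M : OffPolicyMDP S A) (K : ℝ) :
    MeasurableSet (goodSamples M K) :=
  measurableSet_le (measurable_ratio_sample M) measurable_const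

theorem ae_step_good {M : OffPolicyMDP S A} {K : ℝ} (h : M.RatioBounded K) (s : S) :
    ∀ᵐ y ∂(M.step s), (s, y) ∈ goodSamples M K := by
  refine Kernel.ae_compProd_of_ae_ae (p := fun y => (s, y) ∈ goodSamples M K)
    (measurableSet_goodSamples M K |>.preimage measurable_prodMk_left) ?_
  filter_upwards [(h s).2] with a ha
  exact Filter.Eventually.of_forall fun _ => ha

theorem ae_sampleLaw_good {M : OffPolicyMDP S A} {K : ℝ} (h : M.RatioBounded K)
    (μ : Measure S) : ∀ᵐ x ∂(M.sampleLaw μ), x ∈ goodSamples M K :=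
  Measure.ae_compProd_of_ae_ae (measurableSet_goodSamples M K)
    (Filter.Eventually.of_forall fun s => ae_step_good h s)

/-- Importance weighting turns the behavior policy into the target policy. -/
theorem integral_ratio {M : OffPolicyMDP S A} {K B : ℝ} (h : M.RatioBounded K) (μ : Measure S)
    [IsProbabilityMeasure μ] {ψ : S × A × S → ℝ} (hm : Measurable ψ) (hb : ∀ x, ‖ψ x‖ ≤ B) :
    ∫ x, M.ρ x.1 x.2.1 * ψ x ∂(M.sampleLaw μ)
      = ∫ s, ∫ a, ∫ s', ψ (s, a, s') ∂(M.P (s, a)) ∂(M.π s) ∂μ := by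
  have hmm : Measurable fun x : S × A × S => M.ρ x.1 x.2.1 * ψ x :=
    (measurable_ratio_sample M).mul hm
  have hbd : ∀ x ∈ goodSamples M K, ‖M.ρ x.1 x.2.1 * ψ x‖ ≤ K * B := fun x hx => by
    rw [norm_mul, Real.norm_of_nonneg (ratio_nonneg M _ _)]
    exact mul_le_mul hx (hb x) (norm_nonneg _) ((ratio_nonneg M _ _).trans hx)
  have hi : Integrable (fun x => M.ρ x.1 x.2.1 * ψ x) (M.sampleLaw μ) :=
    integrable_of_norm_le hmm.aestronglyMeasurable
      ((ae_sampleLaw_good h μ).mono fun x hx => hbd x hx)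
  rw [OffPolicyMDP.sampleLaw] at hi ⊢
  rw [Measure.integral_compProd hi]
  congr 1
  funext s
  have hi2 : Integrable (fun y => M.ρ s y.1 * ψ (s, y)) (M.step s) :=
    integrable_of_norm_le (hmm.comp measurable_prodMk_left).aestronglyMeasurable
      ((ae_step_good h s).mono fun y hy => hbd (s, y) hy)
  rw [OffPolicyMDP.step] at hi2 ⊢
  rw [integral_compProd hi2]
  simp only [integral_const_mul]
  -- Absolute continuity turns the integral against `M.π s` into one against `M.πb s` weighted by
  -- the Radon–Nikodym derivative of the two measures; this agrees almost everywhere with the kernel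
  -- derivative that defines `M.ρ`.
  rw [← integral_rnDeriv_smul (h s).1]
  refine integral_congr_ae ?_
  filter_upwards [Kernel.rnDeriv_eq_rnDeriv_measure (κ := M.π) (η := M.πb) (a := s)] with a ha
  rw [smul_eq_mul, ← ha]
  rfl

/-- Given the state, the weights are the density of a probability measure and so have mean one. The
gradient formula depends on this. -/
theorem integral_ratio_fst {M : OffPolicyMDP S A} {K B : ℝ} (h : M.RatioBounded K) (μ : Measure S)
    [IsProbabilityMeasure μ] {f : S → ℝ} (hm : Measurable f) (hb : ∀ x, ‖f x‖ ≤ B) :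
    ∫ x, M.ρ x.1 x.2.1 * f x.1 ∂(M.sampleLaw μ) = ∫ x, f x.1 ∂(M.sampleLaw μ) := by
  rw [integral_ratio (ψ := fun x => f x.1) h μ (hm.comp measurable_fst) (fun x => hb x.1),
    integral_sampleLaw_fst M μ hm.aestronglyMeasurable]
  simp

end Weights

/-! ### The regular model: all constants are dominated by one number `K` -/

section Model

variable {S A : Type*} [MeasurableSpace S] [MeasurableSpace A]
  [MeasurableSpace.CountableOrCountablyGenerated S A] {N : ℕ}

/-- The standing assumptions, with all constants dominated by `K`; the radius `R` bounds
`‖E[ρ δ φ]‖ / lam`. -/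
structure Regular (M : OffPolicyMDP S A) (μ : Measure S) (V : Param N → S → ℝ) (K R : ℝ) :
    Prop where
  one_le : 1 ≤ K
  radius_nonneg : 0 ≤ R
  radius_le : R ≤ K
  isProb : IsProbabilityMeasure μ
  smooth : BoundedSmooth V K K K K
  reward_le : ∀ x, M.r x ≤ K
  ratio : M.RatioBounded K
  coercive : ∀ θ w : Param N,
    ‖w‖ ^ 2 ≤ K * ∫ x, inner ℝ (feature V θ x.1) w ^ 2 ∂(M.sampleLaw μ)
  norm_le : ∀ θ w : Param N,
    inner ℝ w (∫ x, (M.ρ x.1 x.2.1 * tdError M V θ x) • feature V θ x.1 ∂(M.sampleLaw μ))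
      = ∫ x, inner ℝ (feature V θ x.1) w ^ 2 ∂(M.sampleLaw μ) → ‖w‖ ≤ R

theorem sum_mul_gram (M : OffPolicyMDP S A) {μ : Measure S} [IsProbabilityMeasure μ]
    {V : Param N → S → ℝ} {Cv Cφ Dv LV : ℝ} (hV : BoundedSmooth V Cv Cφ Dv LV) (θ w : Param N) :
    (WithLp.ofLp w) ⬝ᵥ (gramMatrix μ V θ).mulVec (WithLp.ofLp w)
      = ∫ x, inner ℝ (feature V θ x.1) w ^ 2 ∂(M.sampleLaw μ) := by
  have hm := hV.measurable_feature θ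
  have hmi : ∀ i, Measurable fun s => feature V θ s i := fun i =>
    (EuclideanSpace.proj (𝕜 := ℝ) i).continuous.measurable.comp hm
  have hbi : ∀ i s, ‖feature V θ s i‖ ≤ Cφ := fun i s =>
    (PiLp.norm_apply_le _ i).trans (hV.feature_le θ s)
  have hint : ∀ i j, Integrable (fun s => feature V θ s i * feature V θ s j) μ := fun i j =>
    integrable_of_norm_le (K := Cφ * Cφ) ((hmi i).mul (hmi j)).aestronglyMeasurable
      (Filter.Eventually.of_forall fun s => by
        rw [norm_mul]
        exact mul_le_mul (hbi i s) (hbi j s) (norm_nonneg _) ((norm_nonneg _).trans (hbi i s)))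
  rw [integral_sampleLaw_fst M μ (f := fun s => inner ℝ (feature V θ s) w ^ 2)
    ((hm.inner measurable_const).pow_const 2).aestronglyMeasurable]
  have : ∀ s, inner ℝ (feature V θ s) w ^ 2
      = ∑ i, ∑ j, (w i * w j) * (feature V θ s i * feature V θ s j) := fun s => by
    rw [PiLp.inner_apply, pow_two, Finset.sum_mul_sum]
    refine Finset.sum_congr rfl fun i _ => Finset.sum_congr rfl fun j _ => ?_
    simp
    ring
  simp only [this]
  rw [integral_finsetSum _ fun i _ => integrable_finsetSum _ fun j _ => (hint i j).const_mul _]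
  simp only [dotProduct, Matrix.mulVec, gramMatrix, Matrix.of_apply, Finset.mul_sum]
  refine Finset.sum_congr rfl fun i _ => ?_
  rw [integral_finsetSum _ fun j _ => (hint i j).const_mul _]
  refine Finset.sum_congr rfl fun j _ => ?_
  rw [integral_const_mul]
  ring

theorem measurable_tdError {M : OffPolicyMDP S A} {V : Param N → S → ℝ} {Cv Cφ Dv LV : ℝ}
    (hV : BoundedSmooth V Cv Cφ Dv LV) (θ : Param N) : Measurable (tdError M V θ) :=
  (M.measurable_r.add (((hV.measurable θ).comp measurable_snd.snd).const_mul _)).sub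
    ((hV.measurable θ).comp measurable_fst)

theorem measurable_weightedFeature {M : OffPolicyMDP S A} {V : Param N → S → ℝ} {Cv Cφ Dv LV : ℝ}
    (hV : BoundedSmooth V Cv Cφ Dv LV) (θ : Param N) :
    Measurable fun x : S × A × S =>
      (M.ρ x.1 x.2.1 * tdError M V θ x) • feature V θ x.1 :=
  ((measurable_ratio_sample M).mul (measurable_tdError hV θ)).smul
    ((hV.measurable_feature θ).comp measurable_fst)

/-- The constant dominating all the constants of the assumptions. -/
def masterConst (γ rmax Cv Cφ Dv LV lam ρmax : ℝ) : ℝ :=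
  1 + rmax + Cv + Cφ + Dv + LV + ρmax + 1 / lam + projRadius γ rmax Cv Cφ lam ρmax

/-- The projection radius is a summand of `masterConst` because the fast iterate itself enters the
bounds, and `1 / lam` because it bounds the inverse of the Gram operator. -/
theorem Assumptions.regular {M : OffPolicyMDP S A} {μ : Measure S} {V : Param N → S → ℝ}
    {γ rmax Cv Cφ Dv LV lam ρmax : ℝ} (h : Assumptions M μ V γ rmax Cv Cφ Dv LV lam ρmax)
    (hγ : γ ∈ Set.Icc (0 : ℝ) 1) (hrmax : 0 ≤ rmax) (hCv : 0 < Cv) (hCφ : 0 < Cφ) (hDv : 0 < Dv)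
    (hLV : 0 < LV) (hlam : 0 < lam) (hρmax : 0 < ρmax) :
    Regular M μ V (masterConst γ rmax Cv Cφ Dv LV lam ρmax)
      (projRadius γ rmax Cv Cφ lam ρmax) := by
  have := h.isProb
  have hV := h.smooth
  have h0 := hγ.1
  have hR : 0 ≤ projRadius γ rmax Cv Cφ lam ρmax := by
    unfold projRadius
    positivity
  have hl : 0 < 1 / lam := by positivity
  have hKl : 1 / lam ≤ masterConst γ rmax Cv Cφ Dv LV lam ρmax := by
    unfold masterConst; linarith
  have hKρ : ρmax ≤ masterConst γ rmax Cv Cφ Dv LV lam ρmax := by unfold masterConst; linarith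
  have hco : ∀ θ w : Param N,
      lam * ‖w‖ ^ 2 ≤ ∫ x, inner ℝ (feature V θ x.1) w ^ 2 ∂(M.sampleLaw μ) := by
    intro θ w
    have hH : (gramMatrix μ V θ).IsHermitian := by
      ext i j
      simp [gramMatrix, mul_comm]
    have := hermitian_coercive hH (h.nonSingular θ) (WithLp.ofLp w)
    rw [sum_mul_gram M hV θ w] at this
    refine le_trans (le_of_eq ?_) this
    rw [EuclideanSpace.real_norm_sq_eq]
    simp [dotProduct, pow_two]
  refine ⟨by unfold masterConst; linarith, hR, by unfold masterConst; linarith, h.isProb, ?_,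
    fun x => (h.reward_le x).trans (by unfold masterConst; linarith),
    fun s => ⟨(h.ratio s).1, (h.ratio s).2.mono fun a ha => ha.trans hKρ⟩, ?_, ?_⟩
  · refine ⟨hV.measurable, hV.contDiff, fun θ s => (hV.abs_le θ s).trans ?_,
      fun θ s => (hV.feature_le θ s).trans ?_, fun θ s => (hV.hessian_le θ s).trans ?_,
      fun θ η s => (hV.hessian_lip θ η s).trans (mul_le_mul_of_nonneg_right ?_ (norm_nonneg _))⟩
    all_goals unfold masterConst; linarith
  · intro θ w
    have h1 := hco θ w
    have h2 : 0 ≤ ∫ x, inner ℝ (feature V θ x.1) w ^ 2 ∂(M.sampleLaw μ) :=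
      le_trans (by positivity) h1
    calc ‖w‖ ^ 2 = 1 / lam * (lam * ‖w‖ ^ 2) := by field_simp
      _ ≤ 1 / lam * _ := by gcongr
      _ ≤ _ := mul_le_mul_of_nonneg_right hKl h2
  · intro θ w hw
    have h1 := hco θ w
    rw [← hw] at h1
    -- The algorithm's radius is exactly the bound on the norm of E[ρ δ φ] divided by `lam`.
    -- Together with `lam * ‖w‖ ^ 2 ≤ ⟨w, E[ρ δ φ]⟩` it gives `‖w‖ ≤ R` after cancelling `‖w‖`.
    have h2 : ‖∫ x, (M.ρ x.1 x.2.1 * tdError M V θ x) • feature V θ x.1 ∂(M.sampleLaw μ)‖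
        ≤ lam * projRadius γ rmax Cv Cφ lam ρmax := by
      refine norm_integral_le ((ae_sampleLaw_good h.ratio μ).mono fun x hx => ?_)
      have hδ : |tdError M V θ x| ≤ rmax + (1 + γ) * Cv := by
        have a1 := abs_le.1 (hV.abs_le θ x.1)
        have a2 := abs_le.1 (hV.abs_le θ x.2.2)
        have a3 := M.r_nonneg x
        have a4 := h.reward_le x
        have a5 : |γ * V θ x.2.2| ≤ γ * Cv := by
          rw [abs_mul, abs_of_nonneg h0]
          exact mul_le_mul_of_nonneg_left (hV.abs_le θ x.2.2) h0
        have a6 := abs_le.1 a5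
        unfold tdError
        rw [h.discount, abs_le]
        constructor <;> linarith [a1.1, a1.2, a6.1, a6.2]
      rw [norm_smul, norm_mul, Real.norm_of_nonneg (ratio_nonneg M _ _), Real.norm_eq_abs]
      calc M.ρ x.1 x.2.1 * |tdError M V θ x| * ‖feature V θ x.1‖
          ≤ ρmax * (rmax + (1 + γ) * Cv) * Cφ := by
            have := hV.feature_le θ x.1
            have : M.ρ x.1 x.2.1 ≤ ρmax := hx
            gcongr
        _ = _ := by
          unfold projRadius
          field_simp
    have h3 := (real_inner_le_norm w _).trans (mul_le_mul_of_nonneg_left h2 (norm_nonneg w))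
    rcases (norm_nonneg w).eq_or_lt with h4 | h4
    · rw [← h4]; exact hR
    · have h5 : lam * ‖w‖ * ‖w‖ ≤ lam * ‖w‖ * projRadius γ rmax Cv Cφ lam ρmax := by nlinarith
      exact le_of_mul_le_mul_left h5 (by positivity)

end Model

/-! ### Mean-field quantities and their regularity -/

section MeanField

set_option maxSynthPendingDepth 3

section Calculus

variable {E F : Type*} [NormedAddCommGroup E] [NormedSpace ℝ E]
  [NormedAddCommGroup F] [NormedSpace ℝ F]

theorem C11.const_smul {K k c : ℝ} {f : E → F} {f' : E → E →L[ℝ] F} (h : C11 K f f')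
    (hc : |c| ≤ k) : C11 (k * K) (fun x => c • f x) (fun x => c • f' x) where
  hasFDerivAt x := (h.hasFDerivAt x).const_smul c
  bound x := by
    rw [norm_smul]
    exact mul_le_mul hc (h.bound x) (norm_nonneg _) ((abs_nonneg _).trans hc)
  bound' x := by
    rw [norm_smul]
    exact mul_le_mul hc (h.bound' x) (norm_nonneg _) ((abs_nonneg _).trans hc)
  lip' x y := by
    rw [← smul_sub, norm_smul, mul_assoc]
    exact mul_le_mul hc (h.lip' x y) (norm_nonneg _) ((abs_nonneg _).trans hc)

theorem BL.const_smul {P : Type*} [NormedAddCommGroup P] {K k c : ℝ} {D : Set P} {f : P → F}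
    (h : BL K D f) (hc : |c| ≤ k) : BL (k * K) D (fun x => c • f x) where
  nonneg := mul_nonneg ((abs_nonneg _).trans hc) h.nonneg
  bound p hp := by
    rw [norm_smul]
    exact mul_le_mul hc (h.bound p hp) (norm_nonneg _) ((abs_nonneg _).trans hc)
  lip p hp q hq := by
    rw [← smul_sub, norm_smul, mul_assoc]
    exact mul_le_mul hc (h.lip p hp q hq) (norm_nonneg _) ((abs_nonneg _).trans hc)

end Calculus

/-- The rank-one operator `w ↦ ⟨a, w⟩ b`, as a bilinear map of `(a, b)`. -/
def outer (N : ℕ) : Param N →L[ℝ] Param N →L[ℝ] Param N →L[ℝ] Param N :=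
  (ContinuousLinearMap.smulRightL ℝ (Param N) (Param N)).comp (innerSL ℝ)

@[simp] theorem outer_apply {N : ℕ} (a b w : Param N) : outer N a b w = inner ℝ a w • b := rfl

theorem norm_outer_le (N : ℕ) : ‖outer N‖ ≤ 1 := by
  refine (ContinuousLinearMap.opNorm_comp_le _ _).trans ?_
  have h1 := ContinuousLinearMap.norm_smulRightL_le (𝕜 := ℝ) (E := Param N) (Fₗ := Param N)
  have h2 := norm_innerSL_le ℝ (E := Param N)
  calc _ ≤ (1 : ℝ) * 1 := by
        apply mul_le_mul h1 h2 (norm_nonneg _) zero_le_one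
    _ = 1 := by ring

/-- The region of parameters in which the iterates live after the first projection. -/
def tube (N : ℕ) (R : ℝ) : Set (Param N × Param N) := {p | ‖p.2‖ ≤ R}

section MeanField

variable {S A : Type*} [MeasurableSpace S] [MeasurableSpace A]
  [MeasurableSpace.CountableOrCountablyGenerated S A] {N : ℕ}
  (M : OffPolicyMDP S A) (μ : Measure S) (V : Param N → S → ℝ)

/-- `A_θ` as an operator. -/
def gramOp (θ : Param N) : Param N →L[ℝ] Param N :=
  ∫ x, outer N (feature V θ x.1) (feature V θ x.1) ∂(M.sampleLaw μ)

/-- `E[ρ δ(θ) φ_θ]`. -/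
def meanTD (θ : Param N) : Param N :=
  ∫ x, (M.ρ x.1 x.2.1 * tdError M V θ x) • feature V θ x.1 ∂(M.sampleLaw μ)

/-- The limit `A_θ⁻¹ E[ρ δ(θ) φ_θ]` of the fast iterate for a frozen `θ`. -/
def fastLimit (θ : Param N) : Param N := Ring.inverse (gramOp M μ V θ) (meanTD M μ V θ)

/-- The closed form `E[ρ δ φ]ᵀ A_θ⁻¹ E[ρ δ φ]` of the objective. -/
def objective (θ : Param N) : ℝ := inner ℝ (meanTD M μ V θ) (fastLimit M μ V θ)

/-- Mean direction of the slow iterate. -/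
def meanSlow (θ w : Param N) : Param N := ∫ x, slowDir M V x θ w ∂(M.sampleLaw μ)

/-- Derivative of `θ ↦ ρ δ(θ)`. -/
def tdDeriv (x : S × A × S) (θ : Param N) : Param N →L[ℝ] ℝ :=
  M.ρ x.1 x.2.1 • (M.γ • innerSL ℝ (feature V θ x.2.2) - innerSL ℝ (feature V θ x.1))

/-- Derivative of `θ ↦ ρ δ(θ) φ_θ`. -/
def weightedDeriv (x : S × A × S) (θ : Param N) : Param N →L[ℝ] Param N :=
  (ContinuousLinearMap.lsmul ℝ ℝ).precompR (Param N) (M.ρ x.1 x.2.1 * tdError M V θ x)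
      (hessian V θ x.1)
    + (ContinuousLinearMap.lsmul ℝ ℝ).precompL (Param N) (tdDeriv M V x θ) (feature V θ x.1)

/-- Derivative of `θ ↦ φ_θ φ_θᵀ`. -/
def outerDeriv (x : S × A × S) (θ : Param N) : Param N →L[ℝ] Param N →L[ℝ] Param N :=
  (outer N).precompR (Param N) (feature V θ x.1) (hessian V θ x.1)
    + (outer N).precompL (Param N) (hessian V θ x.1) (feature V θ x.1)

def meanTDDeriv (θ : Param N) : Param N →L[ℝ] Param N :=
  ∫ x, weightedDeriv M V x θ ∂(M.sampleLaw μ)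

def gramOpDeriv (θ : Param N) : Param N →L[ℝ] Param N →L[ℝ] Param N :=
  ∫ x, outerDeriv V x θ ∂(M.sampleLaw μ)

def fastLimitDeriv (θ : Param N) : Param N →L[ℝ] Param N :=
  (ContinuousLinearMap.id ℝ (Param N →L[ℝ] Param N)).precompR (Param N)
      (Ring.inverse (gramOp M μ V θ)) (meanTDDeriv M μ V θ)
    + (ContinuousLinearMap.id ℝ (Param N →L[ℝ] Param N)).precompL (Param N)
      ((-(ContinuousLinearMap.mulLeftRight ℝ (Param N →L[ℝ] Param N))
        (Ring.inverse (gramOp M μ V θ)) (Ring.inverse (gramOp M μ V θ))).comp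
        (gramOpDeriv M μ V θ)) (meanTD M μ V θ)

def objectiveDeriv (θ : Param N) : Param N →L[ℝ] ℝ :=
  (innerSL ℝ : Param N →L[ℝ] Param N →L[ℝ] ℝ).precompR (Param N) (meanTD M μ V θ)
      (fastLimitDeriv M μ V θ)
    + (innerSL ℝ : Param N →L[ℝ] Param N →L[ℝ] ℝ).precompL (Param N) (meanTDDeriv M μ V θ)
      (fastLimit M μ V θ)

/-- Each constant is read off from the rule producing it: `4 * K * L` for a product of `C11`
functions, `3 * K ^ 5` for an inverse, `2 * K * L` for a product of `BL` functions. The factor `3 *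
K ^ 2` belongs to ρ δ, a weight times three summands. -/
def meanTDConst (K : ℝ) : ℝ := 4 * (3 * K ^ 2) * K
def gramConst (K : ℝ) : ℝ := 4 * K * K
def inverseConst (K : ℝ) : ℝ := 3 * gramConst K ^ 5
def fastLimitConst (K : ℝ) : ℝ := 4 * inverseConst K * meanTDConst K
def objectiveConst (K : ℝ) : ℝ := 4 * meanTDConst K * fastLimitConst K
def slowConst (K : ℝ) : ℝ :=
  2 * (3 * K ^ 2) * K + 2 * (K * (2 * K * K)) * K
    + 2 * (3 * K ^ 2 + 2 * K * K) * (2 * K * K)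
def fastConst (K : ℝ) : ℝ := 2 * (2 * K * K) * K + 2 * (3 * K ^ 2) * K

namespace Regular

variable {M μ V} {K R : ℝ} (h : Regular M μ V K R)
include h

theorem c11_value (s : S) : C11 K (fun θ => V θ s) (fun θ => innerSL ℝ (feature V θ s)) :=
  h.smooth.c11_value le_rfl le_rfl le_rfl s

theorem c11_feature (s : S) : C11 K (fun θ => feature V θ s) (fun θ => hessian V θ s) :=
  h.smooth.c11_feature le_rfl le_rfl le_rfl s

theorem discount_abs : |M.γ| ≤ 1 := by
  rw [abs_of_nonneg M.γ_mem.1]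
  exact M.γ_mem.2

theorem ratio_abs {x : S × A × S} (hx : x ∈ goodSamples M K) : |M.ρ x.1 x.2.1| ≤ K := by
  rw [abs_of_nonneg (ratio_nonneg M _ _)]
  exact hx

theorem ae_good : ∀ᵐ x ∂(M.sampleLaw μ), x ∈ goodSamples M K := ae_sampleLaw_good h.ratio μ

theorem c11_td {x : S × A × S} (hx : x ∈ goodSamples M K) :
    C11 (3 * K ^ 2) (fun θ => M.ρ x.1 x.2.1 * tdError M V θ x) (tdDeriv M V x) := by
  have hr : C11 K (fun _ : Param N => M.r x) (fun _ => 0) := C11.const _ (by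
    rw [Real.norm_of_nonneg (M.r_nonneg x)]
    exact h.reward_le x)
  have := ((hr.add ((h.c11_value x.2.2).const_smul h.discount_abs)).add
    (h.c11_value x.1).neg).const_smul (h.ratio_abs hx)
  convert this using 1
  · ring
  · funext θ
    rw [smul_eq_mul, smul_eq_mul, ← sub_eq_add_neg]
    rfl
  · funext θ
    rw [zero_add, ← sub_eq_add_neg]
    rfl

theorem c11_weightedFeature {x : S × A × S} (hx : x ∈ goodSamples M K) :
    C11 (meanTDConst K) (fun θ => (M.ρ x.1 x.2.1 * tdError M V θ x) • feature V θ x.1)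
      (weightedDeriv M V x) :=
  C11.bilin (ContinuousLinearMap.lsmul ℝ ℝ) ContinuousLinearMap.opNorm_lsmul_le (h.c11_td hx)
    (h.c11_feature x.1)

theorem c11_outer (x : S × A × S) :
    C11 (gramConst K) (fun θ => outer N (feature V θ x.1) (feature V θ x.1)) (outerDeriv V x) :=
  C11.bilin (outer N) (norm_outer_le N) (h.c11_feature x.1) (h.c11_feature x.1)

theorem aesm_weightedFeature (θ : Param N) : AEStronglyMeasurable (fun x : S × A × S =>
      (M.ρ x.1 x.2.1 * tdError M V θ x) • feature V θ x.1) (M.sampleLaw μ) :=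
  (measurable_weightedFeature h.smooth θ).aestronglyMeasurable

theorem aesm_outer (θ : Param N) : AEStronglyMeasurable (fun x : S × A × S =>
      outer N (feature V θ x.1) (feature V θ x.1)) (M.sampleLaw μ) := by
  have hm : AEStronglyMeasurable (fun x : S × A × S => feature V θ x.1) (M.sampleLaw μ) :=
    ((h.smooth.measurable_feature θ).comp measurable_fst).aestronglyMeasurable
  exact (outer N).aestronglyMeasurable_comp₂ hm hm

theorem c11_meanTD : C11 (meanTDConst K) (meanTD M μ V) (meanTDDeriv M μ V) := by
  have := h.isProb
  exact C11.integral h.aesm_weightedFeature (h.ae_good.mono fun x hx => h.c11_weightedFeature hx)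

theorem c11_gramOp : C11 (gramConst K) (gramOp M μ V) (gramOpDeriv M μ V) := by
  have := h.isProb
  exact C11.integral h.aesm_outer (Filter.Eventually.of_forall fun x => h.c11_outer x)

theorem integrable_outer (θ : Param N) : Integrable (fun x : S × A × S =>
      outer N (feature V θ x.1) (feature V θ x.1)) (M.sampleLaw μ) := by
  have := h.isProb
  exact integrable_of_norm_le (h.aesm_outer θ)
    (Filter.Eventually.of_forall fun x => (h.c11_outer x).bound θ)

theorem integrable_weightedFeature (θ : Param N) : Integrable (fun x : S × A × S =>
      (M.ρ x.1 x.2.1 * tdError M V θ x) • feature V θ x.1) (M.sampleLaw μ) := by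
  have := h.isProb
  exact integrable_of_norm_le (h.aesm_weightedFeature θ)
    (h.ae_good.mono fun x hx => (h.c11_weightedFeature hx).bound θ)

theorem gramOp_apply (θ w : Param N) : gramOp M μ V θ w
    = ∫ x, inner ℝ (feature V θ x.1) w • feature V θ x.1 ∂(M.sampleLaw μ) := by
  rw [gramOp, ContinuousLinearMap.integral_apply (h.integrable_outer θ)]
  rfl

theorem inner_gramOp (θ w v : Param N) : inner ℝ v (gramOp M μ V θ w)
    = ∫ x, inner ℝ (feature V θ x.1) w * inner ℝ (feature V θ x.1) v ∂(M.sampleLaw μ) := by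
  rw [h.gramOp_apply]
  have hi : Integrable (fun x : S × A × S => inner ℝ (feature V θ x.1) w • feature V θ x.1)
    (M.sampleLaw μ) := (h.integrable_outer θ).apply_continuousLinearMap w
  rw [← integral_inner hi]
  congr 1
  funext x
  rw [inner_smul_right, real_inner_comm v]

theorem gramOp_symm (θ w v : Param N) :
    inner ℝ v (gramOp M μ V θ w) = inner ℝ (gramOp M μ V θ v) w := by
  rw [real_inner_comm w, h.inner_gramOp, h.inner_gramOp]
  simp only [mul_comm]

theorem gramOp_coercive (θ w : Param N) : ‖w‖ ^ 2 ≤ K * inner ℝ w (gramOp M μ V θ w) := by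
  rw [h.inner_gramOp]
  simpa only [pow_two] using h.coercive θ w

theorem norm_le_gramOp (θ w : Param N) : ‖w‖ ≤ K * ‖gramOp M μ V θ w‖ := by
  have h1 := h.gramOp_coercive θ w
  have h2 := real_inner_le_norm w (gramOp M μ V θ w)
  have hK : 0 ≤ K := zero_le_one.trans h.one_le
  rcases (norm_nonneg w).eq_or_lt with h4 | h4
  · rw [← h4]; positivity
  · have : ‖w‖ * ‖w‖ ≤ ‖w‖ * (K * ‖gramOp M μ V θ w‖) := by nlinarith
    exact le_of_mul_le_mul_left this h4

/-- Coercivity gives injectivity, and finite dimension gives the rest. -/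
theorem isUnit_gramOp (θ : Param N) : IsUnit (gramOp M μ V θ) := by
  have hinj : Function.Injective (gramOp M μ V θ) := by
    refine (injective_iff_map_eq_zero _).2 fun w hw => ?_
    have := h.norm_le_gramOp θ w
    rw [hw, norm_zero, mul_zero] at this
    exact norm_le_zero_iff.1 this
  have hsurj : Function.Surjective (gramOp M μ V θ) :=
    (LinearMap.injective_iff_surjective (f := (gramOp M μ V θ).toLinearMap)).1 hinj
  exact ContinuousLinearMap.isUnit_iff_bijective.2 ⟨hinj, hsurj⟩

theorem gramOp_inverse (θ v : Param N) :
    gramOp M μ V θ (Ring.inverse (gramOp M μ V θ) v) = v := by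
  have := Ring.mul_inverse_cancel _ (h.isUnit_gramOp θ)
  exact congrArg (fun L : Param N →L[ℝ] Param N => L v) this

theorem norm_inverse_le (θ : Param N) : ‖Ring.inverse (gramOp M μ V θ)‖ ≤ K := by
  refine ContinuousLinearMap.opNorm_le_bound _ (zero_le_one.trans h.one_le) fun v => ?_
  have := h.norm_le_gramOp θ (Ring.inverse (gramOp M μ V θ) v)
  rwa [h.gramOp_inverse] at this

theorem gramOp_fastLimit (θ : Param N) : gramOp M μ V θ (fastLimit M μ V θ) = meanTD M μ V θ :=
  h.gramOp_inverse θ _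

/-- Pair A ω = b with ω. The fast limit thus lies in the ball, so projecting the fast iterate never
takes it further from its target. -/
theorem norm_fastLimit_le (θ : Param N) : ‖fastLimit M μ V θ‖ ≤ R := by
  refine h.norm_le θ _ ?_
  have := h.inner_gramOp θ (fastLimit M μ V θ) (fastLimit M μ V θ)
  rw [h.gramOp_fastLimit] at this
  simp only [pow_two]
  exact this

theorem one_le_gramConst : 1 ≤ gramConst K := by
  have := h.one_le
  unfold gramConst
  nlinarith

theorem c11_fastLimit :
    C11 (fastLimitConst K) (fastLimit M μ V) (fastLimitDeriv M μ V) := by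
  have h1 := h.one_le
  have hi := C11.ringInverse h.one_le_gramConst h.c11_gramOp h.isUnit_gramOp
    (fun θ => (h.norm_inverse_le θ).trans (by unfold gramConst; nlinarith))
  exact C11.bilin (ContinuousLinearMap.id ℝ (Param N →L[ℝ] Param N))
    ContinuousLinearMap.norm_id_le hi h.c11_meanTD

theorem c11_objective :
    C11 (objectiveConst K) (objective M μ V) (objectiveDeriv M μ V) :=
  C11.bilin (innerSL ℝ) (norm_innerSL_le ℝ) h.c11_meanTD h.c11_fastLimit

/-! ### Directions of the two iterates -/

theorem bl_snd : BL K (tube N R) (fun p : Param N × Param N => p.2) where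
  nonneg := zero_le_one.trans h.one_le
  bound p hp := le_trans hp h.radius_le
  lip p _ q _ := by
    have h1 : ‖p.2 - q.2‖ ≤ ‖p - q‖ := norm_snd_le (p - q)
    nlinarith [h.one_le, norm_nonneg (p - q)]

theorem bl_td {x : S × A × S} (hx : x ∈ goodSamples M K) :
    BL (3 * K ^ 2) (tube N R) (fun p => M.ρ x.1 x.2.1 * tdError M V p.1 x) := (h.c11_td hx).bl

theorem bl_feature (s : S) : BL K (tube N R) (fun p => feature V p.1 s) := (h.c11_feature s).bl

theorem bl_inner (s : S) :
    BL (2 * K * K) (tube N R) (fun p => inner ℝ (feature V p.1 s) p.2) :=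
  (h.bl_feature s).inner h.bl_snd

/-- The direction is quadratic in `w`, through the product of ⟨φ, w⟩ with the Hessian applied to
`w`; bounds uniform in `w` are available only on the tube. -/
theorem bl_slowDir {x : S × A × S} (hx : x ∈ goodSamples M K) :
    BL (slowConst K) (tube N R) (fun p => slowDir M V x p.1 p.2) := by
  have hH : BL (2 * K * K) (tube N R) (fun p => hessian V p.1 x.1 p.2) :=
    (h.c11_feature x.1).bl_deriv.apply h.bl_snd
  have hγρ : |M.γ * M.ρ x.1 x.2.1| ≤ K := by
    rw [abs_mul]
    have := h.discount_abs
    have := h.ratio_abs hx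
    calc _ ≤ 1 * K := by gcongr
      _ = K := one_mul K
  exact (((h.bl_td hx).smul (h.bl_feature x.1)).sub
    (((h.bl_inner x.1).const_smul hγρ).smul (h.bl_feature x.2.2))).sub
    (((h.bl_td hx).sub (h.bl_inner x.1)).smul hH)

theorem bl_fastDir {x : S × A × S} (hx : x ∈ goodSamples M K) :
    BL (fastConst K) (tube N R) (fun p => fastDir M V x p.1 p.2) :=
  (((h.bl_inner x.1).smul (h.bl_feature x.1)).neg).add ((h.bl_td hx).smul (h.bl_feature x.1))

theorem measurable_slowDir : Measurable (fun q : (S × A × S) × (Param N × Param N) =>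
    slowDir M V q.1 q.2.1 q.2.2) := by
  have hφ : Measurable fun q : (S × A × S) × (Param N × Param N) => feature V q.2.1 q.1.1 :=
    h.smooth.measurable_feature_uncurry.comp (measurable_snd.fst.prodMk measurable_fst.fst)
  have hφ' : Measurable fun q : (S × A × S) × (Param N × Param N) => feature V q.2.1 q.1.2.2 :=
    h.smooth.measurable_feature_uncurry.comp (measurable_snd.fst.prodMk measurable_fst.snd.snd)
  have hV : Measurable fun q : (S × A × S) × (Param N × Param N) => V q.2.1 q.1.1 :=
    h.smooth.measurable_value_uncurry.comp (measurable_snd.fst.prodMk measurable_fst.fst)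
  have hV' : Measurable fun q : (S × A × S) × (Param N × Param N) => V q.2.1 q.1.2.2 :=
    h.smooth.measurable_value_uncurry.comp (measurable_snd.fst.prodMk measurable_fst.snd.snd)
  have hH : Measurable fun q : (S × A × S) × (Param N × Param N) =>
      hessian V q.2.1 q.1.1 q.2.2 :=
    h.smooth.measurable_hessian_uncurry.comp (measurable_snd.prodMk measurable_fst.fst)
  have hρ : Measurable fun q : (S × A × S) × (Param N × Param N) => M.ρ q.1.1 q.1.2.1 :=
    (measurable_ratio_sample M).comp measurable_fst
  have hδ : Measurable fun q : (S × A × S) × (Param N × Param N) => tdError M V q.2.1 q.1 :=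
    ((M.measurable_r.comp measurable_fst).add (hV'.const_mul _)).sub hV
  have hi := hφ.inner (𝕜 := ℝ) measurable_snd.snd
  exact (((hρ.mul hδ).smul hφ).sub (((hρ.const_mul M.γ).mul hi).smul hφ')).sub
    (((hρ.mul hδ).sub hi).smul hH)

theorem measurable_fastDir : Measurable (fun q : (S × A × S) × (Param N × Param N) =>
    fastDir M V q.1 q.2.1 q.2.2) := by
  have hφ : Measurable fun q : (S × A × S) × (Param N × Param N) => feature V q.2.1 q.1.1 :=
    h.smooth.measurable_feature_uncurry.comp (measurable_snd.fst.prodMk measurable_fst.fst)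
  have hV : Measurable fun q : (S × A × S) × (Param N × Param N) => V q.2.1 q.1.1 :=
    h.smooth.measurable_value_uncurry.comp (measurable_snd.fst.prodMk measurable_fst.fst)
  have hV' : Measurable fun q : (S × A × S) × (Param N × Param N) => V q.2.1 q.1.2.2 :=
    h.smooth.measurable_value_uncurry.comp (measurable_snd.fst.prodMk measurable_fst.snd.snd)
  have hρ : Measurable fun q : (S × A × S) × (Param N × Param N) => M.ρ q.1.1 q.1.2.1 :=
    (measurable_ratio_sample M).comp measurable_fst
  have hδ : Measurable fun q : (S × A × S) × (Param N × Param N) => tdError M V q.2.1 q.1 :=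
    ((M.measurable_r.comp measurable_fst).add (hV'.const_mul _)).sub hV
  have hi := hφ.inner (𝕜 := ℝ) measurable_snd.snd
  exact ((hi.smul hφ).neg).add ((hρ.mul hδ).smul hφ)

theorem integral_fastDir (θ w : Param N) :
    ∫ x, fastDir M V x θ w ∂(M.sampleLaw μ) = meanTD M μ V θ - gramOp M μ V θ w := by
  have hi : Integrable (fun x : S × A × S => inner ℝ (feature V θ x.1) w • feature V θ x.1)
    (M.sampleLaw μ) := (h.integrable_outer θ).apply_continuousLinearMap w
  simp only [fastDir]
  rw [integral_add (f := fun x : S × A × S => -(inner ℝ (feature V θ x.1) w • feature V θ x.1))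
    hi.neg (h.integrable_weightedFeature θ), integral_neg, h.gramOp_apply, meanTD]
  abel

end Regular

end MeanField

end MeanField

/-! ### The gradient formula -/

section Gradient

variable {S A : Type*} [MeasurableSpace S] [MeasurableSpace A]
  [MeasurableSpace.CountableOrCountablyGenerated S A] {N : ℕ}
  {M : OffPolicyMDP S A} {μ : Measure S} {V : Param N → S → ℝ}

theorem weightedDeriv_apply (x : S × A × S) (θ v : Param N) :
    weightedDeriv M V x θ v = (M.ρ x.1 x.2.1 * tdError M V θ x) • hessian V θ x.1 v
      + tdDeriv M V x θ v • feature V θ x.1 := rfl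

theorem outerDeriv_apply (x : S × A × S) (θ v w : Param N) :
    outerDeriv V x θ v w = inner ℝ (feature V θ x.1) w • hessian V θ x.1 v
      + inner ℝ (hessian V θ x.1 v) w • feature V θ x.1 := rfl

theorem tdDeriv_apply (x : S × A × S) (θ v : Param N) :
    tdDeriv M V x θ v = M.ρ x.1 x.2.1 *
      (M.γ * inner ℝ (feature V θ x.2.2) v - inner ℝ (feature V θ x.1) v) := rfl

namespace Regular

variable {K R : ℝ} (h : Regular M μ V K R)
include h

theorem integrable_slowDir (θ : Param N) {w : Param N} (hw : ‖w‖ ≤ R) :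
    Integrable (fun x => slowDir M V x θ w) (M.sampleLaw μ) := by
  have := h.isProb
  have hm : Measurable fun x => slowDir M V x θ w :=
    Measurable.comp (g := fun q : (S × A × S) × (Param N × Param N) =>
      slowDir M V q.1 q.2.1 q.2.2) (f := fun x => (x, (θ, w))) h.measurable_slowDir
      (measurable_id.prodMk measurable_const)
  have hmem : (θ, w) ∈ tube N R := hw
  exact integrable_of_norm_le (K := slowConst K) hm.aestronglyMeasurable
    (h.ae_good.mono fun x hx => (h.bl_slowDir hx).bound (θ, w) hmem)

/-- Differentiate A_θ ω(θ) = b(θ) by the product rule and use uniqueness of derivatives; this avoids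
handling the derivative of the inverse. -/
theorem fastLimitDeriv_eq (θ v : Param N) :
    gramOp M μ V θ (fastLimitDeriv M μ V θ v) + gramOpDeriv M μ V θ v (fastLimit M μ V θ)
      = meanTDDeriv M μ V θ v := by
  have h1 := (C11.bilin (ContinuousLinearMap.id ℝ (Param N →L[ℝ] Param N))
    ContinuousLinearMap.norm_id_le h.c11_gramOp h.c11_fastLimit).hasFDerivAt θ
  have h2 : (fun θ => ContinuousLinearMap.id ℝ (Param N →L[ℝ] Param N) (gramOp M μ V θ)
      (fastLimit M μ V θ)) = meanTD M μ V := funext fun θ => h.gramOp_fastLimit θ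
  rw [h2] at h1
  exact congrArg (fun L : Param N →L[ℝ] Param N => L v) (h1.unique (h.c11_meanTD.hasFDerivAt θ))

/-- The derivative ω' v is eliminated: ⟨b, ω' v⟩ = ⟨A ω, ω' v⟩ = ⟨ω, A ω' v⟩ by symmetry of A, and
`fastLimitDeriv_eq` evaluates A ω' v. -/
theorem objectiveDeriv_eq (θ v : Param N) :
    objectiveDeriv M μ V θ v = 2 * inner ℝ (fastLimit M μ V θ) (meanTDDeriv M μ V θ v)
      - inner ℝ (fastLimit M μ V θ) (gramOpDeriv M μ V θ v (fastLimit M μ V θ)) := by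
  have h1 : objectiveDeriv M μ V θ v = inner ℝ (meanTD M μ V θ) (fastLimitDeriv M μ V θ v)
      + inner ℝ (meanTDDeriv M μ V θ v) (fastLimit M μ V θ) := rfl
  have h2 := h.fastLimitDeriv_eq θ v
  have h3 := h.gramOp_symm θ (fastLimitDeriv M μ V θ v) (fastLimit M μ V θ)
  rw [h.gramOp_fastLimit, eq_sub_of_add_eq h2, inner_sub_right] at h3
  rw [h1, ← h3, real_inner_comm (fastLimit M μ V θ)]
  ring

theorem integrable_weightedDeriv (θ v : Param N) :
    Integrable (fun x => weightedDeriv M V x θ v) (M.sampleLaw μ) := by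
  have := h.isProb
  exact (C11.integrable_deriv h.aesm_weightedFeature
    (h.ae_good.mono fun x hx => h.c11_weightedFeature hx) θ).apply_continuousLinearMap v

theorem integrable_outerDeriv (θ v w : Param N) :
    Integrable (fun x => outerDeriv V x θ v w) (M.sampleLaw μ) := by
  have := h.isProb
  exact ((C11.integrable_deriv h.aesm_outer (Filter.Eventually.of_forall fun x => h.c11_outer x)
    θ).apply_continuousLinearMap v).apply_continuousLinearMap w

theorem meanTDDeriv_apply (θ v : Param N) :
    meanTDDeriv M μ V θ v = ∫ x, weightedDeriv M V x θ v ∂(M.sampleLaw μ) := by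
  have := h.isProb
  exact ContinuousLinearMap.integral_apply (C11.integrable_deriv h.aesm_weightedFeature
    (h.ae_good.mono fun x hx => h.c11_weightedFeature hx) θ) v

theorem gramOpDeriv_apply (θ v w : Param N) :
    gramOpDeriv M μ V θ v w = ∫ x, outerDeriv V x θ v w ∂(M.sampleLaw μ) := by
  have := h.isProb
  have hi := C11.integrable_deriv h.aesm_outer
    (Filter.Eventually.of_forall fun x => h.c11_outer x) θ
  rw [gramOpDeriv, ContinuousLinearMap.integral_apply hi,
    ContinuousLinearMap.integral_apply (hi.apply_continuousLinearMap v)]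

/-- The gradient of the objective is `-2` times the mean slow direction at the fast limit. -/
theorem objectiveDeriv_eq_meanSlow (θ v : Param N) :
    objectiveDeriv M μ V θ v = -2 * inner ℝ (meanSlow M μ V θ (fastLimit M μ V θ)) v := by
  have hP := h.isProb
  rw [h.objectiveDeriv_eq]
  set ω := fastLimit M μ V θ with hω
  have iw := h.integrable_weightedDeriv θ v
  have io := h.integrable_outerDeriv θ v ω
  have isl : Integrable (fun x => slowDir M V x θ ω) (M.sampleLaw μ) :=
    h.integrable_slowDir θ (h.norm_fastLimit_le θ)
  have ib := h.integrable_weightedFeature θ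
  have hφb : ∀ (s : S) (u : Param N), ‖inner ℝ (feature V θ s) u‖ ≤ K * ‖u‖ := fun s u =>
    (norm_inner_le_norm _ _).trans (by gcongr; exact h.smooth.feature_le θ s)
  have hfm : Measurable fun s => inner ℝ (feature V θ s) ω * inner ℝ (feature V θ s) v :=
    ((h.smooth.measurable_feature θ).inner measurable_const).mul
      ((h.smooth.measurable_feature θ).inner measurable_const)
  have hfb : ∀ s, ‖inner ℝ (feature V θ s) ω * inner ℝ (feature V θ s) v‖
      ≤ K * ‖ω‖ * (K * ‖v‖) := fun s => by
    rw [norm_mul]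
    exact mul_le_mul (hφb s ω) (hφb s v) (norm_nonneg _) ((norm_nonneg _).trans (hφb s ω))
  have irf : Integrable (fun x : S × A × S => M.ρ x.1 x.2.1 *
      (inner ℝ (feature V θ x.1) ω * inner ℝ (feature V θ x.1) v)) (M.sampleLaw μ) :=
    integrable_of_norm_le (K := K * (K * ‖ω‖ * (K * ‖v‖)))
      ((measurable_ratio_sample M).mul (hfm.comp measurable_fst)).aestronglyMeasurable
      (h.ae_good.mono fun x hx => by
        rw [norm_mul, Real.norm_eq_abs]
        exact mul_le_mul (h.ratio_abs hx) (hfb x.1) (norm_nonneg _)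
          ((abs_nonneg _).trans (h.ratio_abs hx)))
  have e1 : inner ℝ ω (meanTDDeriv M μ V θ v)
      = ∫ x, inner ℝ ω (weightedDeriv M V x θ v) ∂(M.sampleLaw μ) := by
    rw [h.meanTDDeriv_apply, integral_inner iw]
  have e2 : inner ℝ ω (gramOpDeriv M μ V θ v ω)
      = ∫ x, inner ℝ ω (outerDeriv V x θ v ω) ∂(M.sampleLaw μ) := by
    rw [h.gramOpDeriv_apply, integral_inner io]
  have e3 : inner ℝ (meanSlow M μ V θ ω) v
      = ∫ x, inner ℝ v (slowDir M V x θ ω) ∂(M.sampleLaw μ) := by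
    rw [real_inner_comm, integral_inner isl]
    rfl
  have e4 : inner ℝ v (meanTD M μ V θ) = ∫ x, inner ℝ v
      ((M.ρ x.1 x.2.1 * tdError M V θ x) • feature V θ x.1) ∂(M.sampleLaw μ) := by
    rw [integral_inner ib]
    rfl
  -- This is A ω = b tested against `v`, with the weight ρ inserted at no cost because the rest of
  -- the integrand depends on the state alone.
  have e5 : inner ℝ v (meanTD M μ V θ) = ∫ x, M.ρ x.1 x.2.1 *
      (inner ℝ (feature V θ x.1) ω * inner ℝ (feature V θ x.1) v) ∂(M.sampleLaw μ) := by
    rw [integral_ratio_fst (f := fun s => inner ℝ (feature V θ s) ω * inner ℝ (feature V θ s) v)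
      h.ratio μ hfm hfb, ← h.inner_gramOp, hω, h.gramOp_fastLimit]
  have jw := iw.const_inner (𝕜 := ℝ) ω
  have jo := io.const_inner (𝕜 := ℝ) ω
  have js := isl.const_inner (𝕜 := ℝ) v
  have jb := ib.const_inner (𝕜 := ℝ) v
  -- Pointwise, the Hessian terms cancel by symmetry and the γ φ(s') terms cancel outright. What is
  -- left has mean zero by `e4` and `e5`.
  have key : ∫ x, (2 * inner ℝ ω (weightedDeriv M V x θ v) - inner ℝ ω (outerDeriv V x θ v ω)
      + 2 * inner ℝ v (slowDir M V x θ ω)) ∂(M.sampleLaw μ)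
      = ∫ x, (2 * inner ℝ v ((M.ρ x.1 x.2.1 * tdError M V θ x) • feature V θ x.1)
        - 2 * (M.ρ x.1 x.2.1 *
          (inner ℝ (feature V θ x.1) ω * inner ℝ (feature V θ x.1) v))) ∂(M.sampleLaw μ) := by
    congr 1
    funext x
    have hs := hessian_symm (h.smooth.contDiff x.1) θ ω v
    have hs' : inner ℝ v (hessian V θ x.1 ω) = inner ℝ ω (hessian V θ x.1 v) := by
      rw [← hs, real_inner_comm]
    have c1 : inner ℝ ω (feature V θ x.1) = inner ℝ (feature V θ x.1) ω := real_inner_comm _ _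
    have c2 : inner ℝ v (feature V θ x.1) = inner ℝ (feature V θ x.1) v := real_inner_comm _ _
    have c3 : inner ℝ v (feature V θ x.2.2) = inner ℝ (feature V θ x.2.2) v := real_inner_comm _ _
    have c4 : inner ℝ (hessian V θ x.1 v) ω = inner ℝ ω (hessian V θ x.1 v) := real_inner_comm _ _
    simp only [weightedDeriv_apply, outerDeriv_apply, tdDeriv_apply, slowDir, hTerm,
      inner_add_right, inner_sub_right, inner_smul_right, hs', c1, c2, c3, c4]
    ring
  have l1 : ∫ x, (2 * inner ℝ ω (weightedDeriv M V x θ v) - inner ℝ ω (outerDeriv V x θ v ω)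
      + 2 * inner ℝ v (slowDir M V x θ ω)) ∂(M.sampleLaw μ)
      = 2 * inner ℝ ω (meanTDDeriv M μ V θ v) - inner ℝ ω (gramOpDeriv M μ V θ v ω)
        + 2 * inner ℝ (meanSlow M μ V θ ω) v := by
    refine (integral_add ((jw.const_mul 2).sub jo) (js.const_mul 2)).trans ?_
    refine (congrArg₂ (· + ·) (integral_sub (jw.const_mul 2) jo) rfl).trans ?_
    simp only [integral_const_mul, e1, e2, e3]
  have l2 : ∫ x, (2 * inner ℝ v ((M.ρ x.1 x.2.1 * tdError M V θ x) • feature V θ x.1)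
        - 2 * (M.ρ x.1 x.2.1 *
          (inner ℝ (feature V θ x.1) ω * inner ℝ (feature V θ x.1) v))) ∂(M.sampleLaw μ) = 0 := by
    rw [integral_sub (jb.const_mul 2) (irf.const_mul 2), integral_const_mul, integral_const_mul,
      ← e4, ← e5, sub_self]
  linarith [key, l1, l2]

end Regular

end Gradient

/-! ### The objective is the projected Bellman error -/

section Projection

variable {S A : Type*} [MeasurableSpace S] [MeasurableSpace A] {N : ℕ}

theorem memLp_of_bounded {μ : Measure S} [IsProbabilityMeasure μ] {f : S → ℝ} {B : ℝ}
    (hm : AEStronglyMeasurable f μ) (hb : ∀ s, ‖f s‖ ≤ B) : MemLp f 2 μ :=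
  MemLp.of_bound hm B (Filter.Eventually.of_forall hb)

theorem inner_toL2 {μ : Measure S} {f g : S → ℝ} (hf : MemLp f 2 μ) (hg : MemLp g 2 μ) :
    inner ℝ (toL2 μ f) (toL2 μ g) = ∫ s, f s * g s ∂μ := by
  rw [toL2, toL2, dif_pos hf, dif_pos hg, L2.inner_def]
  refine integral_congr_ae ?_
  filter_upwards [hf.coeFn_toLp, hg.coeFn_toLp] with s h1 h2
  rw [h1, h2]
  simp [mul_comm]

theorem stronglyMeasurable_bellman (M : OffPolicyMDP S A) {v : S → ℝ} (hv : Measurable v) :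
    StronglyMeasurable (M.bellman v) := by
  have h1 : StronglyMeasurable fun q : (S × A) × S => M.r (q.1.1, q.1.2, q.2) + M.γ * v q.2 :=
    ((M.measurable_r.comp (measurable_fst.fst.prodMk
      (measurable_fst.snd.prodMk measurable_snd))).add
      ((hv.comp measurable_snd).const_mul _)).stronglyMeasurable
  exact (h1.integral_kernel_prod_right' (κ := M.P)).integral_kernel_prod_right' (κ := M.π)

variable [MeasurableSpace.CountableOrCountablyGenerated S A]
  {M : OffPolicyMDP S A} {μ : Measure S} {V : Param N → S → ℝ}

namespace Regular

variable {K R : ℝ} (h : Regular M μ V K R)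
include h

theorem abs_backup_le (θ : Param N) (x : S × A × S) : ‖M.r x + M.γ * V θ x.2.2‖ ≤ 2 * K := by
  have h1 : ‖M.r x‖ ≤ K := by
    rw [Real.norm_of_nonneg (M.r_nonneg x)]
    exact h.reward_le x
  have h2 : ‖M.γ * V θ x.2.2‖ ≤ 1 * K := by
    rw [norm_mul]
    exact mul_le_mul h.discount_abs (h.smooth.abs_le θ _) (norm_nonneg _) zero_le_one
  linarith [norm_add_le (M.r x) (M.γ * V θ x.2.2)]

theorem memLp_bellmanError (θ : Param N) :
    MemLp (fun s => M.bellman (V θ) s - V θ s) 2 μ := by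
  have := h.isProb
  refine memLp_of_bounded (B := 2 * K + K) ((stronglyMeasurable_bellman M
    (h.smooth.measurable θ)).sub (h.smooth.measurable θ).stronglyMeasurable).aestronglyMeasurable
    fun s => (norm_sub_le _ _).trans (add_le_add ?_ (h.smooth.abs_le θ s))
  refine norm_integral_le (Filter.Eventually.of_forall fun a => ?_)
  exact norm_integral_le (Filter.Eventually.of_forall fun s' => h.abs_backup_le θ (s, a, s'))

theorem measurable_coord (θ : Param N) (i : Fin N) : Measurable fun s => feature V θ s i :=
  (EuclideanSpace.proj (𝕜 := ℝ) i).continuous.measurable.comp (h.smooth.measurable_feature θ)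

theorem coord_le (θ : Param N) (i : Fin N) (s : S) : ‖feature V θ s i‖ ≤ K :=
  (PiLp.norm_apply_le _ i).trans (h.smooth.feature_le θ s)

theorem memLp_coord (θ : Param N) (i : Fin N) : MemLp (fun s => feature V θ s i) 2 μ := by
  have := h.isProb
  exact memLp_of_bounded (h.measurable_coord θ i).aestronglyMeasurable (h.coord_le θ i)

/-- The weights change the behavior policy into the target policy, after which the conditional mean
of the temporal-difference error given the state is the Bellman error. -/
theorem inner_coord_bellmanError (θ : Param N) (i : Fin N) :
    ∫ s, feature V θ s i * (M.bellman (V θ) s - V θ s) ∂μ = meanTD M μ V θ i := by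
  have := h.isProb
  have e1 : meanTD M μ V θ i = ∫ x, M.ρ x.1 x.2.1 * (feature V θ x.1 i * tdError M V θ x)
      ∂(M.sampleLaw μ) := by
    have := (EuclideanSpace.proj i : Param N →L[ℝ] ℝ).integral_comp_comm
      (h.integrable_weightedFeature θ)
    refine Eq.trans this.symm ?_
    congr 1
    funext x
    simp
    ring
  have hb : ∀ x, ‖feature V θ x.1 i * tdError M V θ x‖ ≤ K * (2 * K + K) := fun x => by
    rw [norm_mul]
    exact mul_le_mul (h.coord_le θ i x.1) ((norm_sub_le _ _).trans
      (add_le_add (h.abs_backup_le θ x) (h.smooth.abs_le θ x.1))) (norm_nonneg _)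
      (zero_le_one.trans h.one_le)
  have hm : Measurable fun x : S × A × S => feature V θ x.1 i * tdError M V θ x :=
    ((h.measurable_coord θ i).comp measurable_fst).mul (measurable_tdError h.smooth θ)
  rw [e1, integral_ratio h.ratio μ hm hb]
  congr 1
  funext s
  simp only [integral_const_mul]
  congr 1
  have hbm : Measurable fun q : A × S => M.r (s, q.1, q.2) + M.γ * V θ q.2 :=
    (M.measurable_r.comp measurable_prodMk_left).add
      (((h.smooth.measurable θ).comp measurable_snd).const_mul _)
  have i1 : ∀ a, Integrable (fun s' => M.r (s, a, s') + M.γ * V θ s') (M.P (s, a)) := fun a =>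
    integrable_of_norm_le (hbm.comp measurable_prodMk_left).aestronglyMeasurable
      (Filter.Eventually.of_forall fun s' => h.abs_backup_le θ (s, a, s'))
  have e2 : ∀ a, ∫ s', tdError M V θ (s, a, s') ∂(M.P (s, a))
      = (∫ s', (M.r (s, a, s') + M.γ * V θ s') ∂(M.P (s, a))) - V θ s := fun a => by
    simp only [tdError]
    rw [integral_sub (i1 a) (integrable_const _)]
    simp
  have i2 : Integrable (fun a => ∫ s', (M.r (s, a, s') + M.γ * V θ s') ∂(M.P (s, a)))
      (M.π s) := by
    refine integrable_of_norm_le (K := 2 * K) ?_ (Filter.Eventually.of_forall fun a =>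
      norm_integral_le (Filter.Eventually.of_forall fun s' => h.abs_backup_le θ (s, a, s')))
    have h1 : StronglyMeasurable fun q : (S × A) × S =>
        M.r (q.1.1, q.1.2, q.2) + M.γ * V θ q.2 :=
      ((M.measurable_r.comp (measurable_fst.fst.prodMk
        (measurable_fst.snd.prodMk measurable_snd))).add
        (((h.smooth.measurable θ).comp measurable_snd).const_mul _)).stronglyMeasurable
    exact ((h1.integral_kernel_prod_right' (κ := M.P)).comp_measurable
      measurable_prodMk_left).aestronglyMeasurable
  simp only [e2]
  rw [integral_sub i2 (integrable_const _)]
  simp [OffPolicyMDP.bellman]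

/-- The candidate for the projection is the combination `p` of the features with coefficients ω. The
equation A ω = b says that `p` and the Bellman error have the same inner products with all features,
so their difference is orthogonal to the tangent plane, and ‖p‖² = ⟨b, ω⟩. -/
theorem mspbe_eq_objective : mspbe M μ V = objective M μ V := by
  have := h.isProb
  funext θ
  set u : Lp ℝ 2 μ := toL2 μ (fun s => M.bellman (V θ) s - V θ s) with hu
  set e : Fin N → Lp ℝ 2 μ := fun i => toL2 μ (fun s => feature V θ s i) with he
  set ω := fastLimit M μ V θ with hω
  set p : Lp ℝ 2 μ := ∑ i, ω i • e i with hp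
  have hpu : ∀ i, inner ℝ (e i) u = meanTD M μ V θ i := fun i => by
    rw [← h.inner_coord_bellmanError θ i]
    exact inner_toL2 (h.memLp_coord θ i) (h.memLp_bellmanError θ)
  have hpp : ∀ i, inner ℝ (e i) p = meanTD M μ V θ i := fun i => by
    have e1 : meanTD M μ V θ i
        = inner ℝ (EuclideanSpace.single i (1 : ℝ)) (gramOp M μ V θ ω) := by
      rw [hω, h.gramOp_fastLimit]
      simp [EuclideanSpace.inner_single_left]
    have hint : ∀ j, Integrable (fun s => feature V θ s i * feature V θ s j) μ := fun j =>
      integrable_of_norm_le (K := K * K)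
        ((h.measurable_coord θ i).mul (h.measurable_coord θ j)).aestronglyMeasurable
        (Filter.Eventually.of_forall fun s => by
          rw [norm_mul]
          exact mul_le_mul (h.coord_le θ i s) (h.coord_le θ j s) (norm_nonneg _)
            (zero_le_one.trans h.one_le))
    rw [e1, h.inner_gramOp, integral_sampleLaw_fst M μ (f := fun s =>
      inner ℝ (feature V θ s) ω * inner ℝ (feature V θ s) (EuclideanSpace.single i (1 : ℝ)))
      (((h.smooth.measurable_feature θ).inner measurable_const).mul
      ((h.smooth.measurable_feature θ).inner measurable_const)).aestronglyMeasurable]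
    have e2 : ∀ s, inner ℝ (feature V θ s) ω
        * inner ℝ (feature V θ s) (EuclideanSpace.single i (1 : ℝ))
        = ∑ j, ω j * (feature V θ s i * feature V θ s j) := fun s => by
      rw [EuclideanSpace.inner_single_right, PiLp.inner_apply, Finset.sum_mul]
      refine Finset.sum_congr rfl fun j _ => ?_
      simp
      ring
    simp only [e2]
    rw [integral_finsetSum _ fun j _ => (hint j).const_mul _, hp, inner_sum]
    refine Finset.sum_congr rfl fun j _ => ?_
    rw [inner_smul_right, integral_const_mul,
      inner_toL2 (h.memLp_coord θ i) (h.memLp_coord θ j)]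
  have hpm : p ∈ tangentPlane μ V θ :=
    Submodule.sum_mem _ fun i _ => Submodule.smul_mem _ _
      (Submodule.subset_span (Set.mem_range_self i))
  have horth : u - p ∈ (tangentPlane μ V θ)ᗮ := by
    rw [Submodule.mem_orthogonal]
    intro q hq
    induction hq using Submodule.span_induction with
    | mem x hx =>
      obtain ⟨i, rfl⟩ := hx
      change inner ℝ (e i) (u - p) = 0
      rw [inner_sub_right, hpu, hpp, sub_self]
    | zero => simp
    | add x y _ _ h1 h2 => rw [inner_add_left, h1, h2, add_zero]
    | smul c x _ h1 => rw [inner_smul_left, h1, mul_zero]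
  have hproj := Submodule.eq_starProjection_of_mem_orthogonal hpm horth
  have hnorm : ‖p‖ ^ 2 = objective M μ V θ := by
    have h1 : inner ℝ p p = inner ℝ (∑ i, ω i • e i) p := rfl
    rw [← real_inner_self_eq_norm_sq, h1, sum_inner, objective, PiLp.inner_apply]
    refine Finset.sum_congr rfl fun i _ => ?_
    rw [inner_smul_left, hpp]
    rfl
  rw [mspbe, hproj, hnorm]

/-- The gradient of the objective. -/
theorem hasGradientAt_mspbe (θ : Param N) :
    HasGradientAt (mspbe M μ V) ((-2 : ℝ) • meanSlow M μ V θ (fastLimit M μ V θ)) θ := by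
  rw [hasGradientAt_iff_hasFDerivAt, h.mspbe_eq_objective]
  have heq : InnerProductSpace.toDual ℝ (Param N)
      ((-2 : ℝ) • meanSlow M μ V θ (fastLimit M μ V θ)) = objectiveDeriv M μ V θ := by
    refine ContinuousLinearMap.ext fun v => ?_
    rw [h.objectiveDeriv_eq_meanSlow, InnerProductSpace.toDual_apply_apply, inner_smul_left]
    simp
  rw [heq]
  exact h.c11_objective.hasFDerivAt θ

end Regular

end Projection

/-! ### Two-timescale stochastic approximation -/

section TwoTimescale

variable {X : Type*} [MeasurableSpace X] {N : ℕ}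

/-- Regularity of a two-timescale scheme with mean-field objective `J`, gradient `g` of `J`, limit
`ws` of the fast iterate, and derivative `D` of `ws`. -/
structure TwoTimescale (ν : Measure X) (slow fast : X → Param N → Param N → Param N)
    (good : Set X) (J : Param N → ℝ) (g ws : Param N → Param N)
    (D : Param N → Param N →L[ℝ] Param N) (c lam R : ℝ) : Prop where
  isProb : IsProbabilityMeasure ν
  one_le : 1 ≤ c
  lam_pos : 0 < lam
  radius_nonneg : 0 ≤ R
  radius_le : R ≤ c
  measurable_slow : Measurable fun q : X × (Param N × Param N) => slow q.1 q.2.1 q.2.2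
  measurable_fast : Measurable fun q : X × (Param N × Param N) => fast q.1 q.2.1 q.2.2
  ae_good : ∀ᵐ x ∂ν, x ∈ good
  bl_slow : ∀ x ∈ good, BL c (tube N R) fun p => slow x p.1 p.2
  bl_fast : ∀ x ∈ good, BL c (tube N R) fun p => fast x p.1 p.2
  abs_le : ∀ θ, |J θ| ≤ c
  continuous : Continuous J
  expand : ∀ θ η, J η ≤ J θ + inner ℝ (g θ) (η - θ) + c * ‖η - θ‖ ^ 2
  grad_le : ∀ θ, ‖g θ‖ ≤ c
  grad_lip : ∀ θ η, ‖g θ - g η‖ ≤ c * ‖θ - η‖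
  limit_c11 : C11 c ws D
  limit_le : ∀ θ, ‖ws θ‖ ≤ R
  mean_slow : ∀ θ, ∫ x, slow x θ (ws θ) ∂ν = (-(1 / 2) : ℝ) • g θ
  mean_fast : ∀ θ w,
    inner ℝ (w - ws θ) (∫ x, fast x θ w ∂ν) ≤ -(lam * ‖w - ws θ‖ ^ 2)

/-- One step of the projected two-timescale iteration. -/
def stepMap (slow fast : X → Param N → Param N → Param N) (α β R : ℝ) (x : X)
    (p : Param N × Param N) : Param N × Param N :=
  (p.1 + α • slow x p.1 p.2, projBall R (p.2 + β • fast x p.1 p.2))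

theorem measurable_projBall (R : ℝ) : Measurable (projBall R : Param N → Param N) :=
  Measurable.ite (measurableSet_le measurable_norm measurable_const) measurable_id
    ((measurable_norm.const_div R).smul measurable_id)

/-- For `v` outside the ball, expanding the squares and using `⟨v, u⟩ ≤ ‖v‖ * R` leaves `(‖v‖ - R) ^
2 ≥ 0`. -/
theorem projBall_dist_le {R : ℝ} (hR : 0 ≤ R) (v u : Param N) (hu : ‖u‖ ≤ R) :
    ‖projBall R v - u‖ ^ 2 ≤ ‖v - u‖ ^ 2 := by
  unfold projBall
  split_ifs with h
  · exact le_rfl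
  · push Not at h
    have hv : 0 < ‖v‖ := hR.trans_lt h
    have h1 : ‖(R / ‖v‖) • v‖ = R := by
      rw [norm_smul, Real.norm_of_nonneg (by positivity)]
      field_simp
    rw [norm_sub_sq_real, norm_sub_sq_real, h1, inner_smul_left]
    have h2 : inner ℝ v u ≤ ‖v‖ * R :=
      (real_inner_le_norm v u).trans (by gcongr)
    have h3 : 0 ≤ 1 - R / ‖v‖ := by
      rw [sub_nonneg, div_le_one hv]
      exact h.le
    have h4 := mul_le_mul_of_nonneg_left h2 h3
    have h5 : (1 - R / ‖v‖) * (‖v‖ * R) = (‖v‖ - R) * R := by field_simp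
    simp only [conj_trivial]
    nlinarith [sq_nonneg (‖v‖ - R)]

end TwoTimescale

/-! ### The algorithm as a two-timescale scheme -/

section Model

variable {S A : Type*} [MeasurableSpace S] [MeasurableSpace A]
  [MeasurableSpace.CountableOrCountablyGenerated S A] {N : ℕ}
  {M : OffPolicyMDP S A} {μ : Measure S} {V : Param N → S → ℝ}

/-- The regularity constant of the two-timescale scheme. -/
def schemeConst (K : ℝ) : ℝ :=
  1 + K + objectiveConst K + fastLimitConst K + slowConst K + fastConst K

/-- The objective and its mean-field quantities form a regular two-timescale scheme. -/
theorem Regular.twoTimescale {K R : ℝ} (h : Regular M μ V K R) :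
    TwoTimescale (M.sampleLaw μ) (slowDir M V) (fastDir M V) (goodSamples M K) (mspbe M μ V)
      (gradient (mspbe M μ V)) (fastLimit M μ V) (fastLimitDeriv M μ V) (schemeConst K) (1 / K)
      R := by
  have hP := h.isProb
  have hK : 0 < K := zero_lt_one.trans_le h.one_le
  have o1 : 0 ≤ objectiveConst K := h.c11_objective.nonneg
  have o2 : 0 ≤ fastLimitConst K := h.c11_fastLimit.nonneg
  have o3 : 0 ≤ slowConst K := by unfold slowConst; positivity
  have o4 : 0 ≤ fastConst K := by unfold fastConst; positivity
  have hg : ∀ θ, gradient (mspbe M μ V) θ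
      = (-2 : ℝ) • meanSlow M μ V θ (fastLimit M μ V θ) := fun θ => (h.hasGradientAt_mspbe θ).gradient
  have hd : ∀ θ, InnerProductSpace.toDual ℝ (Param N) (gradient (mspbe M μ V) θ)
      = objectiveDeriv M μ V θ := fun θ => by
    have h1 := (h.hasGradientAt_mspbe θ)
    rw [← hg, hasGradientAt_iff_hasFDerivAt, h.mspbe_eq_objective] at h1
    rw [h.mspbe_eq_objective]
    exact h1.unique (h.c11_objective.hasFDerivAt θ)
  have cJ : C11 (schemeConst K) (mspbe M μ V) (objectiveDeriv M μ V) := by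
    rw [h.mspbe_eq_objective]
    exact h.c11_objective.mono (by unfold schemeConst; linarith)
  refine ⟨inferInstance, by unfold schemeConst; linarith, by positivity, h.radius_nonneg,
    h.radius_le.trans (by unfold schemeConst; linarith), h.measurable_slowDir,
    h.measurable_fastDir, h.ae_good,
    fun x hx => (h.bl_slowDir hx).mono (by unfold schemeConst; linarith),
    fun x hx => (h.bl_fastDir hx).mono (by unfold schemeConst; linarith), cJ.bound,
    cJ.continuous, ?_, ?_, ?_, h.c11_fastLimit.mono (by unfold schemeConst; linarith),
    h.norm_fastLimit_le, ?_, ?_⟩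
  · intro θ η
    have h1 := (le_abs_self _).trans (cJ.expand θ η)
    rw [← hd, InnerProductSpace.toDual_apply_apply] at h1
    linarith
  · intro θ
    rw [← LinearIsometryEquiv.norm_map (InnerProductSpace.toDual ℝ (Param N)), hd]
    exact cJ.bound' θ
  · intro θ η
    rw [← LinearIsometryEquiv.norm_map (InnerProductSpace.toDual ℝ (Param N)), map_sub, hd, hd]
    exact cJ.lip' θ η
  · intro θ
    rw [hg, smul_smul]
    norm_num
    rfl
  -- The mean fast direction is −A (w − ω), so the claim is coercivity of A with constant `1 / K`.
  · intro θ w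
    rw [h.integral_fastDir, ← h.gramOp_fastLimit θ, ← map_sub, ← neg_sub w, map_neg,
      inner_neg_right]
    have := h.gramOp_coercive θ (w - fastLimit M μ V θ)
    have h2 : 1 / K * ‖w - fastLimit M μ V θ‖ ^ 2 ≤ 1 / K * (K *
      inner ℝ (w - fastLimit M μ V θ) (gramOp M μ V θ (w - fastLimit M μ V θ))) := by gcongr
    have h3 : 1 / K * (K * inner ℝ (w - fastLimit M μ V θ)
      (gramOp M μ V θ (w - fastLimit M μ V θ)))
      = inner ℝ (w - fastLimit M μ V θ) (gramOp M μ V θ (w - fastLimit M μ V θ)) := by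
      field_simp
    linarith

end Model

/-! ### The Lyapunov function -/

section Lyapunov

variable {X : Type*} [MeasurableSpace X] {N : ℕ}

/-- Weight of the tracking error in the Lyapunov function. -/
def trackWeight (c lam : ℝ) : ℝ := c ^ 2 / lam

/-- Admissible ratio of the step sizes. -/
def stepRatio (c lam : ℝ) : ℝ := min 1 (lam / (2 * c ^ 2 + 2 * trackWeight c lam * c ^ 2))

/-- Lyapunov function: objective plus weighted squared tracking error. -/
def lyapunov (J : Param N → ℝ) (ws : Param N → Param N) (k ε : ℝ) (p : Param N × Param N) : ℝ :=
  J p.1 + k * ε * ‖p.2 - ws p.1‖ ^ 2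

/-- First-order change of the Lyapunov function in one step, per unit of the slow step size. -/
def driftTerm (slow fast : X → Param N → Param N → Param N) (g ws : Param N → Param N)
    (D : Param N → Param N →L[ℝ] Param N) (k ε : ℝ) (x : X) (p : Param N × Param N) : ℝ :=
  inner ℝ (g p.1) (slow x p.1 p.2) + 2 * k * inner ℝ (p.2 - ws p.1) (fast x p.1 p.2)
    - 2 * k * ε * inner ℝ (p.2 - ws p.1) (D p.1 (slow x p.1 p.2))

/-- Lipschitz constant of the drift. -/
def driftConst (c k : ℝ) : ℝ := 2 * c * c + 2 * k * (2 * (c + c) * c)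
    + 2 * k * (2 * (c + c) * (2 * c * c))

theorem stepRatio_pos {c lam : ℝ} (hc : 1 ≤ c) (hl : 0 < lam) : 0 < stepRatio c lam := by
  unfold stepRatio trackWeight
  positivity

/-- Here `n` is the gradient norm and `y` the tracking error. The choice `k * lam = c ^ 2` provides
−2c²y². One c²y² pays for the cross term `n c y` (square `s1`, cost n²/4). The other, through `hr`,
pays for the drift of the target, whose cross term costs n²/8 (square `s2`). Of the initial −n²/2
there remains −n²/8. -/
theorem drift_algebra {c lam k ε n y a b d : ℝ} (hε : 0 ≤ ε) (hε1 : ε ≤ 1) (hk0 : 0 ≤ k)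
    (hkl : k * lam = c ^ 2) (hr : ε * (2 * c ^ 2 + 2 * k * c ^ 2) ≤ lam)
    (t1 : a ≤ -(1 / 2) * n ^ 2 + n * (c * y)) (t2 : b ≤ -(lam * y ^ 2))
    (t3 : -d ≤ y * (c * (n / 2 + c * y))) :
    a + 2 * k * b - 2 * k * ε * d ≤ -(1 / 8) * n ^ 2 := by
  have hr2 : 2 * ε * c ^ 2 + 2 * k * ε ^ 2 * c ^ 2 ≤ lam := by
    have h1 : ε ^ 2 ≤ ε := by nlinarith
    have h2 : ε ^ 2 * (2 * k * c ^ 2) ≤ ε * (2 * k * c ^ 2) := by gcongr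
    linarith
  have m2 := mul_le_mul_of_nonneg_left t2 (by positivity : 0 ≤ 2 * k)
  have m3 := mul_le_mul_of_nonneg_left t3 (by positivity : 0 ≤ 2 * k * ε)
  have m4 := mul_le_mul_of_nonneg_left hr2 (by positivity : 0 ≤ k * y ^ 2)
  have hkl2 : k * y ^ 2 * lam = c ^ 2 * y ^ 2 := by rw [← hkl]; ring
  have s1 := sq_nonneg (n / 2 - c * y)
  have s2 := sq_nonneg (n / 4 - k * ε * c * y)
  linarith

namespace TwoTimescale

variable {ν : Measure X} {slow fast : X → Param N → Param N → Param N} {good : Set X}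
  {J : Param N → ℝ} {g ws : Param N → Param N} {D : Param N → Param N →L[ℝ] Param N}
  {c lam R : ℝ} (h : TwoTimescale ν slow fast good J g ws D c lam R)
include h

theorem c_pos : 0 < c := zero_lt_one.trans_le h.one_le

theorem trackWeight_pos : 0 < trackWeight c lam := by
  have := h.c_pos
  have := h.lam_pos
  unfold trackWeight
  positivity

theorem bl_snd : BL c (tube N R) (fun p : Param N × Param N => p.2) where
  nonneg := h.c_pos.le
  bound p hp := le_trans hp h.radius_le
  lip p _ q _ := by
    have h1 : ‖p.2 - q.2‖ ≤ ‖p - q‖ := norm_snd_le (p - q)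
    nlinarith [h.one_le, norm_nonneg (p - q)]

theorem bl_track : BL (c + c) (tube N R) (fun p : Param N × Param N => p.2 - ws p.1) :=
  h.bl_snd.sub h.limit_c11.bl

theorem bl_grad : BL c (tube N R) (fun p : Param N × Param N => g p.1) :=
  BL.of_fst h.c_pos.le h.grad_le h.grad_lip

/-- Since `ε ≤ 1`, the constant does not depend on the step sizes. -/
theorem bl_drift {k ε : ℝ} (hk : 0 ≤ k) (hε : 0 ≤ ε) (hε1 : ε ≤ 1) {x : X} (hx : x ∈ good) :
    BL (driftConst c k) (tube N R) (driftTerm slow fast g ws D k ε x) := by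
  have hkε : |2 * k * ε| ≤ 2 * k := by
    rw [abs_of_nonneg (by positivity)]
    nlinarith
  have hk2 : |2 * k| ≤ 2 * k := by
    rw [abs_of_nonneg (by positivity)]
  exact ((h.bl_grad.inner (h.bl_slow x hx)).add
    ((h.bl_track.inner (h.bl_fast x hx)).const_smul hk2)).sub
    ((h.bl_track.inner (h.limit_c11.bl_deriv.apply (h.bl_slow x hx))).const_smul hkε)

theorem continuous_grad : Continuous g := by
  have : LipschitzWith ⟨c, h.c_pos.le⟩ g := LipschitzWith.of_dist_le_mul fun x y => by
    rw [dist_eq_norm, dist_eq_norm]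
    exact h.grad_lip x y
  exact this.continuous

theorem continuous_limit_deriv : Continuous D := by
  have : LipschitzWith ⟨c, h.c_pos.le⟩ D := LipschitzWith.of_dist_le_mul fun x y => by
    rw [dist_eq_norm, dist_eq_norm]
    exact h.limit_c11.lip' x y
  exact this.continuous

theorem measurable_drift (k ε : ℝ) : Measurable fun q : X × (Param N × Param N) =>
    driftTerm slow fast g ws D k ε q.1 q.2 := by
  have hg : Measurable fun q : X × (Param N × Param N) => g q.2.1 :=
    h.continuous_grad.measurable.comp measurable_snd.fst
  have hw : Measurable fun q : X × (Param N × Param N) => q.2.2 - ws q.2.1 :=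
    measurable_snd.snd.sub (h.limit_c11.continuous.measurable.comp measurable_snd.fst)
  have hDc : Continuous fun q : Param N × Param N => D q.1 q.2 :=
    (h.continuous_limit_deriv.comp continuous_fst).clm_apply continuous_snd
  have hD : Measurable fun q : X × (Param N × Param N) => D q.2.1 (slow q.1 q.2.1 q.2.2) :=
    hDc.measurable.comp (measurable_snd.fst.prodMk h.measurable_slow)
  exact ((hg.inner h.measurable_slow).add ((hw.inner h.measurable_fast).const_mul (2 * k))).sub
    ((hw.inner hD).const_mul (2 * k * ε))

/-- One-step bound for the Lyapunov function along the iteration. -/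
theorem lyapunov_step {α β : ℝ} (hα : 0 ≤ α) (hβ : 0 < β) (hαβ : α ≤ β) {k : ℝ} (hk : 0 ≤ k)
    {x : X} (hx : x ∈ good) {p : Param N × Param N} (hp : ‖p.2‖ ≤ R) :
    lyapunov J ws k (α / β) (stepMap slow fast α β R x p)
      ≤ lyapunov J ws k (α / β) p + α * driftTerm slow fast g ws D k (α / β) x p
        + (8 * k + 1) * c ^ 4 * (α * β) := by
  obtain ⟨θ, w⟩ := p
  have hc := h.one_le
  have hc0 := h.c_pos
  set s := slow x θ w with hs
  set f := fast x θ w with hf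
  have hmem : (θ, w) ∈ tube N R := hp
  have ns : ‖s‖ ≤ c := (h.bl_slow x hx).bound (θ, w) hmem
  have nf : ‖f‖ ≤ c := (h.bl_fast x hx).bound (θ, w) hmem
  set z := w - ws θ with hz
  have nz : ‖z‖ ≤ 2 * c := by
    have := h.bl_track.bound (θ, w) hmem
    linarith
  set Δ := ws (θ + α • s) - ws θ with hΔ
  have nαs : ‖α • s‖ ≤ α * c := by
    rw [norm_smul, Real.norm_of_nonneg hα]
    gcongr
  have e1 : J (θ + α • s) ≤ J θ + α * inner ℝ (g θ) s + c * (α * c) ^ 2 := by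
    have h1 := h.expand θ (θ + α • s)
    rw [add_sub_cancel_left, inner_smul_right] at h1
    have : c * ‖α • s‖ ^ 2 ≤ c * (α * c) ^ 2 := by gcongr
    linarith
  have nΔ : ‖Δ‖ ≤ c * (α * c) := by
    have := h.limit_c11.lip (θ + α • s) θ
    rw [add_sub_cancel_left] at this
    exact this.trans (by gcongr)
  have nr : ‖Δ - α • D θ s‖ ≤ c * (α * c) ^ 2 := by
    have := h.limit_c11.expand θ (θ + α • s)
    rw [add_sub_cancel_left, map_smul] at this
    exact this.trans (by gcongr)
  -- The new target `ws (θ + α • s)` lies in the ball, so the projection may be dropped.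
  have e2 : ‖projBall R (w + β • f) - ws (θ + α • s)‖ ^ 2 ≤ ‖z + (β • f - Δ)‖ ^ 2 := by
    refine (projBall_dist_le h.radius_nonneg _ _ (h.limit_le _)).trans (le_of_eq ?_)
    congr 2
    rw [hz, hΔ]
    abel
  have e3 : ‖β • f - Δ‖ ≤ β * c + c * (α * c) := by
    refine (norm_sub_le _ _).trans (add_le_add ?_ nΔ)
    rw [norm_smul, Real.norm_of_nonneg hβ.le]
    gcongr
  clear_value Δ
  have e4 : ‖z + (β • f - Δ)‖ ^ 2 ≤ ‖z‖ ^ 2 + 2 * β * inner ℝ z f - 2 * α * inner ℝ z (D θ s)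
      + 2 * (2 * c * (c * (α * c) ^ 2)) + (β * c + c * (α * c)) ^ 2 := by
    have i1 : inner ℝ z (β • f - Δ) = β * inner ℝ z f - α * inner ℝ z (D θ s)
        - inner ℝ z (Δ - α • D θ s) := by
      rw [inner_sub_right, inner_sub_right, inner_smul_right, inner_smul_right]
      ring
    have i2 : |inner ℝ z (Δ - α • D θ s)| ≤ 2 * c * (c * (α * c) ^ 2) :=
      (abs_real_inner_le_norm _ _).trans (by gcongr)
    have i3 := (_root_.abs_le.1 i2).1
    have i4 : ‖β • f - Δ‖ ^ 2 ≤ (β * c + c * (α * c)) ^ 2 := by gcongr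
    rw [norm_add_sq_real, i1]
    linarith
  -- From `α ≤ β` and `1 ≤ c`, all second-order terms are of order β². Multiplied by the weight `k *
  -- (α / β)` they become of order αβ.
  have e5 : 2 * (2 * c * (c * (α * c) ^ 2)) + (β * c + c * (α * c)) ^ 2
      ≤ 8 * c ^ 4 * β ^ 2 := by
    have a1 : c * (α * c) ≤ c ^ 2 * β := by nlinarith [mul_le_mul_of_nonneg_left hαβ (sq_nonneg c)]
    have a2 : β * c ≤ c ^ 2 * β := by nlinarith [mul_pos hβ hc0]
    have a3 : (β * c + c * (α * c)) ^ 2 ≤ (2 * (c ^ 2 * β)) ^ 2 := by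
      have : 0 ≤ c * (α * c) := by positivity
      gcongr
      linarith
    have a4 : α ^ 2 ≤ β ^ 2 := by gcongr
    have a5 : c ^ 4 * α ^ 2 ≤ c ^ 4 * β ^ 2 := by gcongr
    nlinarith
  have e6 : c * (α * c) ^ 2 ≤ c ^ 4 * (α * β) := by
    have a1 : c ^ 3 ≤ c ^ 4 := pow_le_pow_right₀ hc (by norm_num)
    have a2 : α * α ≤ α * β := by gcongr
    calc c * (α * c) ^ 2 = c ^ 3 * (α * α) := by ring
      _ ≤ c ^ 4 * (α * β) := by gcongr
  have hkε : 0 ≤ k * (α / β) := by positivity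
  have e7 := mul_le_mul_of_nonneg_left (e2.trans (e4.trans (by linarith [e5] :
    _ ≤ ‖z‖ ^ 2 + 2 * β * inner ℝ z f - 2 * α * inner ℝ z (D θ s) + 8 * c ^ 4 * β ^ 2))) hkε
  have e8 : k * (α / β) * (‖z‖ ^ 2 + 2 * β * inner ℝ z f - 2 * α * inner ℝ z (D θ s)
      + 8 * c ^ 4 * β ^ 2) = k * (α / β) * ‖z‖ ^ 2 + α * (2 * k * inner ℝ z f)
      - α * (2 * k * (α / β) * inner ℝ z (D θ s)) + 8 * k * c ^ 4 * (α * β) := by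
    field_simp
  rw [e8] at e7
  simp only [lyapunov, stepMap, driftTerm]
  rw [← hs, ← hf, ← hz]
  nlinarith [e7, e1, e6]

theorem integrable_slow (θ w : Param N) (hw : ‖w‖ ≤ R) : Integrable (fun x => slow x θ w) ν := by
  have := h.isProb
  have hm : Measurable fun x => slow x θ w :=
    Measurable.comp (g := fun q : X × (Param N × Param N) => slow q.1 q.2.1 q.2.2)
      (f := fun x => (x, (θ, w))) h.measurable_slow (measurable_id.prodMk measurable_const)
  have hmem : (θ, w) ∈ tube N R := hw
  exact integrable_of_norm_le hm.aestronglyMeasurable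
    (h.ae_good.mono fun x hx => (h.bl_slow x hx).bound (θ, w) hmem)

theorem integrable_fast (θ w : Param N) (hw : ‖w‖ ≤ R) : Integrable (fun x => fast x θ w) ν := by
  have := h.isProb
  have hm : Measurable fun x => fast x θ w :=
    Measurable.comp (g := fun q : X × (Param N × Param N) => fast q.1 q.2.1 q.2.2)
      (f := fun x => (x, (θ, w))) h.measurable_fast (measurable_id.prodMk measurable_const)
  have hmem : (θ, w) ∈ tube N R := hw
  exact integrable_of_norm_le hm.aestronglyMeasurable
    (h.ae_good.mono fun x hx => (h.bl_fast x hx).bound (θ, w) hmem)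

/-- Under the mean field, the drift is negative. -/
theorem integral_drift_le {ε : ℝ} (hε : 0 ≤ ε) (hε0 : ε ≤ stepRatio c lam)
    {p : Param N × Param N} (hp : ‖p.2‖ ≤ R) :
    ∫ x, driftTerm slow fast g ws D (trackWeight c lam) ε x p ∂ν ≤ -(1 / 8) * ‖g p.1‖ ^ 2 := by
  have := h.isProb
  obtain ⟨θ, w⟩ := p
  have hc0 := h.c_pos
  have hl := h.lam_pos
  set k := trackWeight c lam with hk
  have hk0 : 0 < k := h.trackWeight_pos
  have hkl : k * lam = c ^ 2 := by rw [hk, trackWeight]; field_simp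
  set z := w - ws θ with hz
  have is := h.integrable_slow θ w hp
  have if' := h.integrable_fast θ w hp
  set G := ∫ x, slow x θ w ∂ν with hG
  have e0 : ∫ x, driftTerm slow fast g ws D k ε x (θ, w) ∂ν
      = inner ℝ (g θ) G + 2 * k * inner ℝ z (∫ x, fast x θ w ∂ν)
        - 2 * k * ε * inner ℝ z (D θ G) := by
    have hD := (D θ).integral_comp_comm is
    have j1 := is.const_inner (𝕜 := ℝ) (g θ)
    have j2 := if'.const_inner (𝕜 := ℝ) z
    have j3 := ((D θ).integrable_comp is).const_inner (𝕜 := ℝ) z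
    rw [hG, ← hD, ← integral_inner is, ← integral_inner if',
      ← integral_inner ((D θ).integrable_comp is), ← integral_const_mul, ← integral_const_mul,
      ← integral_add j1 (j2.const_mul _)]
    exact integral_sub (j1.add (j2.const_mul _)) (j3.const_mul _)
  -- At `w = ws θ` the mean slow direction is exactly −½ of the gradient; elsewhere the Lipschitz
  -- property in `w` controls the error by the tracking error.
  have nG : ‖G - (-(1 / 2) : ℝ) • g θ‖ ≤ c * ‖z‖ := by
    rw [hG, ← h.mean_slow θ, ← integral_sub is (h.integrable_slow θ _ (h.limit_le θ))]
    refine norm_integral_le (h.ae_good.mono fun x hx => ?_)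
    have := (h.bl_slow x hx).lip (θ, w) hp (θ, ws θ) (h.limit_le θ)
    simpa [Prod.norm_def] using this
  set e := G - (-(1 / 2) : ℝ) • g θ with he
  have hGe : G = (-(1 / 2) : ℝ) • g θ + e := by rw [he]; abel
  set n := ‖g θ‖ with hn
  set y := ‖z‖ with hy
  have hn0 : 0 ≤ n := norm_nonneg _
  have hy0 : 0 ≤ y := norm_nonneg _
  have t1 : inner ℝ (g θ) G ≤ -(1 / 2) * n ^ 2 + n * (c * y) := by
    rw [hGe, inner_add_right, inner_smul_right, real_inner_self_eq_norm_sq]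
    have : inner ℝ (g θ) e ≤ n * (c * y) := (real_inner_le_norm _ _).trans (by gcongr)
    linarith
  have t2 := h.mean_fast θ w
  have nG' : ‖G‖ ≤ n / 2 + c * y := by
    rw [hGe]
    refine (norm_add_le _ _).trans (add_le_add (le_of_eq ?_) nG)
    rw [norm_smul]
    norm_num
    ring
  have t3 : -inner ℝ z (D θ G) ≤ y * (c * (n / 2 + c * y)) := by
    have h1 : ‖D θ G‖ ≤ c * (n / 2 + c * y) :=
      ((D θ).le_opNorm G).trans (mul_le_mul (h.limit_c11.bound' θ) nG' (norm_nonneg _) hc0.le)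
    have h2 := (_root_.abs_le.1 (abs_real_inner_le_norm z (D θ G))).1
    have h3 : ‖z‖ * ‖D θ G‖ ≤ y * (c * (n / 2 + c * y)) := by gcongr
    linarith
  have hr : ε * (2 * c ^ 2 + 2 * k * c ^ 2) ≤ lam := by
    have h1 : ε ≤ lam / (2 * c ^ 2 + 2 * k * c ^ 2) := hε0.trans (min_le_right _ _)
    rwa [le_div_iff₀ (by positivity)] at h1
  have hε1 : ε ≤ 1 := hε0.trans (min_le_left _ _)
  rw [e0]
  exact drift_algebra hε hε1 hk0.le hkl hr t1 t2 t3

end TwoTimescale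

end Lyapunov

/-! ### Runs of the scheme and sampling noise -/

section Runs

variable {X : Type*} [MeasurableSpace X] {N : ℕ}

theorem measurableSet_tube (N : ℕ) (R : ℝ) : MeasurableSet (tube N R) :=
  measurableSet_le measurable_snd.norm measurable_const

/-- The drift, set to zero outside the region where it is bounded. -/
def truncDrift (Z : X → Param N × Param N → ℝ) (good : Set X) (R : ℝ)
    (q : X × (Param N × Param N)) : ℝ :=
  (good ×ˢ tube N R).indicator (fun q => Z q.1 q.2) q

/-- A run of the two-timescale iteration driven by the samples `x`. -/
structure Run {Ω : Type*} (slow fast : X → Param N → Param N → Param N) (α β R : ℝ)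
    (x : ℕ → Ω → X) (p : ℕ → Ω → Param N × Param N) : Prop where
  zero : ∃ p₀, ∀ ω, p 0 ω = p₀
  succ : ∀ t ω, p (t + 1) ω = stepMap slow fast α β R (x t ω) (p t ω)

theorem measurable_stepMap {slow fast : X → Param N → Param N → Param N}
    (hs : Measurable fun q : X × (Param N × Param N) => slow q.1 q.2.1 q.2.2)
    (hf : Measurable fun q : X × (Param N × Param N) => fast q.1 q.2.1 q.2.2) (α β R : ℝ) :
    Measurable fun q : X × (Param N × Param N) => stepMap slow fast α β R q.1 q.2 :=
  (measurable_snd.fst.add (hs.const_smul α)).prodMk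
    ((measurable_projBall R).comp (measurable_snd.snd.add (hf.const_smul β)))

variable {Ω : Type*} {ν : Measure X} {slow fast : X → Param N → Param N → Param N} {good : Set X}
  {J : Param N → ℝ} {g ws : Param N → Param N} {D : Param N → Param N →L[ℝ] Param N}
  {c lam R α β : ℝ} {x : ℕ → Ω → X} {p : ℕ → Ω → Param N × Param N}

/-- The iterates are measurable with respect to any increasing information containing the past
samples. -/
theorem Run.measurable_filtration (hr : Run slow fast α β R x p)
    (hs : Measurable fun q : X × (Param N × Param N) => slow q.1 q.2.1 q.2.2)
    (hf : Measurable fun q : X × (Param N × Param N) => fast q.1 q.2.1 q.2.2)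
    {m : ℕ → MeasurableSpace Ω} (hm : Monotone m) (hx : ∀ t, Measurable[m (t + 1)] (x t)) (t : ℕ) :
    Measurable[m t] (p t) := by
  induction t with
  | zero =>
    obtain ⟨p₀, h0⟩ := hr.zero
    have : p 0 = fun _ => p₀ := funext h0
    rw [this]
    exact measurable_const
  | succ t ih =>
    have : p (t + 1) = fun ω => stepMap slow fast α β R (x t ω) (p t ω) := funext (hr.succ t)
    rw [this]
    have ih' : Measurable[m (t + 1)] (p t) := ih.mono (hm (Nat.le_succ t)) le_rfl
    exact (measurable_stepMap hs hf α β R).comp ((hx t).prodMk ih')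

/-- Time zero is excluded: the initial fast iterate is arbitrary and enters the ball only with the
first projection. -/
theorem Run.mem_tube (hr : Run slow fast α β R x p) (hR : 0 ≤ R) {t : ℕ} (ht : 1 ≤ t) (ω : Ω) :
    p t ω ∈ tube N R := by
  obtain ⟨t, rfl⟩ := Nat.exists_eq_add_of_le' ht
  rw [hr.succ]
  exact (projBall_isProjection hR _).1

variable [MeasurableSpace Ω] {Pr : Measure Ω} [IsProbabilityMeasure Pr]

namespace TwoTimescale

variable (h : TwoTimescale ν slow fast good J g ws D c lam R)
include h

theorem run_measurable (hr : Run slow fast α β R x p) (hx : ∀ t, Measurable (x t)) (t : ℕ) :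
    Measurable (p t) :=
  hr.measurable_filtration h.measurable_slow h.measurable_fast
    (m := fun _ => inferInstance) monotone_const hx t

/-- The product norm is the maximum and `α ≤ β`. In the fast component the current iterate already
lies in the ball, so the projection does not lengthen the step. -/
theorem run_step_le (hr : Run slow fast α β R x p) (hα : 0 ≤ α) (hβ : 0 ≤ β) (hαβ : α ≤ β)
    {t : ℕ} (ht : 1 ≤ t) {ω : Ω} (hg : x t ω ∈ good) :
    ‖p (t + 1) ω - p t ω‖ ≤ c * β := by
  have hmem := hr.mem_tube h.radius_nonneg ht ω
  rw [hr.succ]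
  have ns := (h.bl_slow _ hg).bound _ hmem
  have nf := (h.bl_fast _ hg).bound _ hmem
  have hc := h.c_pos
  refine max_le ?_ ?_
  · simp only [stepMap, Prod.fst_sub, add_sub_cancel_left]
    rw [norm_smul, Real.norm_of_nonneg hα, mul_comm]
    gcongr
  · simp only [stepMap, Prod.snd_sub]
    have h1 := projBall_dist_le h.radius_nonneg
      ((p t ω).2 + β • fast (x t ω) (p t ω).1 (p t ω).2) (p t ω).2 hmem
    rw [add_sub_cancel_left] at h1
    refine (abs_le_of_sq_le_sq' h1 (norm_nonneg _)).2.trans ?_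
    rw [norm_smul, Real.norm_of_nonneg hβ, mul_comm]
    gcongr

theorem run_dist_le (hr : Run slow fast α β R x p) (hα : 0 ≤ α) (hβ : 0 ≤ β) (hαβ : α ≤ β)
    {t : ℕ} (ht : 1 ≤ t) {ω : Ω} (hg : ∀ i, x i ω ∈ good) (j : ℕ) :
    ‖p (t + j) ω - p t ω‖ ≤ j * (c * β) := by
  induction j with
  | zero => simp
  | succ j ih =>
    have h1 := h.run_step_le hr hα hβ hαβ (ht.trans (Nat.le_add_right t j)) (hg (t + j))
    have e : p (t + (j + 1)) ω - p t ω
        = (p (t + j + 1) ω - p (t + j) ω) + (p (t + j) ω - p t ω) := by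
      rw [← add_assoc]
      abel
    rw [e]
    refine (norm_add_le _ _).trans ?_
    push_cast
    linarith

theorem measurable_truncDrift (hgm : MeasurableSet good) (k ε : ℝ) :
    Measurable (truncDrift (driftTerm slow fast g ws D k ε) good R) :=
  (h.measurable_drift k ε).indicator (hgm.prod (measurableSet_tube N R))

/-- Truncation makes the bound hold everywhere, so Fubini and the conditional laws can be applied
without exceptional sets. -/
theorem abs_truncDrift_le {k ε : ℝ} (hk : 0 ≤ k) (hε : 0 ≤ ε) (hε1 : ε ≤ 1)
    (q : X × (Param N × Param N)) :
    ‖truncDrift (driftTerm slow fast g ws D k ε) good R q‖ ≤ driftConst c k := by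
  have hc := h.c_pos
  unfold truncDrift Set.indicator
  split_ifs with hq
  · exact (h.bl_drift hk hε hε1 hq.1).bound q.2 hq.2
  · rw [norm_zero]
    unfold driftConst
    positivity

theorem truncDrift_of_mem {k ε : ℝ} {a : X} {q : Param N × Param N} (ha : a ∈ good)
    (hq : q ∈ tube N R) : truncDrift (driftTerm slow fast g ws D k ε) good R (a, q)
      = driftTerm slow fast g ws D k ε a q :=
  Set.indicator_of_mem (Set.mk_mem_prod ha hq) _

theorem measurable_meanDrift (hgm : MeasurableSet good) (k ε : ℝ) :
    Measurable fun q => ∫ a, truncDrift (driftTerm slow fast g ws D k ε) good R (a, q) ∂ν := by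
  have := h.isProb
  exact ((h.measurable_truncDrift hgm k ε).stronglyMeasurable.integral_prod_left').measurable

theorem meanDrift_le {ε : ℝ} (hε : 0 ≤ ε) (hε0 : ε ≤ stepRatio c lam)
    {q : Param N × Param N} (hq : q ∈ tube N R) :
    ∫ a, truncDrift (driftTerm slow fast g ws D (trackWeight c lam) ε) good R (a, q) ∂ν
      ≤ -(1 / 8) * ‖g q.1‖ ^ 2 := by
  refine le_trans (le_of_eq ?_) (h.integral_drift_le hε hε0 hq)
  exact integral_congr_ae (h.ae_good.mono fun a ha => h.truncDrift_of_mem ha hq)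

theorem abs_lyapunov_le {k ε : ℝ} (hk : 0 ≤ k) (hε : 0 ≤ ε) (hε1 : ε ≤ 1)
    {q : Param N × Param N} (hq : q ∈ tube N R) :
    ‖lyapunov J ws k ε q‖ ≤ c + 4 * k * c ^ 2 := by
  have hc := h.c_pos
  have h1 := h.bl_track.bound q hq
  refine (norm_add_le _ _).trans (add_le_add (h.abs_le q.1) ?_)
  rw [Real.norm_of_nonneg (by positivity)]
  calc k * ε * ‖q.2 - ws q.1‖ ^ 2 ≤ k * 1 * (c + c) ^ 2 := by gcongr
    _ = _ := by ring

theorem measurable_lyapunov (k ε : ℝ) : Measurable (lyapunov J ws k ε) :=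
  (h.continuous.measurable.comp measurable_fst).add
    (((measurable_snd.sub (h.limit_c11.continuous.measurable.comp measurable_fst)).norm.pow_const
      2).const_mul (k * ε))

/-- Descent of the expected Lyapunov function along a run, up to sampling noise `η`. -/
theorem sum_grad_le (hgm : MeasurableSet good) (hr : Run slow fast α β R x p)
    (hx : ∀ t, Measurable (x t)) (hgood : ∀ᵐ ω ∂Pr, ∀ t, x t ω ∈ good)
    (hα : 0 < α) (hβ : 0 < β) (hε0 : α / β ≤ stepRatio c lam) (η : ℕ → ℝ)
    (hη : ∀ t, 1 ≤ t →
      ∫ ω, truncDrift (driftTerm slow fast g ws D (trackWeight c lam) (α / β)) good R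
        (x t ω, p t ω) ∂Pr
      ≤ ∫ ω, (∫ a, truncDrift (driftTerm slow fast g ws D (trackWeight c lam) (α / β)) good R
        (a, p t ω) ∂ν) ∂Pr + η t) (T : ℕ) :
    α * ∑ t ∈ Finset.range T, ∫ ω, ‖g (p (t + 1) ω).1‖ ^ 2 ∂Pr
      ≤ 16 * (c + 4 * trackWeight c lam * c ^ 2) + 8 * α * ∑ t ∈ Finset.range T, η (t + 1)
        + 8 * T * ((8 * trackWeight c lam + 1) * c ^ 4 * (α * β)) := by
  have hPν := h.isProb
  set k := trackWeight c lam with hk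
  have hk0 : 0 < k := h.trackWeight_pos
  have hc0 := h.c_pos
  have hε : 0 ≤ α / β := by positivity
  have hε1 : α / β ≤ 1 := hε0.trans (min_le_left _ _)
  have hαβ : α ≤ β := by rwa [div_le_one hβ] at hε1
  have hpm := h.run_measurable hr hx
  set Z := truncDrift (driftTerm slow fast g ws D k (α / β)) good R with hZ
  have iL : ∀ t, Integrable (fun ω => lyapunov J ws k (α / β) (p (t + 1) ω)) Pr := fun t =>
    integrable_of_norm_le ((h.measurable_lyapunov k (α / β)).comp
      (hpm (t + 1))).aestronglyMeasurable
      (Filter.Eventually.of_forall fun ω => h.abs_lyapunov_le hk0.le hε hε1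
        (hr.mem_tube h.radius_nonneg (Nat.le_add_left 1 t) ω))
  have iZ : ∀ t, Integrable (fun ω => Z (x (t + 1) ω, p (t + 1) ω)) Pr := fun t =>
    integrable_of_norm_le ((h.measurable_truncDrift hgm k (α / β)).comp
      ((hx (t + 1)).prodMk (hpm (t + 1)))).aestronglyMeasurable
      (Filter.Eventually.of_forall fun ω => h.abs_truncDrift_le hk0.le hε hε1 _)
  have iZb : ∀ t, Integrable (fun ω => ∫ a, Z (a, p (t + 1) ω) ∂ν) Pr := fun t =>
    integrable_of_norm_le ((h.measurable_meanDrift hgm k (α / β)).comp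
      (hpm (t + 1))).aestronglyMeasurable
      (Filter.Eventually.of_forall fun ω => norm_integral_le
        (Filter.Eventually.of_forall fun a => h.abs_truncDrift_le hk0.le hε hε1 _))
  have ig : ∀ t, Integrable (fun ω => ‖g (p (t + 1) ω).1‖ ^ 2) Pr := fun t =>
    integrable_of_norm_le (K := c ^ 2) ((h.continuous_grad.measurable.comp
      (hpm (t + 1)).fst).norm.pow_const 2).aestronglyMeasurable
      (Filter.Eventually.of_forall fun ω => by
        rw [norm_pow, norm_norm]
        have := h.grad_le (p (t + 1) ω).1
        gcongr)
  -- Times are shifted by one because the estimates hold only inside the tube, that is from time 1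
  -- on.
  have step : ∀ t, ∫ ω, lyapunov J ws k (α / β) (p (t + 1 + 1) ω) ∂Pr
      ≤ ∫ ω, lyapunov J ws k (α / β) (p (t + 1) ω) ∂Pr
        + α * (-(1 / 8) * ∫ ω, ‖g (p (t + 1) ω).1‖ ^ 2 ∂Pr + η (t + 1))
        + (8 * k + 1) * c ^ 4 * (α * β) := fun t => by
    have s1 : ∫ ω, lyapunov J ws k (α / β) (p (t + 1 + 1) ω) ∂Pr
        ≤ ∫ ω, (lyapunov J ws k (α / β) (p (t + 1) ω) + α * Z (x (t + 1) ω, p (t + 1) ω)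
          + (8 * k + 1) * c ^ 4 * (α * β)) ∂Pr := by
      refine integral_mono_ae (iL (t + 1))
        (((iL t).add ((iZ t).const_mul α)).add (integrable_const _)) ?_
      filter_upwards [hgood] with ω hω
      have hmem := hr.mem_tube h.radius_nonneg (Nat.le_add_left 1 t) ω
      simp only [hr.succ (t + 1) ω, hZ, h.truncDrift_of_mem (hω (t + 1)) hmem]
      exact h.lyapunov_step hα.le hβ hαβ hk0.le (hω (t + 1)) hmem
    have s2 : ∫ ω, (lyapunov J ws k (α / β) (p (t + 1) ω) + α * Z (x (t + 1) ω, p (t + 1) ω)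
          + (8 * k + 1) * c ^ 4 * (α * β)) ∂Pr
        = ∫ ω, lyapunov J ws k (α / β) (p (t + 1) ω) ∂Pr
          + α * ∫ ω, Z (x (t + 1) ω, p (t + 1) ω) ∂Pr + (8 * k + 1) * c ^ 4 * (α * β) := by
      refine (integral_add ((iL t).add ((iZ t).const_mul α)) (integrable_const _)).trans ?_
      refine (congrArg₂ (· + ·) (integral_add (iL t) ((iZ t).const_mul α)) rfl).trans ?_
      simp [integral_const_mul]
    have s3 : ∫ ω, (∫ a, Z (a, p (t + 1) ω) ∂ν) ∂Pr
        ≤ -(1 / 8) * ∫ ω, ‖g (p (t + 1) ω).1‖ ^ 2 ∂Pr := by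
      rw [← integral_const_mul]
      exact integral_mono (iZb t) ((ig t).const_mul _) fun ω =>
        h.meanDrift_le hε hε0 (hr.mem_tube h.radius_nonneg (Nat.le_add_left 1 t) ω)
    have s4 := (hη (t + 1) (Nat.le_add_left 1 t)).trans (add_le_add_left s3 _)
    have s5 := mul_le_mul_of_nonneg_left s4 hα.le
    linarith
  have main : ∀ n : ℕ, α / 8 * ∑ t ∈ Finset.range n, ∫ ω, ‖g (p (t + 1) ω).1‖ ^ 2 ∂Pr
      + ∫ ω, lyapunov J ws k (α / β) (p (n + 1) ω) ∂Pr
      ≤ ∫ ω, lyapunov J ws k (α / β) (p 1 ω) ∂Pr + α * ∑ t ∈ Finset.range n, η (t + 1)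
        + n * ((8 * k + 1) * c ^ 4 * (α * β)) := fun n => by
    induction n with
    | zero => simp
    | succ n ih =>
      rw [Finset.sum_range_succ, Finset.sum_range_succ]
      have := step n
      push_cast
      linarith
  -- The two ends of the telescoped sum; after multiplication by 8 they give the factor 16.
  have b1 : ‖∫ ω, lyapunov J ws k (α / β) (p 1 ω) ∂Pr‖ ≤ c + 4 * k * c ^ 2 :=
    norm_integral_le (Filter.Eventually.of_forall fun ω => h.abs_lyapunov_le hk0.le hε hε1
        (hr.mem_tube h.radius_nonneg le_rfl ω))
  have b2 : ‖∫ ω, lyapunov J ws k (α / β) (p (T + 1) ω) ∂Pr‖ ≤ c + 4 * k * c ^ 2 :=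
    norm_integral_le (Filter.Eventually.of_forall fun ω => h.abs_lyapunov_le hk0.le hε hε1
        (hr.mem_tube h.radius_nonneg (Nat.le_add_left 1 T) ω))
  have b1' := (_root_.abs_le.1 b1).2
  have b2' := (_root_.abs_le.1 b2).1
  have := main T
  linarith

/-- Independent sampling produces no noise. -/
theorem noise_of_indep (hgm : MeasurableSet good) {k ε : ℝ} (hk : 0 ≤ k) (hε : 0 ≤ ε)
    (hε1 : ε ≤ 1) {y : Ω → X} {q : Ω → Param N × Param N} (hy : Measurable y) (hq : Measurable q)
    (hlaw : Pr.map y = ν) (hind : IndepFun y q Pr) :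
    ∫ ω, truncDrift (driftTerm slow fast g ws D k ε) good R (y ω, q ω) ∂Pr
      = ∫ ω, (∫ a, truncDrift (driftTerm slow fast g ws D k ε) good R (a, q ω) ∂ν) ∂Pr := by
  have hPν := h.isProb
  have hm := h.measurable_truncDrift hgm k ε
  have hPq : IsProbabilityMeasure (Pr.map q) := Measure.isProbabilityMeasure_map hq.aemeasurable
  have h1 := (indepFun_iff_map_prod_eq_prod_map_map hy.aemeasurable hq.aemeasurable).1 hind
  rw [hlaw] at h1
  have h2 := integral_map (μ := Pr) (hy.prodMk hq).aemeasurable hm.aestronglyMeasurable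
  rw [← h2, h1, integral_prod_symm _ (integrable_of_norm_le hm.aestronglyMeasurable
    (Filter.Eventually.of_forall fun a => h.abs_truncDrift_le hk hε hε1 _)),
    integral_map hq.aemeasurable (h.measurable_meanDrift hgm k ε).aestronglyMeasurable]

/-- Replacing the current iterate by an earlier one in the noise. -/
theorem noise_le_delayed (hgm : MeasurableSet good) {k ε : ℝ} (hk : 0 ≤ k) (hε : 0 ≤ ε)
    (hε1 : ε ≤ 1) {y : Ω → X} {q q' : Ω → Param N × Param N} (hy : Measurable y)
    (hq : Measurable q) (hq' : Measurable q') (hqt : ∀ ω, q ω ∈ tube N R)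
    (hqt' : ∀ ω, q' ω ∈ tube N R) (hyg : ∀ᵐ ω ∂Pr, y ω ∈ good) {d e : ℝ}
    (hd : ∀ᵐ ω ∂Pr, ‖q ω - q' ω‖ ≤ d)
    (he : ∫ ω, truncDrift (driftTerm slow fast g ws D k ε) good R (y ω, q' ω) ∂Pr
      ≤ ∫ ω, (∫ a, truncDrift (driftTerm slow fast g ws D k ε) good R (a, q' ω) ∂ν) ∂Pr + e) :
    ∫ ω, truncDrift (driftTerm slow fast g ws D k ε) good R (y ω, q ω) ∂Pr
      ≤ ∫ ω, (∫ a, truncDrift (driftTerm slow fast g ws D k ε) good R (a, q ω) ∂ν) ∂Pr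
        + (2 * driftConst c k * d + e) := by
  have hPν := h.isProb
  have hB : 0 ≤ driftConst c k := by
    have := h.c_pos
    unfold driftConst
    positivity
  set Z := truncDrift (driftTerm slow fast g ws D k ε) good R with hZ
  have hm := h.measurable_truncDrift hgm k ε
  have hb := h.abs_truncDrift_le hk hε hε1
  have lipZ : ∀ a ∈ good, ∀ ω, ‖q ω - q' ω‖ ≤ d → |Z (a, q ω) - Z (a, q' ω)|
      ≤ driftConst c k * d := fun a ha ω hω => by
    rw [hZ, h.truncDrift_of_mem ha (hqt ω), h.truncDrift_of_mem ha (hqt' ω)]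
    exact ((h.bl_drift hk hε hε1 ha).lip _ (hqt ω) _ (hqt' ω)).trans (by gcongr)
  have i1 : ∀ {r : Ω → Param N × Param N}, Measurable r →
      Integrable (fun ω => Z (y ω, r ω)) Pr := fun hr =>
    integrable_of_norm_le (hm.comp (hy.prodMk hr)).aestronglyMeasurable
      (Filter.Eventually.of_forall fun ω => hb _)
  have i2 : ∀ {r : Ω → Param N × Param N}, Measurable r →
      Integrable (fun ω => ∫ a, Z (a, r ω) ∂ν) Pr := fun hr =>
    integrable_of_norm_le ((h.measurable_meanDrift hgm k ε).comp hr).aestronglyMeasurable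
      (Filter.Eventually.of_forall fun ω => norm_integral_le
        (Filter.Eventually.of_forall fun a => hb _))
  have i3 : ∀ z, Integrable (fun a => Z (a, z)) ν := fun z =>
    integrable_of_norm_le (hm.comp measurable_prodMk_right).aestronglyMeasurable
      (Filter.Eventually.of_forall fun a => hb _)
  -- The Lipschitz bound is used once with the actual sample and once under `ν`, whence the factor
  -- 2.
  have d1 : ‖∫ ω, (Z (y ω, q ω) - Z (y ω, q' ω)) ∂Pr‖ ≤ driftConst c k * d :=
    norm_integral_le (by filter_upwards [hyg, hd] with ω h1 h2 using lipZ _ h1 ω h2)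
  have d2 : ‖∫ ω, ((∫ a, Z (a, q ω) ∂ν) - ∫ a, Z (a, q' ω) ∂ν) ∂Pr‖ ≤ driftConst c k * d :=
    norm_integral_le (by
      filter_upwards [hd] with ω h2
      rw [← integral_sub (i3 _) (i3 _)]
      exact norm_integral_le (h.ae_good.mono fun a ha => lipZ a ha ω h2))
  rw [integral_sub (i1 hq) (i1 hq')] at d1
  rw [integral_sub (i2 hq) (i2 hq')] at d2
  have d1' := (_root_.abs_le.1 d1).2
  have d2' := (_root_.abs_le.1 d2).1
  linarith

end TwoTimescale

end Runs

/-! ### Total variation -/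

section TotalVariation

variable {S : Type*} [MeasurableSpace S]

theorem abs_real_sub_le_tvDist (μ ν : Measure S) [IsProbabilityMeasure μ] [IsProbabilityMeasure ν]
    {B : Set S} (hB : MeasurableSet B) : |μ.real B - ν.real B| ≤ tvDist μ ν := by
  refine le_ciSup (f := fun B : {B : Set S // MeasurableSet B} => |μ.real B.1 - ν.real B.1|)
    ⟨1, ?_⟩ ⟨B, hB⟩
  rintro _ ⟨C, rfl⟩
  have h1 : μ.real C.1 ≤ 1 := measureReal_le_one
  have h2 : ν.real C.1 ≤ 1 := measureReal_le_one
  have h3 : 0 ≤ μ.real C.1 := measureReal_nonneg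
  have h4 : 0 ≤ ν.real C.1 := measureReal_nonneg
  rw [abs_le]
  constructor <;> linarith

/-- Layer-cake formula for `f + B`, which takes values in `[0, 2 * B]`: the integrals differ by the
integral over levels of the difference of measures of superlevel sets, each at most the total
variation distance. -/
theorem abs_integral_sub_le_tvDist (μ ν : Measure S) [IsProbabilityMeasure μ]
    [IsProbabilityMeasure ν] {f : S → ℝ} {B : ℝ} (hf : Measurable f) (hb : ∀ s, ‖f s‖ ≤ B) :
    |∫ s, f s ∂μ - ∫ s, f s ∂ν| ≤ 2 * B * tvDist μ ν := by
  obtain ⟨s₀⟩ : Nonempty S := μ.nonempty_of_neZero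
  have hB : 0 ≤ B := (norm_nonneg _).trans (hb s₀)
  have hfi : ∀ (ξ : Measure S) [IsProbabilityMeasure ξ], Integrable f ξ := fun ξ _ =>
    integrable_of_norm_le hf.aestronglyMeasurable (Filter.Eventually.of_forall hb)
  have rep : ∀ (ξ : Measure S) [IsProbabilityMeasure ξ],
      ∫ s, f s ∂ξ + B = ∫ t in Set.Ioc 0 (2 * B), ξ.real {s | t ≤ f s + B} := fun ξ _ => by
    have h1 := Integrable.integral_eq_integral_Ioc_meas_le (μ := ξ) (f := fun s => f s + B)
      (M := 2 * B) ((hfi ξ).add (integrable_const B))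
      (Filter.Eventually.of_forall fun s => by
        have := (abs_le.1 (hb s)).1
        simp only [Pi.zero_apply]
        linarith)
      (Filter.Eventually.of_forall fun s => by
        have := (abs_le.1 (hb s)).2
        linarith)
    rw [← h1, integral_add (hfi ξ) (integrable_const B)]
    simp
  have hint : ∀ (ξ : Measure S) [IsProbabilityMeasure ξ],
      Integrable (fun t => ξ.real {s | t ≤ f s + B}) (volume.restrict (Set.Ioc 0 (2 * B))) :=
    fun ξ _ => by
    have hanti : Antitone fun t => ξ.real {s | t ≤ f s + B} := fun t t' htt =>
      measureReal_mono fun s hs => le_trans htt hs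
    refine integrable_of_norm_le (K := 1) hanti.measurable.aestronglyMeasurable
      (Filter.Eventually.of_forall fun t => ?_)
    rw [Real.norm_of_nonneg measureReal_nonneg]
    exact measureReal_le_one
  have e : ∫ s, f s ∂μ - ∫ s, f s ∂ν = ∫ t in Set.Ioc 0 (2 * B),
      (μ.real {s | t ≤ f s + B} - ν.real {s | t ≤ f s + B}) := by
    rw [integral_sub (hint μ) (hint ν), ← rep, ← rep]
    ring
  rw [e, ← Real.norm_eq_abs]
  refine (norm_integral_le_of_norm_le_const (C := tvDist μ ν)
    (Filter.Eventually.of_forall fun t => abs_real_sub_le_tvDist μ ν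
      (measurableSet_le measurable_const (hf.add_const B)))).trans (le_of_eq ?_)
  simp [Measure.real, hB, mul_comm]

end TotalVariation

/-! ### Conditional laws along a trajectory -/

section Trajectory

variable {S A : Type*} [MeasurableSpace S] [MeasurableSpace A] {Ω : Type*} [MeasurableSpace Ω]
  {M : OffPolicyMDP S A} {Pr : Measure Ω} [IsProbabilityMeasure Pr] {s : ℕ → Ω → S}
  {a : ℕ → Ω → A}

theorem history_mono (s : ℕ → Ω → S) (a : ℕ → Ω → A) : Monotone (history s a) := fun _ _ h =>
  sup_le_sup (biSup_mono fun _ hi => le_trans hi h) (biSup_mono fun _ hi => lt_of_lt_of_le hi h)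

theorem measurable_state_history (s : ℕ → Ω → S) (a : ℕ → Ω → A) {i t : ℕ} (hi : i ≤ t) :
    Measurable[history s a t] (s i) := by
  refine Measurable.mono (comap_measurable (s i)) ?_ le_rfl
  exact le_trans (le_biSup (fun i => MeasurableSpace.comap (s i) inferInstance)
    (show i ∈ Set.Iic t from hi)) le_sup_left

theorem measurable_action_history (s : ℕ → Ω → S) (a : ℕ → Ω → A) {i t : ℕ} (hi : i < t) :
    Measurable[history s a t] (a i) := by
  refine Measurable.mono (comap_measurable (a i)) ?_ le_rfl
  exact le_trans (le_biSup (fun i => MeasurableSpace.comap (a i) inferInstance)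
    (show i ∈ Set.Iio t from hi)) le_sup_right

instance isMarkovKernel_pow (κ : Kernel S S) [IsMarkovKernel κ] (j : ℕ) :
    IsMarkovKernel (κ ^ j) := by
  induction j with
  | zero => exact inferInstanceAs (IsMarkovKernel (Kernel.id : Kernel S S))
  | succ j ih =>
    rw [pow_succ']
    exact inferInstanceAs (IsMarkovKernel (κ ∘ₖ (κ ^ j)))

namespace Trajectory

variable (h : Trajectory M Pr s a)
include h

theorem history_le (t : ℕ) : history s a t ≤ (inferInstance : MeasurableSpace Ω) :=
  sup_le (iSup₂_le fun i _ => (h.measurable_s i).comap_le)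
    (iSup₂_le fun i _ => (h.measurable_a i).comap_le)

/-- Joint law of a function `q` of the past, the current state, and the next action and state. -/
theorem map_eq_compProd {Q : Type*} [MeasurableSpace Q] (t : ℕ) {q : Ω → Q}
    (hq : Measurable[history s a t] q) :
    Pr.map (fun ω => ((q ω, s t ω), (a t ω, s (t + 1) ω)))
      = (Pr.map fun ω => (q ω, s t ω)) ⊗ₘ (M.step.comap Prod.snd measurable_snd) := by
  have hle := h.history_le t
  have hr' : Measurable[history s a t] fun ω => (q ω, s t ω) :=
    hq.prodMk (measurable_state_history s a le_rfl)
  have hr : Measurable fun ω => (q ω, s t ω) := hr'.mono hle le_rfl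
  have hy : Measurable fun ω => (a t ω, s (t + 1) ω) :=
    (h.measurable_a t).prodMk (h.measurable_s (t + 1))
  have : IsProbabilityMeasure (Pr.map fun ω => ((q ω, s t ω), (a t ω, s (t + 1) ω))) :=
    Measure.isProbabilityMeasure_map (hr.prodMk hy).aemeasurable
  have : IsProbabilityMeasure (Pr.map fun ω => (q ω, s t ω)) :=
    Measure.isProbabilityMeasure_map hr.aemeasurable
  -- It suffices to compare rectangles `B ×ˢ C`. The event that the past lies in `B` belongs to the
  -- history, so the conditional law of the event `C` may be integrated over it.
  refine Measure.ext_prod fun {B C} hB hC => ?_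
  rw [Measure.compProd_apply_prod hB hC, Measure.map_apply (hr.prodMk hy) (hB.prod hC),
    setLIntegral_map hB ((Kernel.measurable_coe _ hC)) hr]
  simp only [Kernel.comap_apply]
  set E : Set Ω := (fun ω => (a t ω, s (t + 1) ω)) ⁻¹' C with hE
  set F : Set Ω := (fun ω => (q ω, s t ω)) ⁻¹' B with hF
  have hEm : MeasurableSet E := hy hC
  have hFm : MeasurableSet[history s a t] F := hr' hB
  have hi : Integrable (E.indicator fun _ => (1 : ℝ)) Pr :=
    (integrable_const 1).indicator hEm
  have h1 := setIntegral_condExp hle hi hFm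
  have h2 : ∫ ω in F, (Pr[E.indicator fun _ => (1 : ℝ) | history s a t]) ω ∂Pr
      = ∫ ω in F, (M.step (s t ω)).real C ∂Pr :=
    integral_congr_ae (ae_restrict_of_ae (h.condLaw t C hC))
  have h3 : ∫ ω in F, E.indicator (fun _ => (1 : ℝ)) ω ∂Pr = Pr.real (F ∩ E) := by
    rw [setIntegral_indicator hEm]
    simp
  rw [h2, h3] at h1
  have h4 : (fun ω => ((q ω, s t ω), (a t ω, s (t + 1) ω))) ⁻¹' (B ×ˢ C) = F ∩ E := rfl
  have hsm : Measurable fun ω => M.step (s t ω) C :=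
    (Kernel.measurable_coe M.step hC).comp (h.measurable_s t)
  have h5 : ∫ ω in F, (M.step (s t ω)).real C ∂Pr
      = (∫⁻ ω in F, M.step (s t ω) C ∂Pr).toReal :=
    integral_toReal hsm.aemeasurable (Filter.Eventually.of_forall fun ω => measure_lt_top _ _)
  have h6 : ∫⁻ ω in F, M.step (s t ω) C ∂Pr ≠ ⊤ := by
    refine ne_top_of_le_ne_top ENNReal.one_ne_top ?_
    calc ∫⁻ ω in F, M.step (s t ω) C ∂Pr ≤ ∫⁻ ω in F, 1 ∂Pr :=
          lintegral_mono fun ω => prob_le_one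
      _ ≤ 1 := by
        rw [setLIntegral_one]
        exact prob_le_one
  rw [h4, ← ENNReal.toReal_eq_toReal_iff' (measure_ne_top _ _) h6, ← h5, h1]
  rfl

theorem integral_step {Q : Type*} [MeasurableSpace Q] (t : ℕ) {q : Ω → Q}
    (hq : Measurable[history s a t] q) {f : (Q × S) × (A × S) → ℝ} {B : ℝ} (hf : Measurable f)
    (hb : ∀ z, ‖f z‖ ≤ B) :
    ∫ ω, f ((q ω, s t ω), (a t ω, s (t + 1) ω)) ∂Pr
      = ∫ ω, ∫ y, f ((q ω, s t ω), y) ∂(M.step (s t ω)) ∂Pr := by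
  have hr : Measurable fun ω => (q ω, s t ω) :=
    (hq.mono (h.history_le t) le_rfl).prodMk (h.measurable_s t)
  have hy : Measurable fun ω => (a t ω, s (t + 1) ω) :=
    (h.measurable_a t).prodMk (h.measurable_s (t + 1))
  have : IsProbabilityMeasure (Pr.map fun ω => (q ω, s t ω)) :=
    Measure.isProbabilityMeasure_map hr.aemeasurable
  rw [← integral_map (φ := fun ω => ((q ω, s t ω), (a t ω, s (t + 1) ω)))
    (hr.prodMk hy).aemeasurable hf.aestronglyMeasurable, h.map_eq_compProd t hq,
    Measure.integral_compProd (integrable_of_norm_le hf.aestronglyMeasurable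
      (Filter.Eventually.of_forall hb))]
  have hm : StronglyMeasurable fun z : Q × S =>
      ∫ y, f (z, y) ∂(M.step.comap Prod.snd measurable_snd : Kernel (Q × S) (A × S)) z :=
    hf.stronglyMeasurable.integral_kernel_prod_right'
  rw [integral_map hr.aemeasurable hm.aestronglyMeasurable]
  rfl

/-- Law of a later state, given a function `q` of the past. -/
theorem integral_later {Q : Type*} [MeasurableSpace Q] (t : ℕ) {q : Ω → Q}
    (hq : Measurable[history s a t] q) (j : ℕ) {B : ℝ} : ∀ {f : Q × S → ℝ}, Measurable f →
    (∀ z, ‖f z‖ ≤ B) → ∫ ω, f (q ω, s (t + j) ω) ∂Pr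
      = ∫ ω, ∫ s', f (q ω, s') ∂((M.stateKernel ^ j) (s t ω)) ∂Pr := by
  induction j with
  | zero =>
    intro f hf hb
    congr 1
    funext ω
    have : (M.stateKernel ^ 0) (s t ω) = Measure.dirac (s t ω) := by
      rw [pow_zero]
      exact Kernel.id_apply _
    rw [this, integral_dirac' (fun s' => f (q ω, s')) _
      (hf.comp measurable_prodMk_left).stronglyMeasurable]
    rfl
  | succ j ih =>
    intro f hf hb
    have hq' : Measurable[history s a (t + j)] q :=
      hq.mono (history_mono s a (Nat.le_add_right t j)) le_rfl
    -- The last transition is integrated out first. What remains is a function of `q` and the state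
    -- at time `t + j`, to which the induction hypothesis applies.
    have h1 := h.integral_step (t + j) hq' (f := fun z => f (z.1.1, z.2.2)) (B := B)
      (hf.comp (measurable_fst.fst.prodMk measurable_snd.snd)) fun z => hb _
    have h2 : ∀ z : Q × S, ∫ y, f (z.1, y.2) ∂(M.step z.2)
        = ∫ s', f (z.1, s') ∂(M.stateKernel z.2) := fun z => by
      rw [OffPolicyMDP.stateKernel, Kernel.snd_apply, integral_map (f := fun s' => f (z.1, s'))
        measurable_snd.aemeasurable (hf.comp measurable_prodMk_left).aestronglyMeasurable]
    have hm : StronglyMeasurable fun z : Q × S => ∫ s', f (z.1, s') ∂(M.stateKernel z.2) := by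
      have hf2 : StronglyMeasurable fun w : (Q × S) × S => f (w.1.1, w.2) :=
        (hf.comp (measurable_fst.fst.prodMk measurable_snd)).stronglyMeasurable
      exact hf2.integral_kernel_prod_right'
        (κ := (M.stateKernel.comap Prod.snd measurable_snd : Kernel (Q × S) S))
    have h3 := ih (f := fun z => ∫ s', f (z.1, s') ∂(M.stateKernel z.2)) hm.measurable fun z =>
      norm_integral_le (Filter.Eventually.of_forall fun s' => hb _)
    have h4 : ∀ ω, ∫ y, f (q ω, y.2) ∂(M.step (s (t + j) ω))
        = ∫ s', f (q ω, s') ∂(M.stateKernel (s (t + j) ω)) := fun ω => h2 (q ω, s (t + j) ω)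
    simp only [h4] at h1
    rw [← add_assoc, h1, h3]
    congr 1
    funext ω
    have hpow : M.stateKernel ^ (j + 1) = M.stateKernel ∘ₖ (M.stateKernel ^ j) := pow_succ' _ j
    rw [hpow]
    exact (Kernel.integral_comp (integrable_of_norm_le
      (hf.comp measurable_prodMk_left).aestronglyMeasurable
      (Filter.Eventually.of_forall fun s' => hb _))).symm

/-- Only the one-step conditional law matters, so the law of the initial state can be arbitrary; the
past variable is taken trivial. -/
theorem ae_sample {p : S × A × S → Prop} (hp : MeasurableSet {x | p x})
    (hs : ∀ s₀, ∀ᵐ y ∂(M.step s₀), p (s₀, y)) :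
    ∀ᵐ ω ∂Pr, ∀ t, p (s t ω, a t ω, s (t + 1) ω) := by
  rw [ae_all_iff]
  intro t
  have hr : Measurable fun ω => ((), s t ω) := measurable_const.prodMk (h.measurable_s t)
  have hy : Measurable fun ω => (a t ω, s (t + 1) ω) :=
    (h.measurable_a t).prodMk (h.measurable_s (t + 1))
  have h1 := h.map_eq_compProd t (q := fun _ => ()) measurable_const
  have hpm : MeasurableSet {z : (Unit × S) × (A × S) | p (z.1.2, z.2)} :=
    hp.preimage (measurable_fst.snd.prodMk measurable_snd)
  have h2 : ∀ᵐ z ∂((Pr.map fun ω => ((), s t ω)) ⊗ₘ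
      (M.step.comap Prod.snd measurable_snd : Kernel (Unit × S) (A × S))), p (z.1.2, z.2) :=
    Measure.ae_compProd_of_ae_ae hpm (Filter.Eventually.of_forall fun z => hs z.2)
  rw [← h1] at h2
  exact ae_of_ae_map (hr.prodMk hy).aemeasurable h2

/-- A bounded function of a sample and of the information available `j` steps before has nearly the
expectation obtained from an independent stationary sample. -/
theorem integral_mixing {μ : Measure S} [IsProbabilityMeasure μ] {m κ : ℝ}
    (hE : M.GeomErgodic μ m κ) {Q : Type*} [MeasurableSpace Q] (t : ℕ) {q : Ω → Q}
    (hq : Measurable[history s a t] q) {j : ℕ} (hj : 0 < j) {f : (S × A × S) × Q → ℝ} {B : ℝ}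
    (hf : Measurable f) (hb : ∀ z, ‖f z‖ ≤ B) :
    ∫ ω, f ((s (t + j) ω, a (t + j) ω, s (t + j + 1) ω), q ω) ∂Pr
      ≤ ∫ ω, ∫ x, f (x, q ω) ∂(M.sampleLaw μ) ∂Pr + 2 * B * (m * κ ^ j) := by
  have hq' : Measurable[history s a (t + j)] q :=
    hq.mono (history_mono s a (Nat.le_add_right t j)) le_rfl
  have hqm : Measurable q := hq.mono (h.history_le t) le_rfl
  obtain ⟨ω₀⟩ : Nonempty Ω := Pr.nonempty_of_neZero
  obtain ⟨s₀⟩ : Nonempty S := μ.nonempty_of_neZero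
  have hB : 0 ≤ B := (norm_nonneg _).trans (hb ((s 0 ω₀, a 0 ω₀, s 0 ω₀), q ω₀))
  -- Integrating out the action and the next state leaves a function of the past and the current
  -- state, so that mixing of the state chain alone is enough.
  set ψ : Q × S → ℝ := fun z => ∫ y, f ((z.2, y), z.1) ∂(M.step z.2) with hψ
  have hψm : Measurable ψ := by
    have hf2 : StronglyMeasurable fun w : (Q × S) × (A × S) => f ((w.1.2, w.2), w.1.1) :=
      (hf.comp ((measurable_fst.snd.prodMk measurable_snd).prodMk
        measurable_fst.fst)).stronglyMeasurable
    exact (hf2.integral_kernel_prod_right'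
      (κ := (M.step.comap Prod.snd measurable_snd : Kernel (Q × S) (A × S)))).measurable
  have hψb : ∀ z, ‖ψ z‖ ≤ B := fun z =>
    norm_integral_le (Filter.Eventually.of_forall fun y => hb _)
  have h1 := h.integral_step (t + j) hq' (f := fun z => f ((z.1.2, z.2), z.1.1)) (B := B)
    (hf.comp ((measurable_fst.snd.prodMk measurable_snd).prodMk measurable_fst.fst)) fun z => hb _
  have h2 := h.integral_later t hq j hψm hψb
  have h3 : ∀ ω, ∫ x, f (x, q ω) ∂(M.sampleLaw μ) = ∫ s', ψ (q ω, s') ∂μ := fun ω => by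
    rw [OffPolicyMDP.sampleLaw, Measure.integral_compProd]
    exact integrable_of_norm_le (hf.comp measurable_prodMk_right).aestronglyMeasurable
      (Filter.Eventually.of_forall fun x => hb _)
  have h4 : ∀ ω, ∫ s', ψ (q ω, s') ∂((M.stateKernel ^ j) (s t ω))
      ≤ ∫ s', ψ (q ω, s') ∂μ + 2 * B * (m * κ ^ j) := fun ω => by
    have d1 := abs_integral_sub_le_tvDist ((M.stateKernel ^ j) (s t ω)) μ
      (hψm.comp (measurable_prodMk_left (x := q ω))) fun s' => hψb (q ω, s')
    have d2 := (abs_le.1 d1).2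
    have d3 : 2 * B * tvDist ((M.stateKernel ^ j) (s t ω)) μ ≤ 2 * B * (m * κ ^ j) := by
      gcongr
      exact hE j hj (s t ω)
    simp only [Function.comp_apply] at d2
    linarith
  have i1 : Integrable (fun ω => ∫ s', ψ (q ω, s') ∂μ) Pr := by
    refine integrable_of_norm_le (K := B) ?_ (Filter.Eventually.of_forall fun ω =>
      norm_integral_le (Filter.Eventually.of_forall fun s' => hψb _))
    exact (hψm.stronglyMeasurable.integral_prod_right'.comp_measurable hqm).aestronglyMeasurable
  have i2 : Integrable (fun ω => ∫ s', ψ (q ω, s') ∂((M.stateKernel ^ j) (s t ω))) Pr := by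
    refine integrable_of_norm_le (K := B) ?_ (Filter.Eventually.of_forall fun ω =>
      norm_integral_le (Filter.Eventually.of_forall fun s' => hψb _))
    have hf2 : StronglyMeasurable fun w : (Q × S) × S => ψ (w.1.1, w.2) :=
      (hψm.comp (measurable_fst.fst.prodMk measurable_snd)).stronglyMeasurable
    exact ((hf2.integral_kernel_prod_right'
      (κ := ((M.stateKernel ^ j).comap Prod.snd measurable_snd : Kernel (Q × S) S))).comp_measurable
      (hqm.prodMk (h.measurable_s t))).aestronglyMeasurable
  calc ∫ ω, f ((s (t + j) ω, a (t + j) ω, s (t + j + 1) ω), q ω) ∂Pr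
      = ∫ ω, ψ (q ω, s (t + j) ω) ∂Pr := h1
    _ = ∫ ω, ∫ s', ψ (q ω, s') ∂((M.stateKernel ^ j) (s t ω)) ∂Pr := h2
    _ ≤ ∫ ω, (∫ s', ψ (q ω, s') ∂μ + 2 * B * (m * κ ^ j)) ∂Pr :=
        integral_mono i2 (i1.add (integrable_const _)) h4
    _ = _ := by
      rw [integral_add i1 (integrable_const _)]
      simp [h3]

end Trajectory

end Trajectory

/-! ### The uniformly sampled output -/

section Uniform

variable {Ω P : Type*} [MeasurableSpace Ω] [MeasurableSpace P] {Pr : Measure Ω}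
  [IsProbabilityMeasure Pr] {T : ℕ} {W : Ω → ℕ}

theorem IsUniformIndex.ae_lt (hW : IsUniformIndex Pr T W) (hT : 1 ≤ T) : ∀ᵐ ω ∂Pr, W ω < T := by
  have hm : MeasurableSet {ω | W ω < T} := measurableSet_lt hW.1 measurable_const
  have hU : {ω | W ω < T} = ⋃ t ∈ Finset.range T, W ⁻¹' {t} := by
    ext ω
    simp
  have h1 : Pr.real {ω | W ω < T} = 1 := by
    rw [hU, measureReal_biUnion_finset]
    · rw [Finset.sum_congr rfl fun t ht => hW.2 t (Finset.mem_range.1 ht)]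
      have : (T : ℝ) ≠ 0 := by positivity
      simp [this]
    · intro i _ j _ hij
      exact Set.disjoint_left.2 fun ω h1 h2 => hij (h1.symm.trans h2)
    · exact fun t _ => hW.1 (measurableSet_singleton t)
  have h2 : Pr {ω | W ω < T} = 1 := by
    rw [← ENNReal.toReal_eq_one_iff]
    exact h1
  exact (mem_ae_iff_prob_eq_one hm).2 h2

/-- The expectation at an independent uniform index is the average of the expectations. -/
theorem uniform_average (hW : IsUniformIndex Pr T W) (hT : 1 ≤ T) {Y : Ω → P} (hY : Measurable Y)
    (hind : IndepFun W Y Pr) {F : ℕ → P → ℝ} (hF : ∀ t, Measurable (F t)) {B : ℝ}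
    (hB : ∀ t y, ‖F t y‖ ≤ B) :
    Integrable (fun ω => F (W ω) (Y ω)) Pr ∧
      ∫ ω, F (W ω) (Y ω) ∂Pr = (1 / T) * ∑ t ∈ Finset.range T, ∫ ω, F t (Y ω) ∂Pr := by
  have hFm : Measurable fun q : ℕ × P => F q.1 q.2 := measurable_from_prod_countable_right hF
  have hi : Integrable (fun ω => F (W ω) (Y ω)) Pr :=
    integrable_of_norm_le (hFm.comp (hW.1.prodMk hY)).aestronglyMeasurable
      (Filter.Eventually.of_forall fun ω => hB _ _)
  refine ⟨hi, ?_⟩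
  set ind : ℕ → ℕ → ℝ := fun t => Set.indicator {t} (fun _ => (1 : ℝ)) with hind_def
  have him : ∀ t, Measurable (ind t) := fun t => measurable_of_countable _
  -- Split according to the value of `W`. Each indicator is independent of `Y` and has mean `1 / T`.
  have h1 : ∫ ω, F (W ω) (Y ω) ∂Pr
      = ∫ ω, ∑ t ∈ Finset.range T, ind t (W ω) * F t (Y ω) ∂Pr := by
    refine integral_congr_ae ?_
    filter_upwards [hW.ae_lt hT] with ω hω
    rw [Finset.sum_eq_single (W ω)]
    · simp [hind_def]
    · intro t _ ht
      simp [hind_def, ht.symm]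
    · intro h
      exact absurd (Finset.mem_range.2 hω) h
  have hint : ∀ t, Integrable (fun ω => ind t (W ω) * F t (Y ω)) Pr := fun t => by
    refine integrable_of_norm_le (K := B)
      (((him t).comp hW.1).mul ((hF t).comp hY)).aestronglyMeasurable
      (Filter.Eventually.of_forall fun ω => ?_)
    rw [norm_mul]
    have h2 : ‖ind t (W ω)‖ ≤ 1 := by
      simp only [hind_def, Set.indicator]
      split_ifs <;> simp
    have h3 := hB t (Y ω)
    nlinarith [norm_nonneg (F t (Y ω)), norm_nonneg (ind t (W ω))]
  rw [h1, integral_finsetSum _ fun t _ => hint t, Finset.mul_sum]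
  refine Finset.sum_congr rfl fun t ht => ?_
  have hit : IndepFun (fun ω => ind t (W ω)) (fun ω => F t (Y ω)) Pr :=
    hind.comp (him t) (hF t)
  rw [hit.integral_fun_mul_eq_mul_integral ((him t).comp hW.1).aestronglyMeasurable
    ((hF t).comp hY).aestronglyMeasurable]
  congr 1
  rw [← hW.2 t (Finset.mem_range.1 ht)]
  have : (fun ω => ind t (W ω)) = (W ⁻¹' {t}).indicator 1 := by
    funext ω
    by_cases hωt : W ω = t <;> simp [hind_def, hωt]
  rw [this, integral_indicator_one (hW.1 (measurableSet_singleton t))]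

end Uniform

/-! ### Averages along runs -/

section Average

variable {X : Type*} [MeasurableSpace X] {N : ℕ} {Ω : Type*} [MeasurableSpace Ω] {Pr : Measure Ω}
  [IsProbabilityMeasure Pr] {ν : Measure X} {slow fast : X → Param N → Param N → Param N}
  {good : Set X} {J : Param N → ℝ} {g ws : Param N → Param N} {D : Param N → Param N →L[ℝ] Param N}
  {c lam R α β : ℝ} {x : ℕ → Ω → X} {p : ℕ → Ω → Param N × Param N}

/-- Bound of the Lyapunov function. -/
def lyapConst (c lam : ℝ) : ℝ := c + 4 * trackWeight c lam * c ^ 2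

/-- Second-order error of a step. -/
def stepConst (c lam : ℝ) : ℝ := (8 * trackWeight c lam + 1) * c ^ 4

namespace TwoTimescale

variable (h : TwoTimescale ν slow fast good J g ws D c lam R)
include h

theorem lyapConst_nonneg : 0 ≤ lyapConst c lam := by
  have := h.c_pos
  have := h.trackWeight_pos
  unfold lyapConst
  positivity

theorem stepConst_nonneg : 0 ≤ stepConst c lam := by
  have := h.c_pos
  have := h.trackWeight_pos
  unfold stepConst
  positivity

theorem driftConst_nonneg : 0 ≤ driftConst c (trackWeight c lam) := by
  have := h.c_pos
  have := h.trackWeight_pos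
  unfold driftConst
  positivity

/-- The descent estimate starts at time 1; the summand at time 0 is bounded by `c ^ 2` and
contributes `c ^ 2 * (1 / T)`. -/
theorem average_le (hgm : MeasurableSet good) (hr : Run slow fast α β R x p)
    (hx : ∀ t, Measurable (x t)) (hgood : ∀ᵐ ω ∂Pr, ∀ t, x t ω ∈ good)
    (hα : 0 < α) (hβ : 0 < β) (hε0 : α / β ≤ stepRatio c lam) (η : ℕ → ℝ)
    (hη : ∀ t, 1 ≤ t →
      ∫ ω, truncDrift (driftTerm slow fast g ws D (trackWeight c lam) (α / β)) good R
        (x t ω, p t ω) ∂Pr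
      ≤ ∫ ω, (∫ a, truncDrift (driftTerm slow fast g ws D (trackWeight c lam) (α / β)) good R
        (a, p t ω) ∂ν) ∂Pr + η t) {T : ℕ} (hT : 1 ≤ T) :
    (1 / T) * ∑ t ∈ Finset.range T, ∫ ω, ‖g (p t ω).1‖ ^ 2 ∂Pr
      ≤ c ^ 2 * (1 / T) + 16 * lyapConst c lam * (1 / (α * T))
        + 8 * (1 / T * ∑ t ∈ Finset.range T, η (t + 1)) + 8 * stepConst c lam * β := by
  have hT0 : (0 : ℝ) < T := by positivity
  have h1 := h.sum_grad_le hgm hr hx hgood hα hβ hε0 η hη T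
  set E : ℕ → ℝ := fun t => ∫ ω, ‖g (p t ω).1‖ ^ 2 ∂Pr with hE
  have hE0 : ∀ t, 0 ≤ E t := fun t => integral_nonneg fun ω => by positivity
  have hE1 : E 0 ≤ c ^ 2 := by
    refine (Real.le_norm_self _).trans (norm_integral_le
      (f := fun ω => ‖g (p 0 ω).1‖ ^ 2) (Filter.Eventually.of_forall fun ω => ?_))
    rw [norm_pow, norm_norm]
    have := h.grad_le (p 0 ω).1
    gcongr
  have h2 : ∑ t ∈ Finset.range T, E t ≤ c ^ 2 + ∑ t ∈ Finset.range T, E (t + 1) := by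
    have h3 : ∑ t ∈ Finset.range T, E t ≤ ∑ t ∈ Finset.range (T + 1), E t := by
      rw [Finset.sum_range_succ]
      linarith [hE0 T]
    rw [Finset.sum_range_succ'] at h3
    linarith
  have h4 : ∑ t ∈ Finset.range T, E (t + 1) ≤ (1 / α) * (16 * lyapConst c lam
      + 8 * α * ∑ t ∈ Finset.range T, η (t + 1) + 8 * T * (stepConst c lam * (α * β))) := by
    have h5 : ∑ t ∈ Finset.range T, E (t + 1)
        = (1 / α) * (α * ∑ t ∈ Finset.range T, E (t + 1)) := by field_simp
    rw [h5]
    gcongr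
    exact h1
  calc (1 / T) * ∑ t ∈ Finset.range T, E t
      ≤ (1 / T) * (c ^ 2 + (1 / α) * (16 * lyapConst c lam
      + 8 * α * ∑ t ∈ Finset.range T, η (t + 1) + 8 * T * (stepConst c lam * (α * β)))) := by
        gcongr
        exact h2.trans (by gcongr)
    _ = _ := by
        field_simp
        ring

/-- The average is bounded, whatever the step sizes. -/
theorem average_le_sq {T : ℕ} (hT : 1 ≤ T) :
    (1 / T) * ∑ t ∈ Finset.range T, ∫ ω, ‖g (p t ω).1‖ ^ 2 ∂Pr ≤ c ^ 2 := by
  have hT0 : (0 : ℝ) < T := by positivity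
  have hE1 : ∀ t, ∫ ω, ‖g (p t ω).1‖ ^ 2 ∂Pr ≤ c ^ 2 := fun t => by
    refine (Real.le_norm_self _).trans (norm_integral_le
      (f := fun ω => ‖g (p t ω).1‖ ^ 2) (Filter.Eventually.of_forall fun ω => ?_))
    rw [norm_pow, norm_norm]
    have := h.grad_le (p t ω).1
    gcongr
  have h2 : ∑ t ∈ Finset.range T, ∫ ω, ‖g (p t ω).1‖ ^ 2 ∂Pr ≤ T * c ^ 2 := by
    refine (Finset.sum_le_sum fun t _ => hE1 t).trans (le_of_eq ?_)
    simp
  calc _ ≤ (1 / (T : ℝ)) * (T * c ^ 2) := by gcongr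
    _ = c ^ 2 := by field_simp

/-- Averages under independent sampling. -/
theorem average_le_of_iid (hgm : MeasurableSet good) (hr : Run slow fast α β R x p)
    (hx : ∀ t, Measurable (x t)) (hindep : iIndepFun x Pr) (hlaw : ∀ t, Pr.map (x t) = ν)
    (hα : 0 < α) (hβ : 0 < β) (hε0 : α / β ≤ stepRatio c lam) {T : ℕ} (hT : 1 ≤ T) :
    (1 / T) * ∑ t ∈ Finset.range T, ∫ ω, ‖g (p t ω).1‖ ^ 2 ∂Pr
      ≤ c ^ 2 * (1 / T) + 16 * lyapConst c lam * (1 / (α * T)) + 8 * stepConst c lam * β := by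
  have hgood : ∀ᵐ ω ∂Pr, ∀ t, x t ω ∈ good := by
    rw [ae_all_iff]
    intro t
    have := h.ae_good
    rw [← hlaw t] at this
    exact ae_of_ae_map (hx t).aemeasurable this
  have hε : 0 ≤ α / β := by positivity
  have hε1 : α / β ≤ 1 := hε0.trans (min_le_left _ _)
  have key := h.average_le hgm hr hx hgood hα hβ hε0 (fun _ => 0) (fun t _ => by
    -- The iterate at time `t` is a function of the samples with index below `t`, hence independent
    -- of the sample used at time `t`.
    have hpt : Measurable[⨆ i ∈ Set.Iio t, MeasurableSpace.comap (x i) inferInstance] (p t) := by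
      refine hr.measurable_filtration h.measurable_slow h.measurable_fast
        (m := fun t => ⨆ i ∈ Set.Iio t, MeasurableSpace.comap (x i) inferInstance) ?_ ?_ t
      · exact fun _ _ hle => biSup_mono fun _ hi => lt_of_lt_of_le hi hle
      · intro t
        exact Measurable.mono (comap_measurable (x t))
          (le_biSup (fun i => MeasurableSpace.comap (x i) inferInstance)
            (show t ∈ Set.Iio (t + 1) from Nat.lt_succ_self t)) le_rfl
    have hI : Indep (⨆ i ∈ ({t} : Set ℕ), MeasurableSpace.comap (x i) inferInstance)
        (⨆ i ∈ Set.Iio t, MeasurableSpace.comap (x i) inferInstance) Pr :=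
      indep_iSup_of_disjoint (fun i => (hx i).comap_le) hindep.iIndep
        (Set.disjoint_singleton_left.2 (lt_irrefl t))
    have hif : IndepFun (x t) (p t) Pr := by
      rw [IndepFun_iff_Indep]
      refine indep_of_indep_of_le_left (indep_of_indep_of_le_right hI hpt.comap_le) ?_
      exact le_biSup (fun i => MeasurableSpace.comap (x i) inferInstance) (Set.mem_singleton t)
    rw [add_zero]
    exact (h.noise_of_indep hgm h.trackWeight_pos.le hε hε1 (hx t)
      (h.run_measurable hr hx t) (hlaw t) hif).le) hT
  simpa using key

end TwoTimescale

end Average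

/-! ### Averages under Markovian sampling -/

section Markov

variable {S A : Type*} [MeasurableSpace S] [MeasurableSpace A] {N : ℕ}
  {Ω : Type*} [MeasurableSpace Ω] {Pr : Measure Ω} [IsProbabilityMeasure Pr]
  {M : OffPolicyMDP S A} {μ : Measure S} [IsProbabilityMeasure μ]
  {slow fast : S × A × S → Param N → Param N → Param N}
  {good : Set (S × A × S)} {J : Param N → ℝ} {g ws : Param N → Param N}
  {D : Param N → Param N →L[ℝ] Param N} {c lam R α β : ℝ} {p : ℕ → Ω → Param N × Param N}
  {s : ℕ → Ω → S} {a : ℕ → Ω → A}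

/-- Averages along a trajectory; `j` is the number of steps allowed for mixing. -/
theorem TwoTimescale.average_le_of_trajectory
    (h : TwoTimescale (M.sampleLaw μ) slow fast good J g ws D c lam R)
    (hgm : MeasurableSet good) (htr : Trajectory M Pr s a)
    (hr : Run slow fast α β R (fun t ω => (s t ω, a t ω, s (t + 1) ω)) p)
    (hgood : ∀ s₀, ∀ᵐ y ∂(M.step s₀), (s₀, y) ∈ good) {m κ : ℝ} (hm : 0 ≤ m) (hκ : 0 ≤ κ)
    (hE : M.GeomErgodic μ m κ)
    (hα : 0 < α) (hβ : 0 < β) (hε0 : α / β ≤ stepRatio c lam) {j : ℕ} (hj : 0 < j) {T : ℕ}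
    (hT : 1 ≤ T) :
    (1 / T) * ∑ t ∈ Finset.range T, ∫ ω, ‖g (p t ω).1‖ ^ 2 ∂Pr
      ≤ c ^ 2 * (1 / T) + 16 * lyapConst c lam * (1 / (α * T)) + 8 * stepConst c lam * β
        + 16 * driftConst c (trackWeight c lam) * (j * (1 / T) + c * (j * β) + m * κ ^ j) := by
  set L := driftConst c (trackWeight c lam) with hL
  have hL0 : 0 ≤ L := h.driftConst_nonneg
  have hk0 := h.trackWeight_pos.le
  have hc0 := h.c_pos
  have hε : 0 ≤ α / β := by positivity
  have hε1 : α / β ≤ 1 := hε0.trans (min_le_left _ _)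
  have hαβ : α ≤ β := by rwa [div_le_one hβ] at hε1
  have hxm : ∀ t, Measurable fun ω => (s t ω, a t ω, s (t + 1) ω) := fun t =>
    (htr.measurable_s t).prodMk ((htr.measurable_a t).prodMk (htr.measurable_s (t + 1)))
  have hpm := h.run_measurable hr hxm
  have hg : ∀ᵐ ω ∂Pr, ∀ t, (s t ω, a t ω, s (t + 1) ω) ∈ good :=
    htr.ae_sample (p := fun x => x ∈ good) hgm hgood
  have hph : ∀ t, Measurable[history s a t] (p t) :=
    hr.measurable_filtration h.measurable_slow h.measurable_fast (history_mono s a) fun t =>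
      (measurable_state_history s a (Nat.le_succ t)).prodMk
        ((measurable_action_history s a (Nat.lt_succ_self t)).prodMk
          (measurable_state_history s a le_rfl))
  have hZm := h.measurable_truncDrift hgm (trackWeight c lam) (α / β)
  have hZb := h.abs_truncDrift_le hk0 hε hε1
  set late : ℝ := 2 * L * (j * (c * β)) + 2 * L * (m * κ ^ j) with hlate
  have hlate0 : 0 ≤ late := by positivity
  -- For `t ≤ j` one cannot go back `j` steps and stay at a time at least 1, so the noise is bounded
  -- trivially by `2 * L`; at most `j` such times occur. Later times pay for the displacement over
  -- `j` steps and for the mixing error.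
  have key := h.average_le hgm hr hxm hg hα hβ hε0
    (fun t => (if t ≤ j then 2 * L else 0) + late) (fun t ht => by
      split_ifs with htj
      · have b1 := norm_integral_le (ν := Pr) (Filter.Eventually.of_forall fun ω =>
          hZb ((s t ω, a t ω, s (t + 1) ω), p t ω))
        have b2 := norm_integral_le (ν := Pr) (Filter.Eventually.of_forall fun ω =>
          norm_integral_le (ν := M.sampleLaw μ) (Filter.Eventually.of_forall fun y =>
            hZb (y, p t ω)))
        have b1' := (_root_.abs_le.1 b1).2
        have b2' := (_root_.abs_le.1 b2).1
        linarith
      · push Not at htj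
        rw [zero_add]
        have ht1 : 1 ≤ t - j := by omega
        have htj' : t - j + j = t := by omega
        refine h.noise_le_delayed hgm hk0 hε hε1 (hxm t) (hpm t) (hpm (t - j))
          (hr.mem_tube h.radius_nonneg ht) (hr.mem_tube h.radius_nonneg ht1)
          (hg.mono fun ω hω => hω t) (hg.mono fun ω hω => ?_) ?_
        · have := h.run_dist_le hr hα.le hβ.le hαβ ht1 hω j
          rwa [htj'] at this
        · have := htr.integral_mixing hE (t - j) (hph (t - j)) hj hZm hZb
          rwa [htj'] at this) hT
  refine key.trans ?_
  have hT0 : (0 : ℝ) < T := by positivity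
  have hsum : ∑ t ∈ Finset.range T, ((if t + 1 ≤ j then 2 * L else 0) + late)
      ≤ j * (2 * L) + T * late := by
    rw [Finset.sum_add_distrib, ← Finset.sum_filter, Finset.sum_const, Finset.sum_const,
      Finset.card_range, nsmul_eq_mul, nsmul_eq_mul]
    have hcard : (Finset.filter (fun t => t + 1 ≤ j) (Finset.range T)).card ≤ j := by
      refine (Finset.card_le_card fun t ht => ?_).trans (Finset.card_range j).le
      rw [Finset.mem_range]
      exact (Finset.mem_filter.1 ht).2
    have : ((Finset.filter (fun t => t + 1 ≤ j) (Finset.range T)).card : ℝ) ≤ j := by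
      exact_mod_cast hcard
    gcongr
  have havg : 1 / (T : ℝ) * ∑ t ∈ Finset.range T, ((if t + 1 ≤ j then 2 * L else 0) + late)
      ≤ 2 * L * (j * (1 / T)) + late := by
    calc _ ≤ 1 / (T : ℝ) * (j * (2 * L) + T * late) := by gcongr
      _ = _ := by field_simp
  rw [hlate] at havg ⊢
  linarith

end Markov

/-! ### Runs of the algorithm -/

section Iterate

variable {S A : Type*} [MeasurableSpace S] [MeasurableSpace A]
  [MeasurableSpace.CountableOrCountablyGenerated S A] {N : ℕ}

theorem run_iterate {Ω : Type*} (M : OffPolicyMDP S A) (V : Param N → S → ℝ) (α β R : ℝ)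
    (θ₀ ω₀ : Param N) (x : ℕ → Ω → S × A × S) :
    Run (slowDir M V) (fastDir M V) α β R x
      fun t ω => iterate M V α β R θ₀ ω₀ (fun i => x i ω) t where
  zero := ⟨(θ₀, ω₀), fun _ => rfl⟩
  succ _ _ := rfl

theorem Regular.measurable_grad_iterate {M : OffPolicyMDP S A} {μ : Measure S}
    {V : Param N → S → ℝ} {K R' : ℝ} (h : Regular M μ V K R') {P : Type*} [MeasurableSpace P]
    {x : ℕ → P → S × A × S} (hx : ∀ t, Measurable (x t)) (α β R : ℝ) (θ₀ ω₀ : Param N) (t : ℕ) :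
    Measurable fun y =>
      ‖gradient (mspbe M μ V) (iterate M V α β R θ₀ ω₀ (fun i => x i y) t).1‖ ^ 2 := by
  have hr := run_iterate M V α β R θ₀ ω₀ x
  have hm := hr.measurable_filtration h.measurable_slowDir h.measurable_fastDir
    (m := fun _ => inferInstance) monotone_const hx t
  exact (h.twoTimescale.continuous_grad.measurable.comp hm.fst).norm.pow_const 2

end Iterate

/-! ### Rates -/

section Rates

variable {a b c₀ c₁ c₂ c₃ c₄ α β : ℝ} {T : ℕ}

theorem StepSizes.pos (h : StepSizes a b c₀ c₁ c₂ c₃ c₄ T α β) (hT : 1 ≤ T) (h1 : 0 < c₁)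
    (h3 : 0 < c₃) : 0 < α ∧ 0 < β := by
  have hT0 : (0 : ℝ) < T := by positivity
  exact ⟨(by positivity : 0 < c₁ * (T : ℝ) ^ (-a)).trans_le h.1,
    (by positivity : 0 < c₃ * (T : ℝ) ^ (-b)).trans_le h.2.2.1⟩

/-- The ratio of the step sizes is eventually admissible. -/
theorem exists_ratio_le (hba : b ≤ a) (h0 : 0 < c₀) (h1 : 0 < c₁) (h2 : 0 < c₂) (h3 : 0 < c₃) :
    ∃ T₀ : ℕ, ∀ T α β, 1 ≤ T → T₀ ≤ T → StepSizes a b c₀ c₁ c₂ c₃ c₄ T α β → α / β ≤ c₀ := by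
  rcases hba.eq_or_lt with hab | hab
  · refine ⟨0, fun T α β hT _ h => ?_⟩
    rw [div_le_iff₀ (h.pos hT h1 h3).2]
    exact h.2.2.2.2 hab.symm
  · have hlim : Filter.Tendsto (fun T : ℕ => (T : ℝ) ^ (-(a - b))) Filter.atTop (nhds 0) :=
      (tendsto_rpow_neg_atTop (sub_pos.2 hab)).comp tendsto_natCast_atTop_atTop
    have hpos : 0 < c₀ * c₃ / c₂ := by positivity
    obtain ⟨T₀, hT₀⟩ := Filter.eventually_atTop.1 (hlim.eventually_le_const hpos)
    refine ⟨T₀, fun T α β hT hle h => ?_⟩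
    have hT0 : (0 : ℝ) < T := by positivity
    rw [div_le_iff₀ (h.pos hT h1 h3).2]
    have h4 := hT₀ T hle
    rw [le_div_iff₀ h2] at h4
    calc α ≤ c₂ * (T : ℝ) ^ (-a) := h.2.1
      _ = (T : ℝ) ^ (-(a - b)) * c₂ * (T : ℝ) ^ (-b) := by
        rw [show -a = -(a - b) + -b by ring, Real.rpow_add hT0]
        ring
      _ ≤ c₀ * c₃ * (T : ℝ) ^ (-b) := by gcongr
      _ = c₀ * (c₃ * (T : ℝ) ^ (-b)) := by ring
      _ ≤ c₀ * β := by
        have := h.2.2.1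
        gcongr

theorem one_div_le_rpow (hT : 1 ≤ T) {e : ℝ} (he : -1 ≤ e) : 1 / (T : ℝ) ≤ (T : ℝ) ^ e := by
  have h1 : (1 : ℝ) ≤ T := by exact_mod_cast hT
  rw [one_div, ← Real.rpow_neg_one]
  exact Real.rpow_le_rpow_of_exponent_le h1 he

theorem StepSizes.one_div_le (h : StepSizes a b c₀ c₁ c₂ c₃ c₄ T α β) (hT : 1 ≤ T)
    (h1 : 0 < c₁) : 1 / (α * T) ≤ (T : ℝ) ^ (-(1 - a)) / c₁ := by
  have hT0 : (0 : ℝ) < T := by positivity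
  calc 1 / (α * T) ≤ 1 / (c₁ * (T : ℝ) ^ (-a) * T) := by
        have := h.1
        gcongr
    _ = (T : ℝ) ^ (-(1 - a)) / c₁ := by
        rw [show -(1 - a) = -(-a) - 1 by ring, Real.rpow_sub hT0, Real.rpow_neg hT0.le (-a),
          Real.rpow_one]
        field_simp

/-- A bound for small horizons. -/
theorem le_rate_of_small {E B : ℝ} (hB : 0 ≤ B) (hE : E ≤ B) (hb : 0 ≤ b) (hT : 1 ≤ T) {T₀ : ℕ}
    (hlt : T ≤ T₀) : E ≤ B * T₀ * (T : ℝ) ^ (-(1 - b)) := by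
  have hT0 : (0 : ℝ) < T := by positivity
  have h1 : (1 : ℝ) ≤ T₀ * (T : ℝ) ^ (-(1 - b)) := by
    calc (1 : ℝ) = T * (1 / T) := by field_simp
      _ ≤ T₀ * (T : ℝ) ^ (-(1 - b)) := by
        have h2 : (T : ℝ) ≤ T₀ := by exact_mod_cast hlt
        have := one_div_le_rpow hT (e := -(1 - b)) (by linarith)
        gcongr
  calc E ≤ B * 1 := by linarith
    _ ≤ B * (T₀ * (T : ℝ) ^ (-(1 - b))) := by gcongr
    _ = _ := by ring

/-- For `T ≤ T₀` only `E ≤ B` is used, and T^{-(1-b)} ≥ 1/T ≥ 1/T₀ absorbs it into the constant. For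
larger `T` the other two rates already suffice. -/
theorem rate_of_iid (ha : 0 ≤ a) (hb : 0 ≤ b) (h1 : 0 < c₁) (h4 : 0 < c₄)
    {E B A₁ A₂ : ℝ} (hB : 0 ≤ B) (hA₁ : 0 ≤ A₁) (hA₂ : 0 ≤ A₂) (hT : 1 ≤ T) {T₀ : ℕ}
    (h : StepSizes a b c₀ c₁ c₂ c₃ c₄ T α β) (hE : E ≤ B)
    (hbig : T₀ ≤ T → E ≤ B * (1 / T) + A₁ * (1 / (α * T)) + A₂ * β) :
    E ≤ (B * T₀ + B + A₁ / c₁ + A₂ * c₄)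
      * ((T : ℝ) ^ (-(1 - a)) + (T : ℝ) ^ (-b) + (T : ℝ) ^ (-(1 - b))) := by
  have hT0 : (0 : ℝ) < T := by positivity
  set x := (T : ℝ) ^ (-(1 - a))
  set y := (T : ℝ) ^ (-b)
  set z := (T : ℝ) ^ (-(1 - b))
  have hx : 0 < x := by positivity
  have hy : 0 < y := by positivity
  have hz : 0 < z := by positivity
  rcases le_total T T₀ with hle | hle
  · calc E ≤ B * T₀ * z := le_rate_of_small hB hE hb hT hle
      _ ≤ _ := by
        gcongr
        · have : 0 ≤ B + A₁ / c₁ + A₂ * c₄ := by positivity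
          linarith
        · linarith
  · calc E ≤ B * (1 / T) + A₁ * (1 / (α * T)) + A₂ * β := hbig hle
      _ ≤ B * x + A₁ * (x / c₁) + A₂ * (c₄ * y) := by
        have := h.one_div_le hT h1
        have := h.2.2.2.1
        have := one_div_le_rpow hT (e := -(1 - a)) (by linarith)
        gcongr
      _ = (B + A₁ / c₁) * x + (A₂ * c₄) * y := by ring
      _ ≤ _ := by
        have e1 : 0 ≤ B * T₀ := by positivity
        have e2 : 0 ≤ A₁ / c₁ := by positivity
        have e3 : 0 ≤ A₂ * c₄ := by positivity
        nlinarith [mul_nonneg e1 hx.le, mul_nonneg e1 hy.le, mul_nonneg e1 hz.le,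
          mul_nonneg hB hy.le, mul_nonneg hB hz.le, mul_nonneg e2 hy.le, mul_nonneg e2 hz.le,
          mul_nonneg e3 hx.le, mul_nonneg e3 hz.le]

/-- Number of steps after which the chain has mixed up to `1 / T`. -/
def mixingTime (κ : ℝ) (T : ℕ) : ℕ := ⌈Real.log T / (-Real.log κ)⌉₊

/-- Constant in the logarithmic bound of `mixingTime`. -/
def mixingConst (κ : ℝ) : ℝ := 1 / (-Real.log κ) + 1 / Real.log 2

theorem log_two_le (hT : 2 ≤ T) : Real.log 2 ≤ Real.log T :=
  Real.log_le_log two_pos (by exact_mod_cast hT)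

section

variable {κ : ℝ} (hκ : 0 < κ) (hκ1 : κ < 1)
include hκ hκ1

theorem mixingTime_pos (hT : 2 ≤ T) : 0 < mixingTime κ T := by
  have h1 : 0 < -Real.log κ := neg_pos.2 (Real.log_neg hκ hκ1)
  have h2 : 0 < Real.log T := (Real.log_pos one_lt_two).trans_le (log_two_le hT)
  exact Nat.ceil_pos.2 (by positivity)

theorem pow_mixingTime_le (hT : 1 ≤ T) : κ ^ mixingTime κ T ≤ 1 / T := by
  have hT0 : (0 : ℝ) < T := by positivity
  have h1 : 0 < -Real.log κ := neg_pos.2 (Real.log_neg hκ hκ1)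
  have h2 := (div_le_iff₀ h1).1 (Nat.le_ceil (Real.log T / (-Real.log κ)))
  rw [← Real.log_le_log_iff (by positivity) (by positivity), Real.log_pow, one_div, Real.log_inv]
  unfold mixingTime
  linarith

theorem mixingTime_le (hT : 2 ≤ T) : (mixingTime κ T : ℝ) ≤ mixingConst κ * Real.log T := by
  have h1 : 0 < -Real.log κ := neg_pos.2 (Real.log_neg hκ hκ1)
  have h3 : 0 < Real.log 2 := Real.log_pos one_lt_two
  have h2 : 0 < Real.log T := h3.trans_le (log_two_le hT)
  have h4 := (Nat.ceil_lt_add_one (a := Real.log T / (-Real.log κ)) (by positivity)).le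
  have h5 : 1 ≤ 1 / Real.log 2 * Real.log T := by
    rw [one_div, ← div_eq_inv_mul, one_le_div h3]
    exact log_two_le hT
  calc (mixingTime κ T : ℝ) ≤ Real.log T / (-Real.log κ) + 1 := h4
    _ ≤ Real.log T / (-Real.log κ) + 1 / Real.log 2 * Real.log T := by gcongr
    _ = _ := by
      unfold mixingConst
      ring

theorem mixingConst_pos : 0 < mixingConst κ := by
  have h1 : 0 < -Real.log κ := neg_pos.2 (Real.log_neg hκ hκ1)
  have h3 : 0 < Real.log 2 := Real.log_pos one_lt_two
  unfold mixingConst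
  positivity

/-- At `T = 1` the logarithms vanish and only T^{-(1-b)} carries the bound; the threshold `T₀ + 1`
places this case among the small horizons. For `T ≥ 2`, `log T / log 2 ≥ 1` supplies the logarithm
in terms that lack one. -/
theorem rate_of_trajectory (hb : 0 ≤ b) (hb1 : b ≤ 1) (h1 : 0 < c₁)
    (h4 : 0 < c₄) {E B A₁ A₂ A₃ c m : ℝ} (hB : 0 ≤ B) (hA₁ : 0 ≤ A₁) (hA₂ : 0 ≤ A₂)
    (hA₃ : 0 ≤ A₃) (hc : 0 ≤ c) (hm : 0 ≤ m) (hT : 1 ≤ T) {T₀ : ℕ}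
    (h : StepSizes a b c₀ c₁ c₂ c₃ c₄ T α β) (hE : E ≤ B)
    (hbig : T₀ ≤ T → 2 ≤ T → E ≤ B * (1 / T) + A₁ * (1 / (α * T)) + A₂ * β
      + A₃ * (mixingTime κ T * (1 / T) + c * (mixingTime κ T * β) + m * κ ^ mixingTime κ T)) :
    E ≤ (B * (T₀ + 1 : ℕ) + B * (1 / Real.log 2) + A₁ * (1 / Real.log 2) / c₁
        + A₂ * c₄ * (1 / Real.log 2)
        + A₃ * (mixingConst κ + c * mixingConst κ * c₄ + m * (1 / Real.log 2)))
      * (Real.log T * (T : ℝ) ^ (-(1 - a)) + (T : ℝ) ^ (-(1 - b))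
        + Real.log T * (T : ℝ) ^ (-b)) := by
  have hT0 : (0 : ℝ) < T := by positivity
  have hl0 : 0 ≤ Real.log T := Real.log_natCast_nonneg T
  have hl2 : 0 < Real.log 2 := Real.log_pos one_lt_two
  have hM := mixingConst_pos hκ hκ1
  set q := 1 / Real.log 2 with hq
  have hq0 : 0 < q := by positivity
  set x := (T : ℝ) ^ (-(1 - a))
  set y := (T : ℝ) ^ (-b)
  set z := (T : ℝ) ^ (-(1 - b))
  have hx : 0 < x := by positivity
  have hy : 0 < y := by positivity
  have hz : 0 < z := by positivity
  set l := Real.log T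
  set k := mixingConst κ
  set U := B * q + A₁ * q / c₁ + A₂ * c₄ * q + A₃ * (k + c * k * c₄ + m * q) with hU
  have hU0 : 0 ≤ U := by positivity
  have hBT : 0 ≤ B * (T₀ + 1 : ℕ) := by positivity
  have hCeq : B * (T₀ + 1 : ℕ) + B * q + A₁ * q / c₁ + A₂ * c₄ * q
      + A₃ * (k + c * k * c₄ + m * q) = B * (T₀ + 1 : ℕ) + U := by rw [hU]; ring
  rw [hCeq]
  have hlx : 0 ≤ l * x := by positivity
  have hly : 0 ≤ l * y := by positivity
  rcases le_or_gt T (T₀ + 1) with hle | hlt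
  · calc E ≤ B * (T₀ + 1 : ℕ) * z := le_rate_of_small hB hE hb hT hle
      _ ≤ _ := by
        gcongr
        · linarith
        · linarith
  · have hT2 : 2 ≤ T := by omega
    have hql : 1 ≤ q * l := by
      rw [hq, one_div, ← div_eq_inv_mul, one_le_div hl2]
      exact log_two_le hT2
    have p1 := h.one_div_le hT h1
    have p2 := h.2.2.2.1
    have p4 := one_div_le_rpow hT (e := -b) (by linarith)
    have p5 := mixingTime_le hκ hκ1 hT2
    have p6 := pow_mixingTime_le hκ hκ1 hT
    have hx' : x ≤ q * l * x := le_mul_of_one_le_left hx.le hql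
    have hy' : y ≤ q * l * y := le_mul_of_one_le_left hy.le hql
    have hβ : c₄ * y ≤ c₄ * (q * l * y) := by gcongr
    calc E ≤ B * (1 / T) + A₁ * (1 / (α * T)) + A₂ * β
          + A₃ * (mixingTime κ T * (1 / T) + c * (mixingTime κ T * β)
            + m * κ ^ mixingTime κ T) := hbig (by omega) hT2
      _ ≤ B * (q * l * y) + A₁ * (q * l * x / c₁) + A₂ * (c₄ * (q * l * y))
          + A₃ * (k * l * y + c * (k * l * (c₄ * y)) + m * (q * l * y)) := by
        gcongr ?_ + ?_ + ?_ + _ * (?_ + _ * ?_ + ?_)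
        · gcongr; exact p4.trans hy'
        · exact mul_le_mul_of_nonneg_left (p1.trans (by gcongr)) hA₁
        · gcongr; exact p2.trans hβ
        · gcongr
        · exact (mul_le_mul_of_nonneg_left p2 (by positivity)).trans (by gcongr)
        · gcongr; exact p6.trans (p4.trans hy')
      _ = (A₁ * q / c₁) * (l * x) + (B * q + A₂ * c₄ * q + A₃ * (k + c * k * c₄ + m * q))
          * (l * y) := by ring
      _ ≤ U * (l * x) + U * (l * y) := by
        have e1 : 0 ≤ A₁ * q / c₁ := by positivity
        have e2 : 0 ≤ B * q + A₂ * c₄ * q + A₃ * (k + c * k * c₄ + m * q) := by positivity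
        gcongr
        · linarith
        · linarith
      _ = U * (l * x + l * y) := by ring
      _ ≤ _ := by
        gcongr
        · linarith
        · linarith

end

end Rates

theorem one_le_masterConst {γ rmax Cv Cφ Dv LV lam ρmax : ℝ} (hγ : γ ∈ Set.Icc (0 : ℝ) 1)
    (hrmax : 0 ≤ rmax) (hCv : 0 < Cv) (hCφ : 0 < Cφ) (hDv : 0 < Dv) (hLV : 0 < LV)
    (hlam : 0 < lam) (hρmax : 0 < ρmax) : 1 ≤ masterConst γ rmax Cv Cφ Dv LV lam ρmax := by
  have := hγ.1
  have : 0 ≤ projRadius γ rmax Cv Cφ lam ρmax := by unfold projRadius; positivity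
  have : 0 < 1 / lam := by positivity
  unfold masterConst
  linarith

theorem one_le_schemeConst {K : ℝ} (hK : 1 ≤ K) : 1 ≤ schemeConst K := by
  have hK0 : 0 < K := by linarith
  have h1 : 0 ≤ gramConst K := by unfold gramConst; positivity
  have h2 : 0 ≤ meanTDConst K := by unfold meanTDConst; positivity
  have h3 : 0 ≤ inverseConst K := by unfold inverseConst; positivity
  have h4 : 0 ≤ fastLimitConst K := by unfold fastLimitConst; positivity
  have h5 : 0 ≤ objectiveConst K := by unfold objectiveConst; positivity
  have h6 : 0 ≤ slowConst K := by unfold slowConst; positivity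
  have h7 : 0 ≤ fastConst K := by unfold fastConst; positivity
  unfold schemeConst
  linarith

/-! ### Assembly of the rates -/

section Final

/-- Constant of the rate under independent sampling. -/
def iidRateConst (c lam c₁ c₄ : ℝ) (T₀ : ℕ) : ℝ :=
  c ^ 2 * T₀ + c ^ 2 + 16 * lyapConst c lam / c₁ + 8 * stepConst c lam * c₄

/-- Constant of the rate under Markovian sampling. -/
def trajectoryRateConst (c lam c₁ c₄ m κ : ℝ) (T₀ : ℕ) : ℝ :=
  c ^ 2 * (T₀ + 1 : ℕ) + c ^ 2 * (1 / Real.log 2)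
    + 16 * lyapConst c lam * (1 / Real.log 2) / c₁ + 8 * stepConst c lam * c₄ * (1 / Real.log 2)
    + 16 * driftConst c (trackWeight c lam)
      * (mixingConst κ + c * mixingConst κ * c₄ + m * (1 / Real.log 2))

variable {S A : Type*} [MeasurableSpace S] [MeasurableSpace A]
  [MeasurableSpace.CountableOrCountablyGenerated S A] {N : ℕ} {M : OffPolicyMDP S A}
  {μ : Measure S} {V : Param N → S → ℝ} {K R : ℝ} {Ω : Type*} [MeasurableSpace Ω] {Pr : Measure Ω}
  [IsProbabilityMeasure Pr] {W : Ω → ℕ} {T : ℕ} {α β : ℝ} {θ₀ ω₀ : Param N}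
  {a b c₀ c₁ c₂ c₃ c₄ : ℝ}

/-- The expected squared gradient at the output is the average over the run. -/
theorem Regular.output_average (h : Regular M μ V K R) {P : Type*} [MeasurableSpace P]
    {x : ℕ → P → S × A × S} (hx : ∀ t, Measurable (x t)) {Y : Ω → P} (hY : Measurable Y)
    (hW : IsUniformIndex Pr T W) (hT : 1 ≤ T) (hind : IndepFun W Y Pr) (α β : ℝ)
    (θ₀ ω₀ : Param N) :
    Integrable (fun ω => ‖gradient (mspbe M μ V)
        (iterate M V α β R θ₀ ω₀ (fun i => x i (Y ω)) (W ω)).1‖ ^ 2) Pr ∧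
      ∫ ω, ‖gradient (mspbe M μ V)
        (iterate M V α β R θ₀ ω₀ (fun i => x i (Y ω)) (W ω)).1‖ ^ 2 ∂Pr
      = (1 / T) * ∑ t ∈ Finset.range T, ∫ ω, ‖gradient (mspbe M μ V)
        (iterate M V α β R θ₀ ω₀ (fun i => x i (Y ω)) t).1‖ ^ 2 ∂Pr :=
  uniform_average hW hT hY hind
    (F := fun t y => ‖gradient (mspbe M μ V)
      (iterate M V α β R θ₀ ω₀ (fun i => x i y) t).1‖ ^ 2) (B := schemeConst K ^ 2)
    (fun t => h.measurable_grad_iterate hx α β R θ₀ ω₀ t) fun t y => by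
      rw [norm_pow, norm_norm]
      have := h.twoTimescale.grad_le (iterate M V α β R θ₀ ω₀ (fun i => x i y) t).1
      gcongr

/-- Convergence rate for independent samples. -/
theorem Regular.rate_of_iid (h : Regular M μ V K R) {X : ℕ → Ω → S × A × S}
    (hX : IIDSamples M μ Pr X) (hW : IsUniformIndex Pr T W) (hT : 1 ≤ T)
    (hind : IndepFun W (fun ω t => X t ω) Pr) (ha : 0 ≤ a) (hb : 0 ≤ b)
    (h1 : 0 < c₁) (h3 : 0 < c₃) (h4 : 0 < c₄) {T₀ : ℕ}
    (hT₀ : T₀ ≤ T → α / β ≤ stepRatio (schemeConst K) (1 / K))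
    (hs : StepSizes a b c₀ c₁ c₂ c₃ c₄ T α β) (θ₀ ω₀ : Param N) :
    Integrable (fun ω => ‖gradient (mspbe M μ V)
        (iterate M V α β R θ₀ ω₀ (fun i => X i ω) (W ω)).1‖ ^ 2) Pr ∧
      ∫ ω, ‖gradient (mspbe M μ V)
        (iterate M V α β R θ₀ ω₀ (fun i => X i ω) (W ω)).1‖ ^ 2 ∂Pr
      ≤ iidRateConst (schemeConst K) (1 / K) c₁ c₄ T₀
        * ((T : ℝ) ^ (-(1 - a)) + (T : ℝ) ^ (-b) + (T : ℝ) ^ (-(1 - b))) := by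
  have hS := h.twoTimescale
  obtain ⟨hi, he⟩ := h.output_average (x := fun t (y : ℕ → S × A × S) => y t)
    (fun t => measurable_pi_apply t) (measurable_pi_lambda _ hX.measurable) hW hT hind α β θ₀ ω₀
  refine ⟨hi, he.trans_le ?_⟩
  obtain ⟨hα, hβ⟩ := hs.pos hT h1 h3
  have := hS.lyapConst_nonneg
  have := hS.stepConst_nonneg
  exact NonlinearTDC.rate_of_iid ha hb h1 h4 (by positivity) (by positivity) (by positivity) hT
    hs (hS.average_le_sq (p := fun t ω => iterate M V α β R θ₀ ω₀ (fun i => X i ω) t) hT)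
    fun hle => hS.average_le_of_iid (measurableSet_goodSamples M K)
      (run_iterate M V α β R θ₀ ω₀ X) hX.measurable hX.indep hX.law hα hβ (hT₀ hle) hT

/-- Convergence rate along a trajectory of the behavior policy. -/
theorem Regular.rate_of_trajectory (h : Regular M μ V K R) {s : ℕ → Ω → S} {act : ℕ → Ω → A}
    (htr : Trajectory M Pr s act) {m κ : ℝ} (hm : 0 ≤ m) (hκ : 0 < κ) (hκ1 : κ < 1)
    (hE : M.GeomErgodic μ m κ) (hW : IsUniformIndex Pr T W) (hT : 1 ≤ T)
    (hind : IndepFun W (fun ω t => (s t ω, act t ω)) Pr) (hb : 0 ≤ b) (hb1 : b ≤ 1)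
    (h1 : 0 < c₁) (h3 : 0 < c₃) (h4 : 0 < c₄) {T₀ : ℕ}
    (hT₀ : T₀ ≤ T → α / β ≤ stepRatio (schemeConst K) (1 / K))
    (hs : StepSizes a b c₀ c₁ c₂ c₃ c₄ T α β) (θ₀ ω₀ : Param N) :
    Integrable (fun ω => ‖gradient (mspbe M μ V) (iterate M V α β R θ₀ ω₀
        (fun i => (s i ω, act i ω, s (i + 1) ω)) (W ω)).1‖ ^ 2) Pr ∧
      ∫ ω, ‖gradient (mspbe M μ V) (iterate M V α β R θ₀ ω₀
        (fun i => (s i ω, act i ω, s (i + 1) ω)) (W ω)).1‖ ^ 2 ∂Pr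
      ≤ trajectoryRateConst (schemeConst K) (1 / K) c₁ c₄ m κ T₀
        * (Real.log T * (T : ℝ) ^ (-(1 - a)) + (T : ℝ) ^ (-(1 - b))
          + Real.log T * (T : ℝ) ^ (-b)) := by
  have hS := h.twoTimescale
  have hμ := h.isProb
  -- The index is independent of the path of state-action pairs; the next state of a sample is read
  -- from the following pair, so the whole run is a function of that path.
  obtain ⟨hi, he⟩ := h.output_average
    (x := fun t (y : ℕ → S × A) => ((y t).1, (y t).2, (y (t + 1)).1))
    (fun t => (measurable_pi_apply t).fst.prodMk
      ((measurable_pi_apply t).snd.prodMk (measurable_pi_apply (t + 1)).fst))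
    (measurable_pi_lambda _ fun t => (htr.measurable_s t).prodMk (htr.measurable_a t))
    hW hT hind α β θ₀ ω₀
  refine ⟨hi, he.trans_le ?_⟩
  obtain ⟨hα, hβ⟩ := hs.pos hT h1 h3
  have := hS.lyapConst_nonneg
  have := hS.stepConst_nonneg
  have := hS.driftConst_nonneg
  have hr := run_iterate M V α β R θ₀ ω₀ (fun t ω => (s t ω, act t ω, s (t + 1) ω))
  exact NonlinearTDC.rate_of_trajectory hκ hκ1 hb hb1 h1 h4 (by positivity) (by positivity)
    (by positivity) (by positivity) hS.c_pos.le hm hT hs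
    (hS.average_le_sq (p := fun t ω => iterate M V α β R θ₀ ω₀
      (fun i => (s i ω, act i ω, s (i + 1) ω)) t) hT)
    fun hle hT2 => hS.average_le_of_trajectory (measurableSet_goodSamples M K) htr hr
      (fun s₀ => ae_step_good h.ratio s₀) hm hκ.le hE hα hβ (hT₀ hle)
      (mixingTime_pos hκ hκ1 hT2) hT

end Final

end NonlinearTDC

end

theorem theorem1
    -- the constants of the assumptions
    (γ rmax Cv Cφ Dv LV lam ρmax : ℝ)
    (hγ : γ ∈ Set.Icc (0 : ℝ) 1) (hrmax : 0 ≤ rmax) (hCv : 0 < Cv) (hCφ : 0 < Cφ) (hDv : 0 < Dv)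
    (hLV : 0 < LV) (hlam : 0 < lam) (hρmax : 0 < ρmax) :
    -- the objective is differentiable, so that its gradient is meaningful
    (∀ (S : Type u) (A : Type v) [MeasurableSpace S] [MeasurableSpace A]
      [MeasurableSpace.CountableOrCountablyGenerated S A] (N : ℕ)
      (M : NonlinearTDC.OffPolicyMDP S A) (μ : Measure S) (V : NonlinearTDC.Param N → S → ℝ),
      NonlinearTDC.Assumptions M μ V γ rmax Cv Cφ Dv LV lam ρmax →
      Differentiable ℝ (NonlinearTDC.mspbe M μ V)) ∧
    ∃ c₀ : ℝ, 0 < c₀ ∧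
    ∀ a b c₁ c₂ c₃ c₄ : ℝ, 1 / 2 ≤ a → a ≤ 1 → 0 < b → b ≤ a →
      0 < c₁ → 0 < c₂ → 0 < c₃ → 0 < c₄ →
    -- (1) i.i.d. sampling
    (∃ C : ℝ, ∀ (S : Type u) (A : Type v) [MeasurableSpace S] [MeasurableSpace A]
      [MeasurableSpace.CountableOrCountablyGenerated S A] (N : ℕ)
      (M : NonlinearTDC.OffPolicyMDP S A) (μ : Measure S) (V : NonlinearTDC.Param N → S → ℝ)
      (Ω : Type w) [MeasurableSpace Ω] (Pr : Measure Ω) [IsProbabilityMeasure Pr]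
      (X : ℕ → Ω → S × A × S) (W : Ω → ℕ)
      (θ₀ ω₀ : NonlinearTDC.Param N) (T : ℕ) (α β : ℝ),
      NonlinearTDC.Assumptions M μ V γ rmax Cv Cφ Dv LV lam ρmax →
      NonlinearTDC.IIDSamples M μ Pr X →
      1 ≤ T → NonlinearTDC.IsUniformIndex Pr T W → IndepFun W (fun ω t => X t ω) Pr →
      NonlinearTDC.StepSizes a b c₀ c₁ c₂ c₃ c₄ T α β →
      let θ : ℕ → Ω → NonlinearTDC.Param N := fun t ω =>
        (NonlinearTDC.iterate M V α β (NonlinearTDC.projRadius γ rmax Cv Cφ lam ρmax) θ₀ ω₀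
          (fun i => X i ω) t).1
      Integrable (fun ω => ‖gradient (NonlinearTDC.mspbe M μ V) (θ (W ω) ω)‖ ^ 2) Pr ∧
      ∫ ω, ‖gradient (NonlinearTDC.mspbe M μ V) (θ (W ω) ω)‖ ^ 2 ∂Pr ≤
        C * ((T : ℝ) ^ (-(1 - a)) + (T : ℝ) ^ (-b) + (T : ℝ) ^ (-(1 - b)))) ∧
    -- (2) Markovian sampling
    (∀ m κ : ℝ, 0 < m → 0 < κ → κ < 1 →
      ∃ C : ℝ, ∀ (S : Type u) (A : Type v) [MeasurableSpace S] [MeasurableSpace A]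
      [MeasurableSpace.CountableOrCountablyGenerated S A] (N : ℕ)
      (M : NonlinearTDC.OffPolicyMDP S A) (μ : Measure S) (V : NonlinearTDC.Param N → S → ℝ)
      (Ω : Type w) [MeasurableSpace Ω] (Pr : Measure Ω) [IsProbabilityMeasure Pr]
      (s : ℕ → Ω → S) (act : ℕ → Ω → A) (W : Ω → ℕ)
      (θ₀ ω₀ : NonlinearTDC.Param N) (T : ℕ) (α β : ℝ),
      NonlinearTDC.Assumptions M μ V γ rmax Cv Cφ Dv LV lam ρmax →
      M.GeomErgodic μ m κ →
      NonlinearTDC.Trajectory M Pr s act →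
      1 ≤ T → NonlinearTDC.IsUniformIndex Pr T W →
      IndepFun W (fun ω t => (s t ω, act t ω)) Pr →
      NonlinearTDC.StepSizes a b c₀ c₁ c₂ c₃ c₄ T α β →
      let θ : ℕ → Ω → NonlinearTDC.Param N := fun t ω =>
        (NonlinearTDC.iterate M V α β (NonlinearTDC.projRadius γ rmax Cv Cφ lam ρmax) θ₀ ω₀
          (fun i => (s i ω, act i ω, s (i + 1) ω)) t).1
      Integrable (fun ω => ‖gradient (NonlinearTDC.mspbe M μ V) (θ (W ω) ω)‖ ^ 2) Pr ∧
      ∫ ω, ‖gradient (NonlinearTDC.mspbe M μ V) (θ (W ω) ω)‖ ^ 2 ∂Pr ≤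
        C * (Real.log T * (T : ℝ) ^ (-(1 - a)) + (T : ℝ) ^ (-(1 - b))
          + Real.log T * (T : ℝ) ^ (-b))) := by
  set K := NonlinearTDC.masterConst γ rmax Cv Cφ Dv LV lam ρmax with hK
  have hK1 : 1 ≤ K :=
    NonlinearTDC.one_le_masterConst hγ hrmax hCv hCφ hDv hLV hlam hρmax
  have h0 : 0 < NonlinearTDC.stepRatio (NonlinearTDC.schemeConst K) (1 / K) :=
    NonlinearTDC.stepRatio_pos (NonlinearTDC.one_le_schemeConst hK1) (by positivity)
  refine ⟨fun S A _ _ _ N M μ V h θ =>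
    ((h.regular hγ hrmax hCv hCφ hDv hLV hlam hρmax).hasGradientAt_mspbe θ).differentiableAt,
    _, h0, fun a b c₁ c₂ c₃ c₄ ha ha1 hb hba h1 h2 h3 h4 => ?_⟩
  have ha0 : 0 ≤ a := by linarith
  -- If `b < a`, the step ratio tends to zero and is admissible for large `T`; if `a = b`, the
  -- assumption on c₀ makes it so at once. The threshold does not depend on the model, so it may
  -- enter `C`.
  obtain ⟨T₀, hT₀⟩ := NonlinearTDC.exists_ratio_le (c₄ := c₄) hba h0 h1 h2 h3
  refine ⟨⟨NonlinearTDC.iidRateConst (NonlinearTDC.schemeConst K) (1 / K) c₁ c₄ T₀, ?_⟩,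
    fun m κ hm hκ hκ1 =>
      ⟨NonlinearTDC.trajectoryRateConst (NonlinearTDC.schemeConst K) (1 / K) c₁ c₄ m κ T₀, ?_⟩⟩
  · intro S A _ _ _ N M μ V Ω _ Pr _ X W θ₀ ω₀ T α β h hX hT hW hind hs
    exact (h.regular hγ hrmax hCv hCφ hDv hLV hlam hρmax).rate_of_iid hX hW hT hind ha0 hb.le
      h1 h3 h4 (fun hle => hT₀ T α β hT hle hs) hs θ₀ ω₀
  · intro S A _ _ _ N M μ V Ω _ Pr _ s act W θ₀ ω₀ T α β h hE htr hT hW hind hs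
    exact (h.regular hγ hrmax hCv hCφ hDv hLV hlam hρmax).rate_of_trajectory htr hm.le hκ hκ1 hE
      hW hT hind hb.le (hba.trans ha1) h1 h3 h4 (fun hle => hT₀ T α β hT hle hs) hs θ₀ ω₀
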